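/- Let $G=G_1\times\cdots\times G_n$ be a product of locally compact $\sigma$-compact Hausdorff topological groups, and let $\Gamma<G$ be an irreducible uniform lattice, i.e. a discrete subgroup such that $G/\Gamma$ is compact and the projection of $\Gamma$ to each factor $G_i$ is dense. Let $X$ be a non-empty proper CAT(0) space, and let $\Gamma$ act on $X$ by isometries without global fixed point (no $x\in X$ is fixed by all of $\Gamma$). Let $\partial X$ be the boundary at infinity of $X$ (geodesic rays up to bounded distance) with the cone topology and the induced $\Gamma$-action. Then there is a non-empty closed $\Gamma$-invariant set $\mathscr{C}\subseteq\partial X$ on which the $\Gamma$-action extends continuously to a $G$-action: there is an action of $G$ on $\mathscr{C}$ such that the map $G\times\mathscr{C}\to\mathscr{C}$ is continuous and every $\gamma\in\Gamma$ acts on $\mathscr{C}$ as it does on $\partial X$. Moreover, for some $i\in\{1,\ldots,n\}$ this action factors through the projection $G\to G_i$, i.e. it is the composition of this projection with a continuous action of $G_i$ on $\mathscr{C}$. -/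

import Mathlib

open scoped NNReal

namespace CAT0

/-- `σ`, restricted to `[0, d(x,y)]`, is a geodesic segment from `x` to `y`
(only the values of `σ` on that interval matter). -/
def IsGeodesicSegment {X : Type*} [MetricSpace X] (σ : ℝ → X) (x y : X) : Prop :=
  σ 0 = x ∧ σ (dist x y) = y ∧
    ∀ s ∈ Set.Icc 0 (dist x y), ∀ t ∈ Set.Icc 0 (dist x y), dist (σ s) (σ t) = |s - t|

/-- A CAT(0) space: a geodesic space in which the midpoint of every geodesic segment satisfies
the Bruhat-Tits "courbure négative" inequality. -/
structure IsCAT0 (X : Type*) [MetricSpace X] : Prop where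
  exists_geodesic : ∀ x y : X, ∃ σ : ℝ → X, IsGeodesicSegment σ x y
  cn : ∀ (x c c' : X) (σ : ℝ → X), IsGeodesicSegment σ c c' →
    2 * dist (σ (dist c c' / 2)) x ^ 2 ≤
      dist c' x ^ 2 + dist c x ^ 2 - (1 / 2) * dist c' c ^ 2

/-- A geodesic ray: an isometric map `[0, ∞) → X`. -/
structure Ray (X : Type*) [MetricSpace X] where
  toFun : ℝ≥0 → X
  isometry : Isometry toFun

/-- Two rays are asymptotic if they remain at bounded distance from each other. -/
def Asymptotic {X : Type*} [MetricSpace X] (c c' : Ray X) : Prop :=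
  ∃ K : ℝ, ∀ t : ℝ≥0, dist (c.toFun t) (c'.toFun t) ≤ K

/-- Being asymptotic is an equivalence relation. -/
def raySetoid (X : Type*) [MetricSpace X] : Setoid (Ray X) where
  r := Asymptotic
  iseqv :=
    { refl := fun _ => ⟨0, fun _ => (dist_self _).le⟩
      symm := fun ⟨K, hK⟩ => ⟨K, fun t => by rw [dist_comm]; exact hK t⟩
      trans := fun ⟨K, hK⟩ ⟨L, hL⟩ =>
        ⟨K + L, fun t => (dist_triangle _ _ _).trans (add_le_add (hK t) (hL t))⟩ }

/-- The boundary at infinity `∂X`. -/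
def Boundary (X : Type*) [MetricSpace X] : Type _ := Quotient (raySetoid X)

/-- The point at infinity of a ray. -/
def Ray.endpoint {X : Type*} [MetricSpace X] (c : Ray X) : Boundary X :=
  Quotient.mk (raySetoid X) c

/-- The standard cone neighbourhood `U(c, r, ε)` in `∂X`: the points at infinity of those rays
that start at the origin of `c` and pass at time `r` at distance less than `ε` from `c(r)`. -/
def coneNhd {X : Type*} [MetricSpace X] (c : Ray X) (r : ℝ≥0) (ε : ℝ) : Set (Boundary X) :=
  {ξ | ∃ c' : Ray X, c'.endpoint = ξ ∧ c'.toFun 0 = c.toFun 0 ∧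
    dist (c'.toFun r) (c.toFun r) < ε}

/-- The cone topology on `∂X`, generated by the sets `U(c, r, ε)`. In a complete CAT(0) space,
those with `c` starting at a fixed basepoint are a basis of a topology that does not depend on
the basepoint; hence all basepoints are allowed here. -/
instance coneTopology (X : Type*) [MetricSpace X] : TopologicalSpace (Boundary X) :=
  TopologicalSpace.generateFrom
    {U | ∃ (c : Ray X) (r : ℝ≥0) (ε : ℝ), 0 < ε ∧ U = coneNhd c r ε}

/-- The translate of a ray by an isometry. -/
def Ray.smul {M X : Type*} [MetricSpace X] [Group M] [MulAction M X] [IsIsometricSMul M X]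
    (g : M) (c : Ray X) : Ray X where
  toFun t := g • c.toFun t
  isometry := (isometry_smul X g).comp c.isometry

/-- The action on `∂X` induced by an action on `X` by isometries. -/
instance boundaryMulAction {M X : Type*} [MetricSpace X] [Group M] [MulAction M X]
    [IsIsometricSMul M X] : MulAction M (Boundary X) where
  smul g := Quotient.map (Ray.smul g) fun _ _ ⟨K, hK⟩ =>
    ⟨K, fun t => (dist_smul g _ _).trans_le (hK t)⟩
  one_smul ξ := by
    induction ξ using Quotient.inductionOn with
    | _ c => exact Quotient.sound ⟨0, fun t => by simp [Ray.smul]⟩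
  mul_smul g h ξ := by
    induction ξ using Quotient.inductionOn with
    | _ c => exact Quotient.sound ⟨0, fun t => by simp [Ray.smul, mul_smul]⟩

/-- A uniform lattice: a discrete cocompact subgroup. -/
structure IsUniformLattice {G : Type*} [Group G] [TopologicalSpace G] (Γ : Subgroup G) :
    Prop where
  discrete : DiscreteTopology Γ
  cocompact : CompactSpace (G ⧸ Γ)

/-- A subgroup of a product is irreducible if its projection to each factor is dense. -/
def IsIrreducible {n : ℕ} {G : Fin n → Type*} [∀ i, Group (G i)]
    [∀ i, TopologicalSpace (G i)] (Γ : Subgroup (∀ i, G i)) : Prop :=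
  ∀ i, Dense ((fun g : ∀ j, G j => g i) '' (Γ : Set (∀ j, G j)))

end CAT0

/-!
Since `Γ` is cocompact, there is a continuous map `f₀ : G → X` that is equivariant for left
multiplication by `Γ`, obtained by averaging an orbit. If `Γ` fixes a point at infinity, this point
is the set sought. Otherwise let `H = G j` be a factor on which `f₀` depends, and let `H` act by
right translations on the equivariant maps; the other factors commute with `H`, and one keeps their
displacements below those of `f₀`. The distances of two such maps have a mean square over `Γ \ G`,
and for it the convex closed `H`-invariant sets of maps behave like those of a CAT(0) space:
near-minimizers of the distance to `f₀` in a chain of them either run off to infinity, which gives a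
point at infinity fixed by `Γ`, or are Cauchy. Mean-square convergence becomes uniform after
mollification along `H`, so the sets are asked to be stable under mollification as well, and Zorn's
lemma yields a minimal one, `M`.

Minimality makes `g ↦ d (f g) (f' g)` independent of the other factors for `f, f' ∈ M`, and by the
density of the projection of `Γ` to `H` it is then constant. So evaluation at `1` embeds `M`
isometrically as a closed convex subset of `X`, on which `H` acts by isometries that differ from
those of `Γ` by bounded amounts. If `M` is unbounded, its boundary at infinity is the set sought.
If `M` is bounded, it is a single map, which is invariant under `H` and hence depends on one factor
less than `f₀`. This cannot go on: a map depending on no factor is a fixed point of `Γ`.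
-/

namespace CAT0

/-! ### CAT(0) geometry -/

theorem le_max_of_midpoint_convexOn {ψ : ℝ → ℝ} {a b : ℝ} (hc : ContinuousOn ψ (Set.Icc a b))
    (hm : ∀ s ∈ Set.Icc a b, ∀ t ∈ Set.Icc a b, ψ ((s + t) / 2) ≤ (ψ s + ψ t) / 2)
    {t : ℝ} (ht : t ∈ Set.Icc a b) : ψ t ≤ max (ψ a) (ψ b) := by
  obtain ⟨t₁, ht₁, hmax⟩ := isCompact_Icc.exists_isMaxOn ⟨t, ht⟩ hc
  have hT : IsCompact (Set.Icc a b ∩ ψ ⁻¹' {ψ t₁}) :=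
    isCompact_Icc.of_isClosed_subset
      (hc.preimage_isClosed_of_isClosed isClosed_Icc isClosed_singleton) Set.inter_subset_left
  -- At the first maximum `t₀`, an interior point would have a maximum strictly to its left.
  obtain ⟨t₀, ⟨ht₀, ht₀max : ψ t₀ = ψ t₁⟩, hleast⟩ := hT.exists_isLeast ⟨t₁, ht₁, rfl⟩
  have hle : ∀ s ∈ Set.Icc a b, ψ s ≤ ψ t₀ := fun s hs => (hmax hs).trans_eq ht₀max.symm
  refine (hle t ht).trans ?_
  by_contra! hcon
  have ha : a < t₀ := ht₀.1.lt_of_ne (by rintro rfl; exact (le_max_left _ _).not_gt hcon)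
  have hb : t₀ < b := ht₀.2.lt_of_ne (by rintro rfl; exact (le_max_right _ _).not_gt hcon)
  set s := min (t₀ - a) (b - t₀)
  have hs : 0 < s := lt_min (sub_pos.2 ha) (sub_pos.2 hb)
  have hleft : t₀ - s ∈ Set.Icc a b := ⟨by linarith [min_le_left (t₀ - a) (b - t₀)], by linarith⟩
  have hright : t₀ + s ∈ Set.Icc a b :=
    ⟨by linarith, by linarith [min_le_right (t₀ - a) (b - t₀)]⟩
  have hmid := hm _ hleft _ hright
  rw [show (t₀ - s + (t₀ + s)) / 2 = t₀ by ring] at hmid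
  have hmem : ψ (t₀ - s) = ψ t₁ := by linarith [hle _ hleft, hle _ hright]
  linarith [hleast ⟨hleft, hmem⟩]

/-- `σ` is a geodesic of constant speed `v` on the set of parameters `S`. -/
def IsGeodesicOn {X : Type*} [MetricSpace X] (σ : ℝ → X) (v : ℝ≥0) (S : Set ℝ) : Prop :=
  ∀ s ∈ S, ∀ t ∈ S, dist (σ s) (σ t) = v * dist s t

theorem IsGeodesicSegment.isGeodesicOn {X : Type*} [MetricSpace X] {σ : ℝ → X} {x y : X}
    (h : IsGeodesicSegment σ x y) : IsGeodesicOn σ 1 (Set.Icc 0 (dist x y)) := fun s hs t ht => by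
  rw [h.2.2 s hs t ht, NNReal.coe_one, one_mul, Real.dist_eq]

theorem IsGeodesicOn.continuousOn {X : Type*} [MetricSpace X] {σ : ℝ → X} {v : ℝ≥0} {S : Set ℝ}
    (h : IsGeodesicOn σ v S) : ContinuousOn σ S :=
  (LipschitzOnWith.of_dist_le_mul fun s hs t ht => (h s hs t ht).le).continuousOn

namespace IsCAT0

section Midpoint

variable {X : Type*} [MetricSpace X] (hX : IsCAT0 X)

/-- The midpoint of two points of a CAT(0) space, taken on a chosen geodesic segment; by `eq_mid`
it does not depend on the choice. -/
noncomputable def mid (x y : X) : X :=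
  (hX.exists_geodesic x y).choose (dist x y / 2)

theorem sq_dist_mid_le (a b x : X) :
    dist (hX.mid a b) x ^ 2 ≤ (dist a x ^ 2 + dist b x ^ 2) / 2 - dist a b ^ 2 / 4 := by
  have h := hX.cn x a b _ (hX.exists_geodesic a b).choose_spec
  rw [dist_comm b a] at h
  unfold mid
  linarith

theorem dist_mid_left (a b : X) : dist (hX.mid a b) a = dist a b / 2 := by
  obtain ⟨hleft, -, h⟩ := (hX.exists_geodesic a b).choose_spec
  have hd : 0 ≤ dist a b := dist_nonneg
  have := h (dist a b / 2) ⟨by linarith, by linarith⟩ 0 ⟨le_rfl, hd⟩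
  rwa [hleft, sub_zero, abs_of_nonneg (by linarith)] at this

theorem dist_mid_right (a b : X) : dist (hX.mid a b) b = dist a b / 2 := by
  obtain ⟨-, hright, h⟩ := (hX.exists_geodesic a b).choose_spec
  have hd : 0 ≤ dist a b := dist_nonneg
  have := h (dist a b / 2) ⟨by linarith, by linarith⟩ (dist a b) ⟨hd, le_rfl⟩
  rw [hright, abs_of_nonpos (by linarith)] at this
  rw [mid, this]
  ring

theorem eq_mid {a b m : X} (ha : dist m a ≤ dist a b / 2) (hb : dist m b ≤ dist a b / 2) :
    m = hX.mid a b := by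
  have h := hX.sq_dist_mid_le a b m
  rw [dist_comm a m, dist_comm b m] at h
  have ha2 := pow_le_pow_left₀ dist_nonneg ha 2
  have hb2 := pow_le_pow_left₀ dist_nonneg hb 2
  have hsq : dist (hX.mid a b) m ^ 2 = 0 := le_antisymm (by linarith) (sq_nonneg _)
  exact (dist_eq_zero.1 (pow_eq_zero_iff two_ne_zero |>.1 hsq)).symm

theorem mid_comm (a b : X) : hX.mid a b = hX.mid b a :=
  hX.eq_mid (by rw [hX.dist_mid_right, dist_comm]) (by rw [hX.dist_mid_left, dist_comm])

theorem mid_self (a : X) : hX.mid a a = a :=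
  (hX.eq_mid (by simp) (by simp)).symm

theorem smul_mid {M : Type*} [SMul M X] [IsIsometricSMul M X] (g : M) (a b : X) :
    g • hX.mid a b = hX.mid (g • a) (g • b) := by
  apply hX.eq_mid
  · rw [dist_smul, dist_smul, hX.dist_mid_left]
  · rw [dist_smul, dist_smul, hX.dist_mid_right]

theorem dist_mid_mid_left_le (a b b' : X) :
    dist (hX.mid a b) (hX.mid a b') ≤ dist b b' / 2 := by
  have h := hX.sq_dist_mid_le a b' (hX.mid a b)
  have h' := hX.sq_dist_mid_le a b b'
  rw [dist_comm (hX.mid a b'), dist_comm a (hX.mid a b), dist_comm b' (hX.mid a b),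
    hX.dist_mid_left] at h
  exact le_of_sq_le_sq (by nlinarith) (by positivity)

theorem dist_mid_mid_le (a b a' b' : X) :
    dist (hX.mid a b) (hX.mid a' b') ≤ (dist a a' + dist b b') / 2 := by
  have h := hX.dist_mid_mid_left_le a b b'
  have h' := hX.dist_mid_mid_left_le b' a a'
  rw [hX.mid_comm b' a, hX.mid_comm b' a'] at h'
  linarith [dist_triangle (hX.mid a b) (hX.mid a b') (hX.mid a' b')]

theorem continuous_mid : Continuous fun q : X × X => hX.mid q.1 q.2 := by
  refine (LipschitzWith.of_dist_le_mul (K := 1) fun q q' => ?_).continuous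
  have h : dist q.1 q'.1 ≤ dist q q' := le_max_left _ _
  have h' : dist q.2 q'.2 ≤ dist q q' := le_max_right _ _
  rw [NNReal.coe_one, one_mul]
  linarith [hX.dist_mid_mid_le q.1 q.2 q'.1 q'.2]

theorem map_midpoint_eq_mid {σ : ℝ → X} {v : ℝ≥0} {S : Set ℝ} (hσ : IsGeodesicOn σ v S) {s t : ℝ}
    (hs : s ∈ S) (ht : t ∈ S) (hst : (s + t) / 2 ∈ S) :
    σ ((s + t) / 2) = hX.mid (σ s) (σ t) := by
  apply hX.eq_mid
  · rw [hσ _ hst _ hs, hσ _ hs _ ht, Real.dist_eq, Real.dist_eq,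
      show (s + t) / 2 - s = -((s - t) / 2) by ring, abs_neg, abs_div, abs_two, mul_div_assoc]
  · rw [hσ _ hst _ ht, hσ _ hs _ ht, Real.dist_eq, Real.dist_eq,
      show (s + t) / 2 - t = (s - t) / 2 by ring, abs_div, abs_two, mul_div_assoc]

include hX

theorem exists_isGeodesicOn_unitInterval (x y : X) :
    ∃ τ : ℝ → X, τ 0 = x ∧ τ 1 = y ∧ IsGeodesicOn τ (nndist x y) (Set.Icc 0 1) := by
  obtain ⟨σ, hσ0, hσ1, hσ⟩ := hX.exists_geodesic x y
  have hmem : ∀ s ∈ Set.Icc (0 : ℝ) 1, dist x y * s ∈ Set.Icc 0 (dist x y) := fun s hs =>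
    ⟨mul_nonneg dist_nonneg hs.1, mul_le_of_le_one_right dist_nonneg hs.2⟩
  refine ⟨fun s => σ (dist x y * s), by simp [hσ0], by simp [hσ1], fun s hs t ht => ?_⟩
  rw [hσ _ (hmem s hs) _ (hmem t ht), ← mul_sub, abs_mul, abs_of_nonneg dist_nonneg,
    coe_nndist, Real.dist_eq]

theorem exists_sq_dist_le (x y : X) {t : ℝ} (ht : t ∈ Set.Icc (0 : ℝ) 1) :
    ∃ m : X, ∀ z, dist m z ^ 2 ≤
      (1 - t) * dist x z ^ 2 + t * dist y z ^ 2 - t * (1 - t) * dist x y ^ 2 := by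
  obtain ⟨τ, hτ0, hτ1, hτ⟩ := hX.exists_isGeodesicOn_unitInterval x y
  have hτc := hτ.continuousOn
  refine ⟨τ t, fun z => ?_⟩
  -- The defect in the inequality is midpoint convex by the CN inequality and vanishes at the ends.
  set ψ : ℝ → ℝ := fun s =>
    dist (τ s) z ^ 2 - ((1 - s) * dist x z ^ 2 + s * dist y z ^ 2 - s * (1 - s) * dist x y ^ 2)
    with hψ
  have hψc : ContinuousOn ψ (Set.Icc 0 1) := by fun_prop
  have hψ0 : ψ 0 = 0 := by simp [hψ, hτ0]
  have hψ1 : ψ 1 = 0 := by simp [hψ, hτ1]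
  have hψm : ∀ s ∈ Set.Icc (0 : ℝ) 1, ∀ u ∈ Set.Icc (0 : ℝ) 1,
      ψ ((s + u) / 2) ≤ (ψ s + ψ u) / 2 := by
    intro s hs u hu
    have hsu : (s + u) / 2 ∈ Set.Icc (0 : ℝ) 1 :=
      ⟨by linarith [hs.1, hu.1], by linarith [hs.2, hu.2]⟩
    have h := hX.sq_dist_mid_le (τ s) (τ u) z
    rw [← hX.map_midpoint_eq_mid hτ hs hu hsu, hτ s hs u hu, coe_nndist, mul_pow,
      Real.dist_eq, sq_abs] at h
    simp only [hψ]
    linarith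
  have h := le_max_of_midpoint_convexOn hψc hψm ht
  rw [hψ0, hψ1, max_self] at h
  exact sub_nonpos.1 h

-- Reshetnyak's inequality, by cutting the diagonal `[x, b']` in the ratio `d(x, y) : d(b, b')`.
theorem sq_dist_add_sq_dist_le (x y b b' : X) :
    dist x b' ^ 2 + dist y b ^ 2 ≤
      dist x b ^ 2 + dist y b' ^ 2 + 2 * (dist x y * dist b b') := by
  rcases eq_or_ne x y with rfl | hxy
  · simp [add_comm]
  rcases eq_or_ne b b' with rfl | hbb'
  · simp
  have hα : 0 < dist x y := dist_pos.2 hxy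
  have hβ : 0 < dist b b' := dist_pos.2 hbb'
  set α := dist x y
  set β := dist b b'
  set t := α / (α + β)
  have ht : 0 < t := by positivity
  have ht' : 0 < 1 - t := by rw [sub_pos, div_lt_one (by positivity)]; linarith
  have hratio : (1 - t) * α = t * β := by simp only [t]; field_simp; ring
  obtain ⟨m, hm⟩ := hX.exists_sq_dist_le x b' ⟨ht.le, by linarith⟩
  have hy : dist m y ^ 2 ≤ (1 - t) * α ^ 2 + t * dist y b' ^ 2 - t * (1 - t) * dist x b' ^ 2 :=
    dist_comm y b' ▸ hm y
  have hb : dist m b ^ 2 ≤ (1 - t) * dist x b ^ 2 + t * β ^ 2 - t * (1 - t) * dist x b' ^ 2 := by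
    have := hm b
    rwa [dist_comm b' b] at this
  have htri : t * (1 - t) * dist y b ^ 2 ≤ (1 - t) * dist m y ^ 2 + t * dist m b ^ 2 := by
    have := pow_le_pow_left₀ dist_nonneg (dist_triangle_left y b m) 2
    have := mul_le_mul_of_nonneg_left this (mul_pos ht ht').le
    nlinarith [sq_nonneg ((1 - t) * dist m y - t * dist m b)]
  have hsum : t * (1 - t) * (dist x b' ^ 2 + dist y b ^ 2) ≤
      t * (1 - t) * (dist x b ^ 2 + dist y b' ^ 2 + 2 * (α * β)) := by
    have hα2 : ((1 - t) * α) ^ 2 = t * (1 - t) * (α * β) := by rw [sq]; nth_rw 2 [hratio]; ring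
    have hβ2 : (t * β) ^ 2 = t * (1 - t) * (α * β) := by rw [sq]; nth_rw 1 [← hratio]; ring
    have := mul_le_mul_of_nonneg_left hy ht'.le
    have := mul_le_mul_of_nonneg_left hb ht.le
    linarith
  exact le_of_mul_le_mul_left hsum (mul_pos ht ht')

theorem sq_dist_mid_mid_le (a b a' b' : X) :
    dist (hX.mid a b) (hX.mid a' b') ^ 2 ≤
      (dist a a' ^ 2 + dist b b' ^ 2) / 2 - (dist a b - dist a' b') ^ 2 / 4 := by
  have hmid := hX.sq_dist_mid_le a' b' (hX.mid a b)
  have ha' := hX.sq_dist_mid_le a b a'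
  have hb' := hX.sq_dist_mid_le a b b'
  have hquad := hX.sq_dist_add_sq_dist_le a b a' b'
  rw [dist_comm (hX.mid a' b'), dist_comm a', dist_comm b'] at hmid
  linarith

end Midpoint

end IsCAT0

section Rays

open Filter Topology

variable {X : Type*} [MetricSpace X]

theorem Ray.dist_eq (c : Ray X) (s t : ℝ≥0) : dist (c.toFun s) (c.toFun t) = |(s : ℝ) - t| := by
  rw [c.isometry.dist_eq, NNReal.dist_eq]

theorem Ray.dist_zero_left (c : Ray X) (t : ℝ≥0) : dist (c.toFun 0) (c.toFun t) = t := by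
  simp [c.dist_eq]

theorem Ray.isGeodesicOn (c : Ray X) (v : ℝ≥0) :
    IsGeodesicOn (fun s : ℝ => c.toFun (v * s.toNNReal)) v (Set.Ici 0) := fun s hs t ht => by
  rw [c.dist_eq, NNReal.coe_mul, NNReal.coe_mul, Real.coe_toNNReal s hs, Real.coe_toNNReal t ht,
    ← mul_sub, abs_mul, NNReal.abs_eq, Real.dist_eq]

theorem endpoint_eq_iff {c c' : Ray X} : c.endpoint = c'.endpoint ↔ Asymptotic c c' :=
  Quotient.eq

theorem smul_endpoint {M : Type*} [Group M] [MulAction M X] [IsIsometricSMul M X] (g : M)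
    (c : Ray X) : g • c.endpoint = (c.smul g).endpoint := rfl

namespace IsCAT0

variable (hX : IsCAT0 X)
include hX

theorem ray_eq_mid (c : Ray X) (t : ℝ≥0) :
    c.toFun t = hX.mid (c.toFun 0) (c.toFun (2 * t)) := by
  apply hX.eq_mid
  · rw [dist_comm, c.dist_zero_left, c.dist_zero_left, NNReal.coe_mul, NNReal.coe_ofNat,
      mul_div_cancel_left₀ _ two_ne_zero]
  · rw [c.dist_eq, c.dist_zero_left, NNReal.coe_mul, NNReal.coe_ofNat, two_mul,
      sub_add_cancel_left, abs_neg, NNReal.abs_eq, add_self_div_two]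

theorem dist_ray_sub_dist_zero_le (c c' : Ray X) (t : ℝ≥0) (n : ℕ) :
    dist (c.toFun t) (c'.toFun t) - dist (c.toFun 0) (c'.toFun 0) ≤
      (1 / 2) ^ n * (dist (c.toFun (2 ^ n * t)) (c'.toFun (2 ^ n * t))
        - dist (c.toFun 0) (c'.toFun 0)) := by
  induction n with
  | zero => simp
  | succ n ih =>
    refine ih.trans ?_
    have h := hX.dist_mid_mid_le (c.toFun 0) (c.toFun (2 * (2 ^ n * t))) (c'.toFun 0)
      (c'.toFun (2 * (2 ^ n * t)))
    rw [← hX.ray_eq_mid, ← hX.ray_eq_mid] at h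
    rw [pow_succ, pow_succ', mul_assoc, mul_assoc]
    exact mul_le_mul_of_nonneg_left (by linarith) (by positivity)

theorem dist_ray_le_of_toFun_zero_eq {c c' : Ray X} (h0 : c.toFun 0 = c'.toFun 0) (t : ℝ≥0)
    (n : ℕ) : dist (c.toFun t) (c'.toFun t) ≤
      (1 / 2) ^ n * dist (c.toFun (2 ^ n * t)) (c'.toFun (2 ^ n * t)) := by
  have h := hX.dist_ray_sub_dist_zero_le c c' t n
  rwa [h0, dist_self, sub_zero, sub_zero] at h

theorem dist_ray_le_of_asymptotic {c c' : Ray X} (h : Asymptotic c c') (t : ℝ≥0) :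
    dist (c.toFun t) (c'.toFun t) ≤ dist (c.toFun 0) (c'.toFun 0) := by
  obtain ⟨K, hK⟩ := h
  have hlim : Tendsto (fun n : ℕ => (1 / 2 : ℝ) ^ n * K) atTop (𝓝 (0 * K)) :=
    (tendsto_pow_atTop_nhds_zero_of_lt_one (by norm_num) (by norm_num)).mul_const _
  rw [zero_mul] at hlim
  refine sub_nonpos.1 (ge_of_tendsto' hlim fun n =>
    (hX.dist_ray_sub_dist_zero_le c c' t n).trans ?_)
  exact mul_le_mul_of_nonneg_left ((sub_le_self _ dist_nonneg).trans (hK _)) (by positivity)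

theorem ray_ext {c c' : Ray X} (h : c.endpoint = c'.endpoint) (h0 : c.toFun 0 = c'.toFun 0) :
    c = c' := by
  have heq : c.toFun = c'.toFun := funext fun t => by
    have hle := hX.dist_ray_le_of_asymptotic (endpoint_eq_iff.1 h) t
    rwa [h0, dist_self, dist_le_zero] at hle
  cases c; cases c'; congr

theorem dist_le_max_of_isGeodesicOn {σ τ : ℝ → X} {v w : ℝ≥0} {L : ℝ}
    (hσ : IsGeodesicOn σ v (Set.Icc 0 L)) (hτ : IsGeodesicOn τ w (Set.Icc 0 L))
    {t : ℝ} (ht : t ∈ Set.Icc 0 L) :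
    dist (σ t) (τ t) ≤ max (dist (σ 0) (τ 0)) (dist (σ L) (τ L)) := by
  refine le_max_of_midpoint_convexOn (ψ := fun t => dist (σ t) (τ t))
    (continuous_dist.comp_continuousOn (hσ.continuousOn.prodMk hτ.continuousOn))
    (fun s hs t ht => ?_) ht
  have hst : (s + t) / 2 ∈ Set.Icc 0 L := ⟨by linarith [hs.1, ht.1], by linarith [hs.2, ht.2]⟩
  rw [hX.map_midpoint_eq_mid hσ hs ht hst, hX.map_midpoint_eq_mid hτ hs ht hst]
  exact hX.dist_mid_mid_le _ _ _ _

variable [ProperSpace X]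

theorem exists_ray_tendsto {x : X} {a : ℕ → X} (ha : Tendsto (fun n => dist x (a n)) atTop atTop) :
    ∃ (σ : ℕ → ℝ → X) (c : Ray X), (∀ n, IsGeodesicSegment (σ n) x (a n)) ∧ c.toFun 0 = x ∧
      ∀ t : ℝ≥0, Tendsto (fun n => σ n t) (hyperfilter ℕ) (𝓝 (c.toFun t)) := by
  choose σ hσ using fun n => hX.exists_geodesic x (a n)
  have hmem : ∀ t : ℝ≥0, ∀ᶠ n in (hyperfilter ℕ : Filter ℕ), (t : ℝ) ∈ Set.Icc 0 (dist x (a n)) :=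
    fun t => by
      filter_upwards [Nat.hyperfilter_le_atTop (ha.eventually_ge_atTop (t : ℝ))] with n hn
      exact ⟨t.2, hn⟩
  have hlim : ∀ t : ℝ≥0, ∃ y, Tendsto (fun n => σ n t) (hyperfilter ℕ) (𝓝 y) := by
    intro t
    have hball : ∀ᶠ n in (hyperfilter ℕ : Filter ℕ), σ n t ∈ Metric.closedBall x t := by
      filter_upwards [hmem t] with n hn
      have h := (hσ n).2.2 t hn 0 ⟨le_rfl, dist_nonneg⟩
      rw [(hσ n).1, sub_zero, NNReal.abs_eq] at h
      exact h.le
    obtain ⟨y, -, hy⟩ := (isCompact_closedBall x (t : ℝ)).ultrafilter_le_nhds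
      ((hyperfilter ℕ).map fun n => σ n t) (le_principal_iff.2 hball)
    exact ⟨y, hy⟩
  choose c hc using hlim
  have hiso : Isometry c := Isometry.of_dist_eq fun s t => by
    refine tendsto_nhds_unique ((hc s).dist (hc t)) (tendsto_const_nhds.congr' ?_)
    filter_upwards [hmem s, hmem t] with n hs ht
    rw [(hσ n).2.2 s hs t ht, NNReal.dist_eq]
  refine ⟨σ, ⟨c, hiso⟩, hσ, tendsto_nhds_unique (hc 0) (tendsto_const_nhds.congr fun n => ?_), hc⟩
  exact (hσ n).1.symm

theorem nonempty_boundary [NoncompactSpace X] : Nonempty (Boundary X) := by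
  obtain ⟨x, -⟩ := (cocompact X).nonempty_of_mem univ_mem
  choose a ha using fun n : ℕ =>
    ((tendsto_dist_left_cocompact_atTop x).eventually_ge_atTop (n : ℝ)).exists
  obtain ⟨-, c, -⟩ :=
    hX.exists_ray_tendsto (tendsto_atTop_mono ha tendsto_natCast_atTop_atTop)
  exact ⟨c.endpoint⟩

theorem exists_ray_eq (x : X) (ξ : Boundary X) :
    ∃ c : Ray X, c.toFun 0 = x ∧ c.endpoint = ξ := by
  obtain ⟨c, rfl : c.endpoint = ξ⟩ := Quotient.exists_rep ξ
  set D := dist x (c.toFun 0)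
  have hD : ∀ n : ℕ, |n - dist x (c.toFun n)| ≤ D := fun n => by
    have h := abs_dist_sub_le x (c.toFun 0) (c.toFun n)
    rwa [c.dist_zero_left, abs_sub_comm] at h
  have ha : Tendsto (fun n : ℕ => dist x (c.toFun n)) atTop atTop :=
    tendsto_atTop_mono (fun n : ℕ => by linarith [(abs_le.1 (hD n)).2])
      (tendsto_atTop_add_const_right _ (-D) tendsto_natCast_atTop_atTop)
  obtain ⟨σ, c', hσ, hc'0, hc'⟩ := hX.exists_ray_tendsto ha
  refine ⟨c', hc'0, endpoint_eq_iff.2 ⟨D + D, fun t => ?_⟩⟩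
  refine le_of_tendsto ((hc' t).dist tendsto_const_nhds) ?_
  filter_upwards [Nat.hyperfilter_le_atTop (ha.eventually_ge_atTop (t : ℝ)),
    Nat.hyperfilter_le_atTop (ha.eventually_gt_atTop 0)] with n htℓ hℓ
  obtain ⟨ℓ, hℓdef⟩ : ∃ ℓ : ℝ≥0, (ℓ : ℝ) = dist x (c.toFun n) := ⟨_, coe_nndist _ _⟩
  -- Compare `σ n` with the segment of `c` from `c 0` to `c n`, run through in the same time `ℓ`.
  have hspeed : (n : ℝ≥0) / ℓ * ℓ = n := div_mul_cancel₀ _ (NNReal.coe_pos.1 (hℓdef ▸ hℓ)).ne'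
  have hconv := hX.dist_le_max_of_isGeodesicOn (hσ n).isGeodesicOn
    (fun s hs t ht => c.isGeodesicOn (n / ℓ) s hs.1 t ht.1) ⟨t.coe_nonneg, htℓ⟩
  rw [(hσ n).1, (hσ n).2.1, ← hℓdef, Real.toNNReal_coe, Real.toNNReal_coe, hspeed, dist_self,
    Real.toNNReal_zero, mul_zero, max_eq_left dist_nonneg] at hconv
  have hshift : dist (c.toFun (n / ℓ * t)) (c.toFun t) ≤ D := by
    have hℓn : (n : ℝ) - ℓ = (n / ℓ - 1) * ℓ := by
      rw [sub_mul, one_mul, div_mul_cancel₀ _ (hℓdef ▸ hℓ).ne']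
    have h := hD n
    rw [← hℓdef, hℓn, abs_mul, NNReal.abs_eq] at h
    rw [c.dist_eq, NNReal.coe_mul, NNReal.coe_div, NNReal.coe_natCast, ← sub_one_mul, abs_mul,
      NNReal.abs_eq]
    exact (mul_le_mul_of_nonneg_left (hℓdef ▸ htℓ) (abs_nonneg _)).trans h
  exact (dist_triangle _ _ _).trans (add_le_add hconv hshift)

theorem exists_fixed_of_bounded_displacement {M : Type*} [Group M] [MulAction M X]
    [IsIsometricSMul M X] {x₀ : X} {x : ℕ → X}
    (hx : Tendsto (fun n => dist x₀ (x n)) atTop atTop)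
    (hM : ∀ g : M, ∃ K, ∀ n, dist (g • x n) (x n) ≤ K) :
    ∃ ξ : Boundary X, ∀ g : M, g • ξ = ξ := by
  obtain ⟨σ, c, hσ, -, hc⟩ := hX.exists_ray_tendsto hx
  refine ⟨c.endpoint, fun g => ?_⟩
  obtain ⟨K, hK⟩ := hM g
  refine endpoint_eq_iff.2 ⟨max (dist (g • x₀) x₀) K, fun t => ?_⟩
  refine le_of_tendsto (((hc t).const_smul g).dist (hc t)) ?_
  filter_upwards [Nat.hyperfilter_le_atTop (hx.eventually_ge_atTop (t : ℝ))] with n hn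
  have hgσ : IsGeodesicOn (fun s => g • σ n s) 1 (Set.Icc 0 (dist x₀ (x n))) := fun s hs t ht =>
    (dist_smul _ _ _).trans ((hσ n).isGeodesicOn s hs t ht)
  have hconv := hX.dist_le_max_of_isGeodesicOn hgσ (hσ n).isGeodesicOn ⟨t.2, hn⟩
  rw [(hσ n).1, (hσ n).2.1] at hconv
  exact hconv.trans (max_le_max le_rfl (hK n))

end IsCAT0

end Rays

section ConeTopology

open Filter Topology

variable {X : Type*} [MetricSpace X]

theorem isOpen_coneNhd (c : Ray X) (r : ℝ≥0) {ε : ℝ} (hε : 0 < ε) : IsOpen (coneNhd c r ε) :=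
  TopologicalSpace.isOpen_generateFrom_of_mem ⟨c, r, ε, hε, rfl⟩

namespace IsCAT0

variable [ProperSpace X] (hX : IsCAT0 X)

/-- The ray from `x` to the point at infinity `ξ`; by `ray_ext` there is only one. -/
noncomputable def rayTo (x : X) (ξ : Boundary X) : Ray X :=
  (hX.exists_ray_eq x ξ).choose

@[simp] theorem rayTo_zero (x : X) (ξ : Boundary X) : (hX.rayTo x ξ).toFun 0 = x :=
  (hX.exists_ray_eq x ξ).choose_spec.1

@[simp] theorem endpoint_rayTo (x : X) (ξ : Boundary X) : (hX.rayTo x ξ).endpoint = ξ :=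
  (hX.exists_ray_eq x ξ).choose_spec.2

theorem rayTo_endpoint {x : X} {c : Ray X} (h : c.toFun 0 = x) : hX.rayTo x c.endpoint = c :=
  hX.ray_ext (hX.endpoint_rayTo x _) ((hX.rayTo_zero x _).trans h.symm)

theorem rayTo_smul {M : Type*} [Group M] [MulAction M X] [IsIsometricSMul M X] (g : M) (x : X)
    (ξ : Boundary X) : hX.rayTo (g • x) (g • ξ) = (hX.rayTo x ξ).smul g := by
  have h := hX.rayTo_endpoint (c := (hX.rayTo x ξ).smul g) (congrArg (g • ·) (hX.rayTo_zero x ξ))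
  rwa [← smul_endpoint, endpoint_rayTo] at h

theorem dist_rayTo_rayTo_le (x y : X) (ξ : Boundary X) (t : ℝ≥0) :
    dist ((hX.rayTo x ξ).toFun t) ((hX.rayTo y ξ).toFun t) ≤ dist x y := by
  have h := hX.dist_ray_le_of_asymptotic (c := hX.rayTo x ξ) (c' := hX.rayTo y ξ)
    (endpoint_eq_iff.1 (by simp)) t
  rwa [rayTo_zero, rayTo_zero] at h

theorem mem_coneNhd {c : Ray X} {r : ℝ≥0} {ε : ℝ} {ξ : Boundary X} :
    ξ ∈ coneNhd c r ε ↔ dist ((hX.rayTo (c.toFun 0) ξ).toFun r) (c.toFun r) < ε := by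
  constructor
  · rintro ⟨c', rfl, h0, hd⟩
    rwa [hX.rayTo_endpoint h0]
  · exact fun h => ⟨_, hX.endpoint_rayTo _ ξ, hX.rayTo_zero _ ξ, h⟩

theorem continuous_rayTo (x : X) (t : ℝ≥0) :
    Continuous fun ξ : Boundary X => (hX.rayTo x ξ).toFun t := by
  refine continuous_iff_continuousAt.2 fun ξ => Metric.tendsto_nhds.2 fun ε hε => ?_
  have hnhds : coneNhd (hX.rayTo x ξ) t ε ∈ 𝓝 ξ :=
    (isOpen_coneNhd _ t hε).mem_nhds (hX.mem_coneNhd.2 (by simpa using hε))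
  filter_upwards [hnhds] with η hη
  simpa using hX.mem_coneNhd.1 hη

/- The radius `T = 2 ^ n * r` is so large that contraction towards the origin of `c` beats the
change of base point. -/
theorem exists_rayTo_subset_coneNhd (x : X) {c : Ray X} {r : ℝ≥0} {ε : ℝ} {ξ : Boundary X}
    (hξ : ξ ∈ coneNhd c r ε) : ∃ T : ℝ≥0, ∀ η : Boundary X,
      dist ((hX.rayTo x η).toFun T) ((hX.rayTo x ξ).toFun T) < 1 → η ∈ coneNhd c r ε := by
  rw [hX.mem_coneNhd] at hξ
  set y := c.toFun 0
  set K := dist y x + 1 + dist x y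
  have hlim : Tendsto (fun n : ℕ => (1 / 2 : ℝ) ^ n * K) atTop (𝓝 (0 * K)) :=
    (tendsto_pow_atTop_nhds_zero_of_lt_one (by norm_num) (by norm_num)).mul_const _
  rw [zero_mul] at hlim
  obtain ⟨n, hn⟩ := (hlim.eventually_lt_const (sub_pos.2 hξ)).exists
  refine ⟨2 ^ n * r, fun η hη => hX.mem_coneNhd.2 ?_⟩
  have hK : dist ((hX.rayTo y η).toFun (2 ^ n * r)) ((hX.rayTo y ξ).toFun (2 ^ n * r)) ≤ K :=
    (dist_triangle4 _ _ _ _).trans (add_le_add (add_le_add (hX.dist_rayTo_rayTo_le y x η _) hη.le)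
      (hX.dist_rayTo_rayTo_le x y ξ _))
  calc dist ((hX.rayTo y η).toFun r) (c.toFun r)
      ≤ dist ((hX.rayTo y η).toFun r) ((hX.rayTo y ξ).toFun r)
        + dist ((hX.rayTo y ξ).toFun r) (c.toFun r) := dist_triangle _ _ _
    _ ≤ (1 / 2) ^ n * K + dist ((hX.rayTo y ξ).toFun r) (c.toFun r) := by
        gcongr
        exact (hX.dist_ray_le_of_toFun_zero_eq (by simp) r n).trans (by gcongr)
    _ < ε := by linarith

theorem isInducing_rayTo (x : X) : IsInducing fun ξ : Boundary X => (hX.rayTo x ξ).toFun := by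
  have hcont := continuous_pi fun t => hX.continuous_rayTo x t
  refine isInducing_iff_nhds.2 fun ξ => le_antisymm hcont.continuousAt.le_comap ?_
  rw [← tendsto_id', TopologicalSpace.tendsto_nhds_generateFrom_iff]
  rintro _ ⟨c, r, ε, -, rfl⟩ hξ
  obtain ⟨T, hT⟩ := hX.exists_rayTo_subset_coneNhd x hξ
  have hball : (fun f : ℝ≥0 → X => f T) ⁻¹' Metric.ball ((hX.rayTo x ξ).toFun T) 1 ∈
      𝓝 (hX.rayTo x ξ).toFun :=
    (continuous_apply T).continuousAt.preimage_mem_nhds (Metric.ball_mem_nhds _ one_pos)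
  exact mem_of_superset (preimage_mem_comap hball) hT

theorem isEmbedding_rayTo (x : X) : IsEmbedding fun ξ : Boundary X => (hX.rayTo x ξ).toFun := by
  refine ⟨hX.isInducing_rayTo x, fun ξ η h => ?_⟩
  rw [← hX.endpoint_rayTo x ξ, ← hX.endpoint_rayTo x η, endpoint_eq_iff]
  exact ⟨0, fun t => (congrArg (dist _) (congrFun h t).symm).trans (dist_self _) |>.le⟩

include hX in
theorem t2Space_boundary [Nonempty X] : T2Space (Boundary X) :=
  (hX.isEmbedding_rayTo (Classical.arbitrary X)).t2Space

include hX in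
theorem continuous_smul_boundary {H : Type*} [Group H] [TopologicalSpace H]
    [MulAction H X] [IsIsometricSMul H X] (hcont : ∀ x : X, Continuous fun h : H => h • x) :
    Continuous fun q : H × Boundary X => q.1 • q.2 := by
  refine continuous_iff_continuousAt.2 fun ⟨h₀, ξ₀⟩ => ?_
  obtain ⟨x⟩ : Nonempty X := (Quotient.exists_rep ξ₀).elim fun c _ => ⟨c.toFun 0⟩
  refine (hX.isInducing_rayTo (h₀ • x)).continuousAt_iff.2 (continuousAt_pi.2 fun t => ?_)
  set z := (hX.rayTo x ξ₀).toFun t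
  have hbound : ∀ q : H × Boundary X, dist ((hX.rayTo (h₀ • x) (q.1 • q.2)).toFun t) (h₀ • z) ≤
      dist (h₀ • x) (q.1 • x) + dist ((hX.rayTo x q.2).toFun t) z + dist (q.1 • z) (h₀ • z) := by
    intro q
    have h := hX.dist_rayTo_rayTo_le (h₀ • x) (q.1 • x) (q.1 • q.2) t
    rw [hX.rayTo_smul q.1 x] at h
    have hsmul : dist (((hX.rayTo x q.2).smul q.1).toFun t) (q.1 • z) =
      dist ((hX.rayTo x q.2).toFun t) z := dist_smul _ _ _
    rw [← hsmul]
    exact (dist_triangle4 _ _ _ _).trans (by gcongr)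
  have hlim : Tendsto (fun q : H × Boundary X => dist (h₀ • x) (q.1 • x)
      + dist ((hX.rayTo x q.2).toFun t) z + dist (q.1 • z) (h₀ • z)) (𝓝 (h₀, ξ₀)) (𝓝 0) := by
    have hx := (hcont x).comp (continuous_fst (Y := Boundary X))
    have hz := (hcont z).comp (continuous_fst (Y := Boundary X))
    have hξ := (hX.continuous_rayTo x t).comp (continuous_snd (X := H))
    exact (((continuous_const.dist hx).add (hξ.dist continuous_const)).add
      (hz.dist continuous_const)).tendsto' _ _ (by simp [z])
  have h0 : (hX.rayTo (h₀ • x) (h₀ • ξ₀)).toFun t = h₀ • z := by rw [hX.rayTo_smul]; rfl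
  rw [ContinuousAt, Function.comp_apply, h0, tendsto_iff_dist_tendsto_zero]
  exact squeeze_zero (fun _ => dist_nonneg) hbound hlim

end IsCAT0

end ConeTopology

section Isometry

open Filter Topology

variable {X Y : Type*} [MetricSpace X] [MetricSpace Y] {e : Y → X}

/-- The image of a ray under an isometric embedding. -/
def Ray.map (he : Isometry e) (c : Ray Y) : Ray X := ⟨e ∘ c.toFun, he.comp c.isometry⟩

/-- The map between the boundaries at infinity induced by an isometric embedding. -/
def boundaryMap (he : Isometry e) : Boundary Y → Boundary X :=
  Quotient.map (Ray.map he) fun _ _ ⟨K, hK⟩ => ⟨K, fun t => (he.dist_eq _ _).trans_le (hK t)⟩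

theorem boundaryMap_endpoint (he : Isometry e) (c : Ray Y) :
    boundaryMap he c.endpoint = (c.map he).endpoint := rfl

namespace IsCAT0

variable (hX : IsCAT0 X)

/-- A set is closed under midpoints; for closed sets this is convexity. -/
def MidClosed (A : Set X) : Prop := ∀ a ∈ A, ∀ b ∈ A, hX.mid a b ∈ A

variable {hX} in
theorem MidClosed.infDist_mid_le {A : Set X} (hA : hX.MidClosed A) (hne : A.Nonempty) (x y : X) :
    Metric.infDist (hX.mid x y) A ≤ (Metric.infDist x A + Metric.infDist y A) / 2 := by
  refine le_of_forall_pos_le_add fun ε hε => ?_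
  obtain ⟨a, ha, hxa⟩ := (Metric.infDist_lt_iff hne).1 (lt_add_of_pos_right (Metric.infDist x A) hε)
  obtain ⟨b, hb, hyb⟩ := (Metric.infDist_lt_iff hne).1 (lt_add_of_pos_right (Metric.infDist y A) hε)
  linarith [Metric.infDist_le_dist_of_mem (x := hX.mid x y) (hA a ha b hb),
    hX.dist_mid_mid_le x y a b]

variable {hX} in
theorem MidClosed.geodesic_mem {A : Set X} (hm : hX.MidClosed A) (hA : IsClosed A) {σ : ℝ → X}
    {v : ℝ≥0} {L : ℝ} (hσ : IsGeodesicOn σ v (Set.Icc 0 L)) (h0 : σ 0 ∈ A) (hL : σ L ∈ A)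
    {t : ℝ} (ht : t ∈ Set.Icc 0 L) : σ t ∈ A := by
  have hle := le_max_of_midpoint_convexOn (ψ := fun t => Metric.infDist (σ t) A)
    ((Metric.continuous_infDist_pt A).comp_continuousOn hσ.continuousOn) (fun s hs t ht => ?_) ht
  · simp only [Metric.infDist_zero_of_mem h0, Metric.infDist_zero_of_mem hL, max_self] at hle
    exact (hA.mem_iff_infDist_zero ⟨_, h0⟩).2 (le_antisymm hle Metric.infDist_nonneg)
  · have hst : (s + t) / 2 ∈ Set.Icc 0 L := ⟨by linarith [hs.1, ht.1], by linarith [hs.2, ht.2]⟩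
    rw [hX.map_midpoint_eq_mid hσ hs ht hst]
    exact hm.infDist_mid_le ⟨_, h0⟩ _ _

theorem of_isometry (he : Isometry e) (hcl : IsClosed (Set.range e))
    (hmid : hX.MidClosed (Set.range e)) : IsCAT0 Y where
  exists_geodesic x y := by
    obtain ⟨σ, hσ⟩ := hX.exists_geodesic (e x) (e y)
    have hmem : ∀ t ∈ Set.Icc 0 (dist (e x) (e y)), σ t ∈ Set.range e := fun t =>
      hmid.geodesic_mem hcl hσ.isGeodesicOn ⟨x, hσ.1.symm⟩ ⟨y, hσ.2.1.symm⟩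
    have : Nonempty Y := ⟨x⟩
    have hinv : ∀ t ∈ Set.Icc 0 (dist x y), e (Function.invFun e (σ t)) = σ t := fun t ht =>
      Function.invFun_eq (hmem t (by rwa [he.dist_eq]))
    refine ⟨fun t => Function.invFun e (σ t), he.injective ?_, he.injective ?_, fun s hs t ht => ?_⟩
    · rw [hinv _ ⟨le_rfl, dist_nonneg⟩, hσ.1]
    · rw [hinv _ ⟨dist_nonneg, le_rfl⟩, ← he.dist_eq, hσ.2.1]
    · rw [← he.dist_eq, hinv s hs, hinv t ht]
      rw [← he.dist_eq] at hs ht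
      exact hσ.2.2 s hs t ht
  cn x c c' σ hσ := by
    have h := hX.cn (e x) (e c) (e c') (e ∘ σ)
    simp only [IsGeodesicSegment, Function.comp_apply, he.dist_eq] at h
    exact h ⟨congrArg e hσ.1, congrArg e hσ.2.1, hσ.2.2⟩

variable [ProperSpace X] [ProperSpace Y] (hY : IsCAT0 Y)

theorem rayTo_boundaryMap (he : Isometry e) (y : Y) (ξ : Boundary Y) :
    hX.rayTo (e y) (boundaryMap he ξ) = (hY.rayTo y ξ).map he := by
  conv_lhs => rw [← hY.endpoint_rayTo y ξ, boundaryMap_endpoint]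
  exact hX.rayTo_endpoint (congrArg e (hY.rayTo_zero y ξ))

include hX hY

theorem isClosedEmbedding_boundaryMap (he : Isometry e) (hcl : IsClosed (Set.range e)) (y : Y) :
    IsClosedEmbedding (boundaryMap he) := by
  have hcomp : (fun ξ => (hX.rayTo (e y) ξ).toFun) ∘ boundaryMap he =
      (fun c t => e (c t)) ∘ fun ξ => (hY.rayTo y ξ).toFun := funext fun ξ =>
    congrArg Ray.toFun (hX.rayTo_boundaryMap hY he y ξ)
  have hemb : IsEmbedding (boundaryMap he) := by
    rw [← (hX.isEmbedding_rayTo (e y)).of_comp_iff, hcomp]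
    exact (IsEmbedding.piMap fun _ => he.isEmbedding).comp (hY.isEmbedding_rayTo y)
  refine ⟨hemb, ?_⟩
  have hrange : Set.range (boundaryMap he) =
      ⋂ t, (fun ξ => (hX.rayTo (e y) ξ).toFun t) ⁻¹' Set.range e := by
    ext ξ
    simp only [Set.mem_iInter, Set.mem_preimage]
    refine ⟨?_, fun h => ?_⟩
    · rintro ⟨η, rfl⟩ t
      rw [hX.rayTo_boundaryMap hY]
      exact ⟨_, rfl⟩
    · choose c hc using h
      have hiso : Isometry c := Isometry.of_dist_eq fun s t => by
        rw [← he.dist_eq, hc, hc, (hX.rayTo (e y) ξ).isometry.dist_eq]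
      refine ⟨Ray.endpoint ⟨c, hiso⟩, ?_⟩
      rw [boundaryMap_endpoint, ← hX.endpoint_rayTo (e y) ξ, endpoint_eq_iff]
      exact ⟨0, fun t => (congrArg (dist · _) (hc t)).trans (dist_self _) |>.le⟩
  rw [hrange]
  exact isClosed_iInter fun t => hcl.preimage (hX.continuous_rayTo (e y) t)

end IsCAT0

end Isometry

section Extension

/-- `C` is a non-empty closed `Γ`-invariant set on which the action of `Γ` extends along `φ` to a
continuous action of `H`. -/
def ExtendsOn {Γ H Z : Type*} [Group Γ] [Group H] [TopologicalSpace H] [TopologicalSpace Z]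
    [MulAction Γ Z] (φ : Γ →* H) (C : Set Z) : Prop :=
  C.Nonempty ∧ IsClosed C ∧ (∀ γ : Γ, ∀ ξ ∈ C, γ • ξ ∈ C) ∧
    ∃ ρ : H →* Equiv.Perm C, Continuous (fun q : H × C => ρ q.1 q.2) ∧
      ∀ (γ : Γ) (ξ : C), (ρ (φ γ) ξ : Z) = γ • (ξ : Z)

variable {Γ H Z W : Type*} [Group Γ] [Group H] [TopologicalSpace H] [TopologicalSpace Z]
  [MulAction Γ Z] {φ : Γ →* H}

theorem ExtendsOn.singleton [T1Space Z] {ξ : Z} (h : ∀ γ : Γ, γ • ξ = ξ) :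
    ExtendsOn φ {ξ} := by
  refine ⟨Set.singleton_nonempty ξ, isClosed_singleton, fun γ η hη => ?_, 1,
    continuous_snd, fun γ η => ?_⟩
  · rw [Set.mem_singleton_iff.1 hη, h, Set.mem_singleton_iff]
  · exact η.2.trans ((congrArg (γ • ·) η.2).trans (h γ)).symm

theorem ExtendsOn.range [TopologicalSpace W] [Nonempty W] [MulAction H W]
    (hcont : Continuous fun q : H × W => q.1 • q.2) {j : W → Z}
    (hj : Topology.IsClosedEmbedding j) (hφ : ∀ (γ : Γ) (w : W), j (φ γ • w) = γ • j w) :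
    ExtendsOn φ (Set.range j) := by
  set E := hj.isEmbedding.toHomeomorph
  have hE : ∀ w, (E w : Z) = j w := fun _ => rfl
  refine ⟨Set.range_nonempty j, hj.isClosed_range, ?_,
    (E.toEquiv.permCongrHom : _ →* _).comp (MulAction.toPermHom H W), ?_, fun γ ξ => ?_⟩
  · rintro γ _ ⟨w, rfl⟩
    exact ⟨_, hφ γ w⟩
  · exact E.continuous.comp (hcont.comp (continuous_id.prodMap E.symm.continuous))
  · obtain ⟨w, rfl⟩ := E.surjective ξ
    rw [hE, ← hφ γ w, ← hE]
    exact congrArg (fun w => (E (φ γ • w) : Z)) (E.symm_apply_apply w)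

theorem IsCAT0.extendsOn_range_boundaryMap {X Y : Type*} [MetricSpace X] [MetricSpace Y]
    [ProperSpace X] [MulAction Γ X] [IsIsometricSMul Γ X] [MulAction H Y] [IsIsometricSMul H Y]
    [NoncompactSpace Y] (hX : IsCAT0 X) {e : Y → X} (he : Isometry e)
    (hcl : IsClosed (Set.range e)) (hmid : hX.MidClosed (Set.range e))
    (hcont : ∀ y : Y, Continuous fun h : H => h • y)
    (hφ : ∀ γ : Γ, ∃ K, ∀ y, dist (γ • e y) (e (φ γ • y)) ≤ K) :
    ExtendsOn φ (Set.range (boundaryMap he)) := by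
  have hclosed : Topology.IsClosedEmbedding e := ⟨he.isEmbedding, hcl⟩
  have : ProperSpace Y := LipschitzWith.properSpace hclosed.isProperMap he.lipschitz
  have hY := hX.of_isometry he hcl hmid
  have : Nonempty (Boundary Y) := hY.nonempty_boundary
  obtain ⟨y, -⟩ := (Filter.cocompact Y).nonempty_of_mem Filter.univ_mem
  refine .range (hY.continuous_smul_boundary hcont)
    (hX.isClosedEmbedding_boundaryMap hY he hcl y) fun γ ξ => ?_
  obtain ⟨c, rfl : c.endpoint = ξ⟩ := Quotient.exists_rep ξ
  obtain ⟨K, hK⟩ := hφ γ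
  rw [smul_endpoint, boundaryMap_endpoint, boundaryMap_endpoint, smul_endpoint, endpoint_eq_iff]
  exact ⟨K, fun t => (dist_comm _ _).trans_le (hK (c.toFun t))⟩

end Extension

/-! ### Barycenters -/

section Barycenter

open Filter Topology MeasureTheory

variable {X : Type*} [MetricSpace X]

theorem sq_dist_le_two_mul (a b c : X) : dist a c ^ 2 ≤ 2 * (dist a b ^ 2 + dist b c ^ 2) :=
  (pow_le_pow_left₀ dist_nonneg (dist_triangle a b c) 2).trans add_sq_le

/-- Nonnegative continuous functions on a CAT(0) space that are as convex as the square of a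
distance; convexity is only required at midpoints. -/
structure IsCAT0.Quadratic (hX : IsCAT0 X) (F : X → ℝ) : Prop where
  continuous : Continuous F
  nonneg : ∀ x, 0 ≤ F x
  convex : ∀ x y, F (hX.mid x y) ≤ (F x + F y) / 2 - dist x y ^ 2 / 4

/-- A point where `F` is minimal; a junk value if there is none. -/
noncomputable def argmin [Nonempty X] (F : X → ℝ) : X :=
  Classical.epsilon fun b => ∀ x, F b ≤ F x

namespace IsCAT0.Quadratic

variable {hX : IsCAT0 X} {F F' : X → ℝ}

theorem exists_min [CompleteSpace X] [Nonempty X] (hF : hX.Quadratic F) : ∃ b, ∀ x, F b ≤ F x := by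
  have bdd : BddBelow (Set.range F) := ⟨0, by rintro _ ⟨x, rfl⟩; exact hF.nonneg x⟩
  have approx : ∀ n : ℕ, ∃ x, F x < (⨅ y, F y) + 1 / (n + 1) := fun n =>
    exists_lt_of_ciInf_lt (lt_add_of_pos_right _ Nat.one_div_pos_of_nat)
  choose x hx using approx
  have cauchy : CauchySeq x := by
    refine cauchySeq_of_le_tendsto_0 (fun N : ℕ => √(4 * (1 / ((N : ℝ) + 1))))
      (fun n k N hn hk => ?_) ?_
    · refine Real.le_sqrt_of_sq_le ?_
      have hmid := (ciInf_le bdd _).trans (hF.convex (x n) (x k))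
      have hxn := (hx n).trans_le (add_le_add_right (Nat.one_div_le_one_div hn) _)
      have hxk := (hx k).trans_le (add_le_add_right (Nat.one_div_le_one_div hk) _)
      linarith
    · simpa using ((tendsto_one_div_add_atTop_nhds_zero_nat (𝕜 := ℝ)).const_mul 4).sqrt
  obtain ⟨b, hb⟩ := cauchySeq_tendsto_of_complete cauchy
  have hFb : F b ≤ ⨅ y, F y := by
    refine le_of_tendsto_of_tendsto' ((hF.continuous.tendsto b).comp hb) ?_ fun n => (hx n).le
    simpa using (tendsto_one_div_add_atTop_nhds_zero_nat (𝕜 := ℝ)).const_add (⨅ y, F y)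
  exact ⟨b, fun y => hFb.trans (ciInf_le bdd y)⟩

variable [CompleteSpace X] [Nonempty X]

theorem argmin_le (hF : hX.Quadratic F) (x : X) : F (argmin F) ≤ F x :=
  Classical.epsilon_spec (p := fun b => ∀ x, F b ≤ F x) hF.exists_min x

theorem add_sq_dist_argmin_le (hF : hX.Quadratic F) (z : X) :
    F (argmin F) + dist (argmin F) z ^ 2 ≤ F z := by
  set b := argmin F
  -- Halving the segment from `b` to `z` improves the constant `1 - 2⁻ⁿ` to `1 - 2⁻⁽ⁿ⁺¹⁾`.
  have improve : ∀ n : ℕ, ∀ z, F b + (1 - (1 / 2) ^ n) * dist b z ^ 2 ≤ F z := by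
    intro n
    induction n with
    | zero => intro z; simpa using hF.argmin_le z
    | succ n ih =>
      intro z
      have hmid := ih (hX.mid b z)
      have hconv := hF.convex b z
      rw [dist_comm b (hX.mid b z), hX.dist_mid_left] at hmid
      rw [pow_succ]
      nlinarith
  have lim : Tendsto (fun n : ℕ => F b + (1 - (1 / 2 : ℝ) ^ n) * dist b z ^ 2) atTop
      (𝓝 (F b + (1 - 0) * dist b z ^ 2)) :=
    (((tendsto_pow_atTop_nhds_zero_of_lt_one (by norm_num) (by norm_num)).const_sub
      1).mul_const _).const_add _
  simpa using le_of_tendsto' lim fun n => improve n z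

theorem sq_dist_argmin_le (hF : hX.Quadratic F) (z : X) : dist (argmin F) z ^ 2 ≤ F z :=
  (le_add_of_nonneg_left (hF.nonneg _)).trans (hF.add_sq_dist_argmin_le z)

theorem eq_argmin (hF : hX.Quadratic F) {b : X} (hb : ∀ x, F b ≤ F x) : b = argmin F := by
  have h := hF.add_sq_dist_argmin_le b
  have hsq : dist (argmin F) b ^ 2 ≤ 0 := by linarith [hb (argmin F)]
  exact (dist_eq_zero.1 (pow_eq_zero_iff two_ne_zero |>.1 (hsq.antisymm (sq_nonneg _)))).symm

theorem smul_argmin {M : Type*} [Group M] [MulAction M X] (hF : hX.Quadratic F)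
    (hF' : hX.Quadratic F') {g : M} (h : ∀ x, F' (g • x) = F x) :
    g • argmin F = argmin F' := by
  refine hF'.eq_argmin fun x => ?_
  rw [h, ← smul_inv_smul g x, h]
  exact hF.argmin_le _

end IsCAT0.Quadratic

theorem IsCAT0.continuous_argmin [ProperSpace X] [Nonempty X] {hX : IsCAT0 X} {E : Type*}
    [TopologicalSpace E] {F : E → X → ℝ} (hF : ∀ e, hX.Quadratic (F e))
    (hc : Continuous (Function.uncurry F)) : Continuous fun e => argmin (F e) := by
  refine continuous_iff_continuousAt.2 fun e₀ => Metric.tendsto_nhds.2 fun ε hε => ?_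
  set b : E → X := fun e => argmin (F e)
  set r := √(F e₀ (b e₀) + 1)
  have hr : r ^ 2 = F e₀ (b e₀) + 1 := Real.sq_sqrt (by linarith [(hF e₀).nonneg (b e₀)])
  have bounded : ∀ᶠ e in 𝓝 e₀, F e (b e₀) < r ^ 2 :=
    (hc.comp (Continuous.prodMk_left (b e₀))).continuousAt.eventually_lt_const (by simp [hr])
  have uniform : ∀ᶠ e in 𝓝 e₀, ∀ x ∈ Metric.closedBall (b e₀) r, |F e x - F e₀ x| < ε ^ 2 := by
    refine (isCompact_closedBall _ _).eventually_forall_of_forall_eventually fun x _ => ?_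
    have hcont : Continuous fun z : E × X => |F z.1 z.2 - F e₀ z.2| :=
      (hc.sub (hc.comp (continuous_const.prodMk continuous_snd))).abs
    exact hcont.continuousAt.eventually_lt_const (by simpa using pow_pos hε 2)
  filter_upwards [bounded, uniform] with e hb hu
  have hmem : b e ∈ Metric.closedBall (b e₀) r :=
    (pow_lt_pow_iff_left₀ dist_nonneg (Real.sqrt_nonneg _) two_ne_zero).1
      (((hF e).sq_dist_argmin_le _).trans_lt hb) |>.le
  have hvar := (hF e).add_sq_dist_argmin_le (b e₀)
  have hvar₀ := (hF e₀).add_sq_dist_argmin_le (b e)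
  rw [dist_comm] at hvar₀
  have hclose := (abs_lt.1 (hu _ hmem)).1
  have hclose₀ := (abs_lt.1 (hu _ (Metric.mem_closedBall_self (Real.sqrt_nonneg _)))).2
  exact lt_of_pow_lt_pow_left₀ 2 hε.le (by linarith)

variable {Ω : Type*} [MeasurableSpace Ω] {μ : Measure Ω} {ρ : Ω → ℝ} {p p' : Ω → X}

/-- The measure `ρ μ` is a probability measure whose image under `p` has finite second moments. -/
structure HasSecondMoment (μ : Measure Ω) (ρ : Ω → ℝ) (p : Ω → X) : Prop where
  nonneg : ∀ ω, 0 ≤ ρ ω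
  integral_eq_one : ∫ ω, ρ ω ∂μ = 1
  integrable_sq : ∀ x, Integrable (fun ω => ρ ω * dist x (p ω) ^ 2) μ

/-- The barycenter of the image of the probability measure `ρ μ` under `p`. -/
noncomputable def bary [Nonempty X] (μ : Measure Ω) (ρ : Ω → ℝ) (p : Ω → X) : X :=
  argmin fun x => ∫ ω, ρ ω * dist x (p ω) ^ 2 ∂μ

namespace HasSecondMoment

theorem integrable (h : HasSecondMoment μ ρ p) : Integrable ρ μ :=
  .of_integral_ne_zero (h.integral_eq_one.trans_ne one_ne_zero)

theorem integral_mul_const (h : HasSecondMoment μ ρ p) (c : ℝ) : ∫ ω, ρ ω * c ∂μ = c := by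
  rw [MeasureTheory.integral_mul_const, h.integral_eq_one, one_mul]

theorem continuous_integral (h : HasSecondMoment μ ρ p) :
    Continuous fun x => ∫ ω, ρ ω * dist x (p ω) ^ 2 ∂μ := by
  refine continuous_iff_continuousAt.2 fun x₀ => ?_
  refine continuousAt_of_dominated (bound := fun ω => 2 * (ρ ω * 1 + ρ ω * dist x₀ (p ω) ^ 2))
    (.of_forall fun x => (h.integrable_sq x).aestronglyMeasurable) ?_
    (((h.integrable.mul_const 1).add (h.integrable_sq x₀)).const_mul 2)
    (.of_forall fun ω => Continuous.continuousAt (by fun_prop))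
  filter_upwards [Metric.ball_mem_nhds x₀ one_pos] with x hx
  refine .of_forall fun ω => ?_
  have hxx₀ : dist x x₀ ^ 2 ≤ 1 := pow_le_one₀ dist_nonneg (Metric.mem_ball.1 hx).le
  rw [Real.norm_of_nonneg (mul_nonneg (h.nonneg ω) (sq_nonneg _)), ← mul_add, mul_left_comm]
  refine mul_le_mul_of_nonneg_left ?_ (h.nonneg ω)
  linarith [sq_dist_le_two_mul x x₀ (p ω)]

theorem integral_sq_dist_mid_le (hX : IsCAT0 X) (h : HasSecondMoment μ ρ p) (x y : X) :
    ∫ ω, ρ ω * dist (hX.mid x y) (p ω) ^ 2 ∂μ ≤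
      ((∫ ω, ρ ω * dist x (p ω) ^ 2 ∂μ) + ∫ ω, ρ ω * dist y (p ω) ^ 2 ∂μ) / 2
        - dist x y ^ 2 / 4 := by
  have hi : Integrable (fun ω => (ρ ω * dist x (p ω) ^ 2 + ρ ω * dist y (p ω) ^ 2) / 2) μ :=
    ((h.integrable_sq x).add (h.integrable_sq y)).div_const 2
  have hc : Integrable (fun ω => ρ ω * (dist x y ^ 2 / 4)) μ := h.integrable.mul_const _
  calc _ ≤ ∫ ω, ((ρ ω * dist x (p ω) ^ 2 + ρ ω * dist y (p ω) ^ 2) / 2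
          - ρ ω * (dist x y ^ 2 / 4)) ∂μ := by
        refine integral_mono (h.integrable_sq _) (hi.sub hc) fun ω => ?_
        linarith [mul_le_mul_of_nonneg_left (hX.sq_dist_mid_le x y (p ω)) (h.nonneg ω)]
    _ = _ := by
        rw [integral_sub hi hc, integral_div, integral_add (h.integrable_sq x) (h.integrable_sq y),
          h.integral_mul_const]

theorem quadratic (hX : IsCAT0 X) (h : HasSecondMoment μ ρ p) :
    hX.Quadratic fun x => ∫ ω, ρ ω * dist x (p ω) ^ 2 ∂μ where
  continuous := h.continuous_integral
  nonneg _ := integral_nonneg fun ω => mul_nonneg (h.nonneg ω) (sq_nonneg _)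
  convex := h.integral_sq_dist_mid_le hX

end HasSecondMoment

theorem IsCAT0.quadratic_sum (hX : IsCAT0 X) {I : Type*} (T : Finset I) {ρ : I → ℝ}
    (h0 : ∀ i, 0 ≤ ρ i) (h1 : ∑ i ∈ T, ρ i = 1) (p : I → X) :
    hX.Quadratic fun x => ∑ i ∈ T, ρ i * dist x (p i) ^ 2 := by
  let : MeasurableSpace T := ⊤
  have hint : ∀ φ : I → ℝ, ∫ i : T, φ i ∂Measure.count = ∑ i ∈ T, φ i := fun φ => by
    simp [integral_countable, Finset.sum_attach T φ]
  have h : HasSecondMoment (Measure.count : Measure T) (fun i => ρ i) fun i => p i :=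
    ⟨fun i => h0 i, (hint ρ).trans h1, fun _ => .of_finite⟩
  convert h.quadratic hX using 2 with x
  exact (hint fun i => ρ i * dist x (p i) ^ 2).symm

section Bary

variable [CompleteSpace X] [Nonempty X] (hX : IsCAT0 X)

include hX

namespace IsCAT0

theorem sq_dist_bary_le (h : HasSecondMoment μ ρ p) (z : X) :
    dist (bary μ ρ p) z ^ 2 ≤ ∫ ω, ρ ω * dist z (p ω) ^ 2 ∂μ :=
  (h.quadratic hX).sq_dist_argmin_le z

theorem sq_dist_bary_bary_le (h : HasSecondMoment μ ρ p) (h' : HasSecondMoment μ ρ p')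
    (hi : Integrable (fun ω => ρ ω * dist (p ω) (p' ω) ^ 2) μ) :
    dist (bary μ ρ p) (bary μ ρ p') ^ 2 ≤ ∫ ω, ρ ω * dist (p ω) (p' ω) ^ 2 ∂μ := by
  set b := bary μ ρ p with hb
  set b' := bary μ ρ p' with hb'
  have hvar := (h.quadratic hX).add_sq_dist_argmin_le b'
  have hvar' := (h'.quadratic hX).add_sq_dist_argmin_le b
  rw [← bary, ← hb] at hvar
  rw [← bary, ← hb', dist_comm b' b] at hvar'
  have reshetnyak :
      (∫ ω, ρ ω * dist b' (p ω) ^ 2 ∂μ) + (∫ ω, ρ ω * dist b (p' ω) ^ 2 ∂μ) ≤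
      (∫ ω, ρ ω * dist b (p ω) ^ 2 ∂μ) + (∫ ω, ρ ω * dist b' (p' ω) ^ 2 ∂μ)
        + ((∫ ω, ρ ω * dist (p ω) (p' ω) ^ 2 ∂μ) + ∫ ω, ρ ω * dist b b' ^ 2 ∂μ) := by
    have hb'p := h.integrable_sq b'
    have hbp' := h'.integrable_sq b
    have hbp : Integrable (fun ω => ρ ω * dist b (p ω) ^ 2 + ρ ω * dist b' (p' ω) ^ 2) μ :=
      (h.integrable_sq b).add (h'.integrable_sq b')
    have hc : Integrable (fun ω => ρ ω * dist b b' ^ 2) μ := h.integrable.mul_const _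
    have hic : Integrable (fun ω => ρ ω * dist (p ω) (p' ω) ^ 2 + ρ ω * dist b b' ^ 2) μ :=
      hi.add hc
    rw [← integral_add hb'p hbp', ← integral_add (h.integrable_sq b) (h'.integrable_sq b'),
      ← integral_add hi hc, ← integral_add hbp hic]
    refine integral_mono (hb'p.add hbp') (hbp.add hic) fun ω => ?_
    simp only [← mul_add]
    refine mul_le_mul_of_nonneg_left ?_ (h.nonneg ω)
    simp only [dist_comm b, dist_comm b' (p ω), dist_comm b' (p' ω)]
    have hquad := hX.sq_dist_add_sq_dist_le (p ω) (p' ω) b b'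
    rw [dist_comm b b'] at hquad
    linarith [two_mul_le_add_sq (dist (p ω) (p' ω)) (dist b' b)]
  rw [h.integral_mul_const] at reshetnyak
  linarith

theorem smul_bary {M : Type*} [Group M] [MulAction M X] [IsIsometricSMul M X]
    (h : HasSecondMoment μ ρ p) (g : M) : g • bary μ ρ p = bary μ ρ fun ω => g • p ω := by
  have hdist : ∀ x ω, dist x (g • p ω) = dist (g⁻¹ • x) (p ω) := fun x ω => by
    rw [← dist_smul g (g⁻¹ • x), smul_inv_smul]
  have h' : HasSecondMoment μ ρ fun ω => g • p ω :=
    ⟨h.nonneg, h.integral_eq_one, fun x => by simpa only [hdist] using h.integrable_sq _⟩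
  exact (h.quadratic hX).smul_argmin (h'.quadratic hX) fun x => by simp only [dist_smul]

end IsCAT0

end Bary

end Barycenter

/-! ### Uniform lattices -/

section Lattice

open Filter Topology MeasureTheory

theorem integral_mul_integral_mul_comm {G H : Type*} [TopologicalSpace G] [TopologicalSpace H]
    [MeasurableSpace G] [OpensMeasurableSpace G] [MeasurableSpace H] [OpensMeasurableSpace H]
    {m : Measure G} [IsFiniteMeasureOnCompacts m] {mH : Measure H} [IsFiniteMeasureOnCompacts mH]
    {w : G → ℝ} {ν : H → ℝ} (wc : Continuous w) (ws : HasCompactSupport w) (νc : Continuous ν)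
    (νs : HasCompactSupport ν) {Φ : G → H → ℝ} (hΦ : Continuous (Function.uncurry Φ)) :
    ∫ g, w g * (∫ q, ν q * Φ g q ∂mH) ∂m = ∫ q, ν q * (∫ g, w g * Φ g q ∂m) ∂mH := by
  simp_rw [← integral_const_mul]
  rw [integral_integral_swap_of_hasCompactSupport]
  · simp_rw [mul_left_comm (w _)]
  · exact (wc.comp continuous_fst).mul ((νc.comp continuous_snd).mul hΦ)
  · refine HasCompactSupport.intro' (ws.isCompact.prod νs.isCompact)
      ((isClosed_tsupport _).prod (isClosed_tsupport _)) ?_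
    rintro ⟨g, q⟩ hgq
    rcases not_and_or.1 (Set.mem_prod.not.1 hgq) with h | h <;>
      simp [Function.uncurry, image_eq_zero_of_notMem_tsupport h]

theorem exists_continuousMap_one_on {Y : Type*} [TopologicalSpace Y] [R1Space Y]
    [LocallyCompactSpace Y] {K : Set Y} (hK : IsCompact K) :
    ∃ u : C(Y, ℝ), HasCompactSupport u ∧ (∀ y, 0 ≤ u y) ∧ Set.EqOn u 1 K := by
  obtain ⟨u, hu1, hus, -, hu⟩ :=
    exists_continuousMap_one_of_isCompact_subset_isOpen hK isOpen_univ K.subset_univ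
  exact ⟨u, hus, fun y => (hu y).1, hu1⟩

variable {G : Type*} [Group G] {Γ : Subgroup G}

/-- The sum of the translates of `u` by elements of `Γ`. -/
noncomputable def periodization (Γ : Subgroup G) (u : G → ℝ) (g : G) : ℝ :=
  ∑ᶠ γ : Γ, u (γ * g)

theorem periodization_mul (u : G → ℝ) (γ : Γ) (g : G) :
    periodization Γ u (γ * g) = periodization Γ u g := by
  simp only [periodization]
  rw [← finsum_comp_equiv (Equiv.mulRight γ) (f := fun δ : Γ => u (δ * g))]
  simp [mul_assoc]

variable [TopologicalSpace G]

/-- Weights on `G` whose translates by `Γ` add up to one. Integrating a `Γ`-invariant function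
against such a weight is integrating it over `Γ \ G`. -/
structure IsWeight (Γ : Subgroup G) (w : G → ℝ) : Prop where
  continuous : Continuous w
  hasCompactSupport : HasCompactSupport w
  nonneg : ∀ g, 0 ≤ w g
  periodization_eq_one : ∀ g, periodization Γ w g = 1

namespace IsWeight

variable {w : G → ℝ} (hw : IsWeight Γ w)

include hw

theorem exists_pos (g : G) : ∃ γ : Γ, 0 < w (γ * g) := by
  by_contra! hcon
  have h := hw.periodization_eq_one g
  simp [periodization, fun γ : Γ => (hcon γ).antisymm (hw.nonneg _)] at h

variable [MeasurableSpace G] [BorelSpace G] {m : Measure G} [IsFiniteMeasureOnCompacts m]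

theorem integrable_mul {φ : G → ℝ} (φc : Continuous φ) :
    Integrable (fun g => w g * φ g) m :=
  (hw.continuous.mul φc).integrable_of_hasCompactSupport hw.hasCompactSupport.mul_right

theorem integral_mul_pos [m.IsOpenPosMeasure] {φ : G → ℝ}
    (φc : Continuous φ) (φ0 : ∀ g, 0 ≤ φ g) {γ : Γ} {g : G} (hγ : 0 < w (γ * g))
    (hφ : φ (γ * g) ≠ 0) : 0 < ∫ g, w g * φ g ∂m :=
  (hw.continuous.mul φc).integral_pos_of_hasCompactSupport_nonneg_nonzero
    hw.hasCompactSupport.mul_right (fun g => mul_nonneg (hw.nonneg g) (φ0 g))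
    (mul_ne_zero hγ.ne' hφ)

theorem eq_zero_of_integral_mul_eq_zero [m.IsOpenPosMeasure]
    {φ : G → ℝ} (φc : Continuous φ) (φΓ : ∀ (γ : Γ) g, φ (γ * g) = φ g) (φ0 : ∀ g, 0 ≤ φ g)
    (h : ∫ g, w g * φ g ∂m = 0) (g : G) : φ g = 0 := by
  obtain ⟨γ, hγ⟩ := hw.exists_pos g
  by_contra hne
  exact (hw.integral_mul_pos φc φ0 hγ (by rwa [φΓ])).ne' h

theorem integral_pos [m.IsOpenPosMeasure] : 0 < ∫ g, w g ∂m := by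
  obtain ⟨γ, hγ⟩ := hw.exists_pos 1
  simpa using hw.integral_mul_pos (m := m) continuous_const (fun _ => zero_le_one) hγ one_ne_zero

end IsWeight

variable [IsTopologicalGroup G]

theorem IsUniformLattice.exists_isCompact_forall_mul_mem [LocallyCompactSpace G]
    (hΓ : IsUniformLattice Γ) : ∃ F : Set G, IsCompact F ∧ ∀ g : G, ∃ γ : Γ, (γ : G) * g ∈ F := by
  have := hΓ.cocompact
  choose K hK hmem using fun g : G => exists_compact_mem_nhds g
  obtain ⟨t, ht⟩ := isCompact_univ.elim_finite_subcover
    (fun g : G => (QuotientGroup.mk '' interior (K g) : Set (G ⧸ Γ)))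
    (fun g => QuotientGroup.isOpenMap_coe _ isOpen_interior) (by
      intro q _
      obtain ⟨g, rfl⟩ := QuotientGroup.mk_surjective q
      exact Set.mem_iUnion.2 ⟨g, g, mem_interior_iff_mem_nhds.2 (hmem g), rfl⟩)
  refine ⟨(⋃ g ∈ t, K g)⁻¹, (t.finite_toSet.isCompact_biUnion fun g _ => hK g).inv, fun g => ?_⟩
  obtain ⟨a, hat, b, hb, hab⟩ := Set.mem_iUnion₂.1 (ht (Set.mem_univ (QuotientGroup.mk g⁻¹)))
  refine ⟨⟨b⁻¹ * g⁻¹, QuotientGroup.eq.1 hab⟩, ?_⟩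
  simp only [inv_mul_cancel_right, Set.mem_inv, inv_inv]
  exact Set.mem_biUnion hat (interior_subset hb)

theorem finite_setOf_exists_mul_mem [T2Space G] [DiscreteTopology Γ] {A B : Set G}
    (hA : IsCompact A) (hB : IsCompact B) : {γ : Γ | ∃ a ∈ A, (γ : G) * a ∈ B}.Finite := by
  have hfin := Subgroup.tendsto_coe_cofinite_of_discrete Γ ⟨inferInstance⟩
    (hB.mul hA.inv).compl_mem_cocompact
  rw [mem_map, mem_cofinite] at hfin
  refine hfin.subset ?_
  rintro γ ⟨a, ha, hb⟩
  simp only [Set.preimage_compl, compl_compl, Set.mem_preimage]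
  exact ⟨γ * a, hb, a⁻¹, by simpa using ha, by group⟩

section Discrete

variable [T2Space G] [DiscreteTopology Γ]

theorem locallyFinite_support_mul [LocallyCompactSpace G] {u : G → ℝ} (us : HasCompactSupport u) :
    LocallyFinite fun γ : Γ => Function.support fun g => u ((γ : G) * g) := by
  intro g
  obtain ⟨K, hK, hg⟩ := exists_compact_mem_nhds g
  refine ⟨K, hg, (finite_setOf_exists_mul_mem hK us).subset ?_⟩
  rintro γ ⟨a, ha, haK⟩
  exact ⟨a, haK, subset_tsupport _ ha⟩

theorem continuous_periodization [LocallyCompactSpace G] {u : G → ℝ} (uc : Continuous u)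
    (us : HasCompactSupport u) : Continuous (periodization Γ u) :=
  continuous_finsum (fun γ : Γ => uc.comp (continuous_const_mul (γ : G)))
    (locallyFinite_support_mul us)

theorem exists_mul_periodization_eq_sum {u v : G → ℝ} (us : HasCompactSupport u)
    (vs : HasCompactSupport v) : ∃ T : Finset Γ,
      (∀ g, u g * periodization Γ v g = ∑ γ ∈ T, u g * v ((γ : G)⁻¹ * g)) ∧
      ∀ g, v g * periodization Γ u g = ∑ γ ∈ T, v g * u (γ * g) := by
  have hfin := finite_setOf_exists_mul_mem (Γ := Γ) vs us
  refine ⟨hfin.toFinset, fun g => ?_, fun g => ?_⟩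
  · rcases eq_or_ne (u g) 0 with hu | hu
    · simp [hu]
    rw [← Finset.mul_sum, periodization, ← finsum_comp_equiv (Equiv.inv Γ)]
    simp only [Equiv.inv_apply, Subgroup.coe_inv]
    congr 1
    refine finsum_eq_sum_of_support_subset _ fun γ hγ => hfin.mem_toFinset.2 ?_
    exact ⟨(γ : G)⁻¹ * g, subset_tsupport _ hγ, by simpa using subset_tsupport _ hu⟩
  · rcases eq_or_ne (v g) 0 with hv | hv
    · simp [hv]
    rw [← Finset.mul_sum, periodization]
    congr 1
    refine finsum_eq_sum_of_support_subset _ fun γ hγ => hfin.mem_toFinset.2 ?_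
    exact ⟨g, subset_tsupport _ hv, subset_tsupport _ hγ⟩

variable [MeasurableSpace G] [BorelSpace G] {m : Measure G} [m.IsMulLeftInvariant]
  [IsFiniteMeasureOnCompacts m]

theorem integral_mul_periodization_comm {u v φ : G → ℝ} (uc : Continuous u)
    (us : HasCompactSupport u) (vc : Continuous v) (vs : HasCompactSupport v)
    (φc : Continuous φ) (φΓ : ∀ (γ : Γ) g, φ (γ * g) = φ g) :
    ∫ g, u g * periodization Γ v g * φ g ∂m = ∫ g, v g * periodization Γ u g * φ g ∂m := by
  obtain ⟨T, huT, hvT⟩ := exists_mul_periodization_eq_sum (Γ := Γ) us vs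
  simp only [huT, hvT, Finset.sum_mul]
  rw [integral_finsetSum, integral_finsetSum]
  · refine Finset.sum_congr rfl fun γ _ => ?_
    rw [← integral_mul_left_eq_self _ (γ : G)]
    simp only [φΓ, inv_mul_cancel_left, mul_comm]
  · exact fun γ _ => Continuous.integrable_of_hasCompactSupport (by fun_prop)
      vs.mul_right.mul_right
  · exact fun γ _ => Continuous.integrable_of_hasCompactSupport (by fun_prop)
      us.mul_right.mul_right

end Discrete

theorem IsUniformLattice.exists_isWeight [T2Space G] [LocallyCompactSpace G]
    (hΓ : IsUniformLattice Γ) : ∃ w : G → ℝ, IsWeight Γ w := by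
  have := hΓ.discrete
  obtain ⟨F, hF, hFΓ⟩ := hΓ.exists_isCompact_forall_mul_mem
  obtain ⟨u, us, u0, u1⟩ := exists_continuousMap_one_on hF
  set U := periodization Γ u with hU
  have U_pos : ∀ g, 0 < U g := by
    intro g
    obtain ⟨γ, hγ⟩ := hFΓ g
    calc (0 : ℝ) < u (γ * g) := by rw [u1 hγ]; exact one_pos
      _ ≤ U g := single_le_finsum γ ((locallyFinite_support_mul us).point_finite g) fun _ => u0 _
  refine ⟨fun g => u g / U g, u.continuous.div
    (continuous_periodization u.continuous us) fun g => (U_pos g).ne', ?_,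
    fun g => div_nonneg (u0 g) (U_pos g).le, fun g => ?_⟩
  · simp only [div_eq_mul_inv]
    exact us.mul_right
  · simp only [periodization, hU, periodization_mul, div_eq_mul_inv]
    rw [← finsum_mul]
    exact mul_inv_cancel₀ (U_pos g).ne'

namespace IsWeight

variable {w : G → ℝ} (hw : IsWeight Γ w)

include hw

theorem comp_mul_right (h : G) : IsWeight Γ fun g => w (g * h) where
  continuous := hw.continuous.comp (continuous_mul_const h)
  hasCompactSupport := hw.hasCompactSupport.comp_homeomorph (Homeomorph.mulRight h)
  nonneg g := hw.nonneg _
  periodization_eq_one g := by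
    simpa [periodization, mul_assoc] using hw.periodization_eq_one (g * h)

variable [MeasurableSpace G] [BorelSpace G] {m : Measure G}

section Unfold

variable [T2Space G] [DiscreteTopology Γ] {u φ : G → ℝ}

theorem integral_mul_eq [m.IsMulLeftInvariant] [IsFiniteMeasureOnCompacts m] (uc : Continuous u)
    (us : HasCompactSupport u) (φc : Continuous φ) (φΓ : ∀ (γ : Γ) g, φ (γ * g) = φ g) :
    ∫ g, u g * φ g ∂m = ∫ g, w g * periodization Γ u g * φ g ∂m := by
  have h := integral_mul_periodization_comm (m := m) uc us hw.continuous hw.hasCompactSupport φc φΓ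
  simpa only [hw.periodization_eq_one, mul_one] using h

theorem integral_mul_eq_of_isWeight [m.IsMulLeftInvariant] [IsFiniteMeasureOnCompacts m]
    (hu : IsWeight Γ u) (φc : Continuous φ) (φΓ : ∀ (γ : Γ) g, φ (γ * g) = φ g) :
    ∫ g, u g * φ g ∂m = ∫ g, w g * φ g ∂m := by
  simp only [hw.integral_mul_eq hu.continuous hu.hasCompactSupport φc φΓ, hu.periodization_eq_one,
    mul_one]

theorem exists_integral_mul_le [LocallyCompactSpace G] [m.IsMulLeftInvariant]
    [IsFiniteMeasureOnCompacts m] (uc : Continuous u) (us : HasCompactSupport u) :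
    ∃ C : ℝ, 0 ≤ C ∧ ∀ φ : G → ℝ, Continuous φ → (∀ (γ : Γ) g, φ (γ * g) = φ g) →
      (∀ g, 0 ≤ φ g) → ∫ g, u g * φ g ∂m ≤ C * ∫ g, w g * φ g ∂m := by
  have Uc : Continuous (periodization Γ u) := continuous_periodization uc us
  obtain ⟨C, hC⟩ := hw.hasCompactSupport.isCompact.exists_bound_of_continuousOn Uc.continuousOn
  refine ⟨max C 0, le_max_right _ _, fun φ φc φΓ φ0 => ?_⟩
  rw [hw.integral_mul_eq uc us φc φΓ, ← integral_const_mul]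
  refine integral_mono ?_ ((hw.integrable_mul φc).const_mul _) fun g => ?_
  · have := hw.integrable_mul (m := m) (φ := fun g => periodization Γ u g * φ g) (Uc.mul φc)
    simpa only [mul_assoc] using this
  by_cases hg : g ∈ tsupport w
  · have hU : periodization Γ u g ≤ max C 0 :=
      (le_abs_self _).trans ((hC g hg).trans (le_max_left _ _))
    calc w g * periodization Γ u g * φ g = periodization Γ u g * (w g * φ g) := by ring
      _ ≤ max C 0 * (w g * φ g) :=
        mul_le_mul_of_nonneg_right hU (mul_nonneg (hw.nonneg g) (φ0 g))
  · simp [image_eq_zero_of_notMem_tsupport hg]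

variable [m.IsHaarMeasure] (φc : Continuous φ) (φΓ : ∀ (γ : Γ) g, φ (γ * g) = φ g)

include φc φΓ

theorem integral_mul_comp_mul_right_eq_smul (h : G) : ∫ g, w g * φ (g * h) ∂m =
    Measure.haarScalarFactor (m.map (· * h)) m * ∫ g, w g * φ g ∂m := by
  have hwh := hw.comp_mul_right h⁻¹
  calc ∫ g, w g * φ (g * h) ∂m = ∫ g, w (g * h⁻¹) * φ g ∂(m.map (· * h)) := by
        have hmap := (Homeomorph.mulRight h).measurableEmbedding.integral_map
          (μ := m) (fun g => w (g * h⁻¹) * φ g)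
        simpa only [Homeomorph.coe_mulRight, mul_inv_cancel_right] using hmap.symm
    _ = _ := by
        rw [Measure.integral_isMulLeftInvariant_eq_smul_of_hasCompactSupport (m.map (· * h)) m
          (f := fun g => w (g * h⁻¹) * φ g) (hwh.continuous.mul φc)
          hwh.hasCompactSupport.mul_right, integral_smul_nnreal_measure,
          ← hw.integral_mul_eq_of_isWeight hwh φc φΓ]
        rfl

-- Unimodularity of `G`: constant functions show that the Haar scalar factor is one.
theorem integral_mul_comp_mul_right (h : G) : ∫ g, w g * φ (g * h) ∂m = ∫ g, w g * φ g ∂m := by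
  have hone := hw.integral_mul_comp_mul_right_eq_smul (m := m) (φ := fun _ => 1) continuous_const
    (fun _ _ => rfl) h
  simp only [mul_one] at hone
  rw [hw.integral_mul_comp_mul_right_eq_smul φc φΓ,
    (right_eq_mul₀ hw.integral_pos.ne').1 hone, one_mul]

theorem integral_mul_average {H : Type*} [TopologicalSpace H] [MeasurableSpace H]
    [OpensMeasurableSpace H] {mH : Measure H} [IsFiniteMeasureOnCompacts mH] {ν : H → ℝ}
    {ι : H → G} (ιc : Continuous ι) (νc : Continuous ν) (νs : HasCompactSupport ν) :
    ∫ g, w g * (∫ q, ν q * φ (g * ι q) ∂mH) ∂m = (∫ q, ν q ∂mH) * ∫ g, w g * φ g ∂m := by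
  rw [integral_mul_integral_mul_comm hw.continuous hw.hasCompactSupport νc νs (by
    unfold Function.uncurry; fun_prop)]
  simp_rw [hw.integral_mul_comp_mul_right φc φΓ, integral_mul_const]

end Unfold

theorem exists_forall_le_mul_integral [T2Space G] [LocallyCompactSpace G] [m.IsHaarMeasure]
    (hΓ : IsUniformLattice Γ) {W : Set G} (hW : W ∈ 𝓝 1) :
    ∃ C : ℝ, 0 ≤ C ∧ ∀ φ : G → ℝ, Continuous φ → (∀ (γ : Γ) g, φ (γ * g) = φ g) →
      (∀ g, 0 ≤ φ g) → ∀ g v, (∀ x ∈ W, v ≤ φ (g * x)) → v ≤ C * ∫ g, w g * φ g ∂m := by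
  have := hΓ.discrete
  obtain ⟨F, hF, hFΓ⟩ := hΓ.exists_isCompact_forall_mul_mem
  obtain ⟨β, β1, βs, βW, β01⟩ := exists_continuousMap_one_of_isCompact_subset_isOpen
    (isCompact_singleton (x := (1 : G))) isOpen_interior
    (by simpa [mem_interior_iff_mem_nhds] using hW)
  obtain ⟨U, Us, U0, U1⟩ := exists_continuousMap_one_on (hF.mul (HasCompactSupport.isCompact βs))
  obtain ⟨C, hC0, hC⟩ := hw.exists_integral_mul_le (m := m) U.continuous Us
  have βpos : 0 < ∫ x, β x ∂m := β.continuous.integral_pos_of_hasCompactSupport_nonneg_nonzero βs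
    (fun x => (β01 x).1) (x := 1) (by simp [β1 rfl])
  refine ⟨C / ∫ x, β x ∂m, by positivity, fun φ φc φΓ φ0 g v hv => ?_⟩
  obtain ⟨γ, hγ⟩ := hFΓ g
  rw [div_mul_eq_mul_div, le_div_iff₀ βpos]
  calc v * ∫ x, β x ∂m = ∫ x, v * β x ∂m := (integral_const_mul _ _).symm
    _ ≤ ∫ x, U (γ * g * x) * φ (γ * g * x) ∂m := by
        refine integral_mono
          ((β.continuous.integrable_of_hasCompactSupport βs).const_mul _) ?_ fun x => ?_
        · exact Continuous.integrable_of_hasCompactSupport (by fun_prop)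
            (Us.comp_homeomorph (Homeomorph.mulLeft (γ * g))).mul_right
        · by_cases hx : x ∈ tsupport β
          · rw [U1 (Set.mul_mem_mul hγ hx), Pi.one_apply, one_mul, mul_assoc, φΓ]
            have hβ := mul_le_mul_of_nonneg_right (hv x (interior_subset (βW hx))) (β01 x).1
            exact hβ.trans (mul_le_of_le_one_right (φ0 _) (β01 x).2)
          · simpa [image_eq_zero_of_notMem_tsupport hx] using mul_nonneg (U0 _) (φ0 _)
    _ = ∫ x, U x * φ x ∂m := integral_mul_left_eq_self (fun x => U x * φ x) _
    _ ≤ C * ∫ g, w g * φ g ∂m := hC φ φc φΓ φ0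

end IsWeight

end Lattice

/-! ### Equivariant maps -/

section Equivariant

open Filter Topology MeasureTheory

variable {X : Type*} [MetricSpace X] {G : Type*} [Group G]

/-- The largest displacement of `f` under right translation by `x`. -/
noncomputable def displacement (f : G → X) (x : G) : ℝ := ⨆ g, dist (f g) (f (g * x))

theorem displacement_nonneg (f : G → X) (x : G) : 0 ≤ displacement f x :=
  Real.iSup_nonneg fun _ => dist_nonneg

variable {Γ : Subgroup G} [MulAction Γ X]

/-- The average of the squared distances to the orbit points `γ⁻¹ • x₀`, with the weights
`w (γ * g)`. -/
noncomputable def weightedSqDist (Γ : Subgroup G) [MulAction Γ X] (w : G → ℝ) (x₀ : X) (g : G)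
    (x : X) : ℝ :=
  ∑ᶠ γ : Γ, w (γ * g) * dist x (γ⁻¹ • x₀) ^ 2

theorem weightedSqDist_mul_smul [IsIsometricSMul Γ X] (w : G → ℝ) (x₀ : X) (γ : Γ)
    (g : G) (x : X) :
    weightedSqDist Γ w x₀ (γ * g) (γ • x) = weightedSqDist Γ w x₀ g x := by
  simp only [weightedSqDist]
  rw [← finsum_comp_equiv (Equiv.mulRight γ)
    (f := fun δ : Γ => w (δ * g) * dist x (δ⁻¹ • x₀) ^ 2)]
  refine finsum_congr fun δ => ?_
  simp only [Equiv.coe_mulRight, Subgroup.coe_mul, mul_assoc, mul_inv_rev, mul_smul]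
  rw [← dist_smul γ x, smul_inv_smul]

variable [TopologicalSpace G]

/-- Continuous maps `G → X` that are equivariant for left multiplication by `Γ`. -/
structure IsEquivariantMap (Γ : Subgroup G) [MulAction Γ X] (f : G → X) : Prop where
  continuous : Continuous f
  map_mul : ∀ (γ : Γ) (g : G), f (γ * g) = γ • f g

theorem IsEquivariantMap.dist_mul [IsIsometricSMul Γ X] {f f' : G → X}
    (hf : IsEquivariantMap Γ f) (hf' : IsEquivariantMap Γ f') (γ : Γ) (g g' : G) :
    dist (f (γ * g)) (f' (γ * g')) = dist (f g) (f' g') := by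
  rw [hf.map_mul, hf'.map_mul, dist_smul]

section WeightedSqDist

variable {w : G → ℝ} (x₀ : X) [IsTopologicalGroup G] [T2Space G] [LocallyCompactSpace G]
  [DiscreteTopology Γ]

theorem IsWeight.continuous_weightedSqDist (hw : IsWeight Γ w) :
    Continuous (Function.uncurry (weightedSqDist Γ w x₀)) := by
  have wc := hw.continuous
  refine continuous_finsum (fun γ : Γ => by fun_prop) ?_
  refine ((locallyFinite_support_mul hw.hasCompactSupport).preimage_continuous
    (continuous_fst (Y := X))).subset fun γ z hz => ?_
  exact left_ne_zero_of_mul (Function.mem_support.1 hz)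

theorem IsWeight.quadratic_weightedSqDist (hw : IsWeight Γ w) (hX : IsCAT0 X) (g : G) :
    hX.Quadratic (weightedSqDist Γ w x₀ g) := by
  have hfin : (Function.support fun γ : Γ => w (γ * g)).Finite :=
    (locallyFinite_support_mul hw.hasCompactSupport).point_finite g
  have hsum : weightedSqDist Γ w x₀ g =
      fun x => ∑ γ ∈ hfin.toFinset, w (γ * g) * dist x (γ⁻¹ • x₀) ^ 2 := by
    ext x
    refine finsum_eq_sum_of_support_subset _ fun γ hγ => ?_
    simpa using left_ne_zero_of_mul (Function.mem_support.1 hγ)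
  rw [hsum]
  refine hX.quadratic_sum _ (fun γ => hw.nonneg _) ?_ _
  rw [← finsum_eq_sum _ hfin]
  exact hw.periodization_eq_one g

end WeightedSqDist

section Cocompact

variable [IsTopologicalGroup G] [LocallyCompactSpace G] [IsIsometricSMul Γ X]

theorem IsCAT0.exists_isEquivariantMap [T2Space G] [ProperSpace X] [Nonempty X] (hX : IsCAT0 X)
    (hΓ : IsUniformLattice Γ) : ∃ f : G → X, IsEquivariantMap Γ f := by
  have := hΓ.discrete
  obtain ⟨w, hw⟩ := hΓ.exists_isWeight
  obtain ⟨x₀⟩ := ‹Nonempty X›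
  have hquad := hw.quadratic_weightedSqDist x₀ hX
  refine ⟨fun g => argmin (weightedSqDist Γ w x₀ g), IsCAT0.continuous_argmin hquad
    (hw.continuous_weightedSqDist x₀), fun γ g => ?_⟩
  exact ((hquad g).smul_argmin (hquad (γ * g)) (weightedSqDist_mul_smul w x₀ γ g)).symm

namespace IsEquivariantMap

variable {f : G → X} (hf : IsEquivariantMap Γ f) (hΓ : IsUniformLattice Γ)

include hf hΓ

theorem exists_forall_dist_mul_le {Q : Set G} (hQ : IsCompact Q) :
    ∃ C : ℝ, ∀ x ∈ Q, ∀ g, dist (f g) (f (g * x)) ≤ C := by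
  obtain ⟨F, hF, hFΓ⟩ := hΓ.exists_isCompact_forall_mul_mem
  have hc := hf.continuous
  obtain ⟨C, hC⟩ := (hF.prod hQ).bddAbove_image
    (f := fun z : G × G => dist (f z.1) (f (z.1 * z.2))) (by fun_prop)
  refine ⟨C, fun x hx g => ?_⟩
  obtain ⟨γ, hγ⟩ := hFΓ g
  rw [← hf.dist_mul hf γ g, ← mul_assoc]
  exact hC ⟨(γ * g, x), ⟨hγ, hx⟩, rfl⟩

theorem dist_mul_le_displacement (g x : G) : dist (f g) (f (g * x)) ≤ displacement f x := by
  obtain ⟨C, hC⟩ := hf.exists_forall_dist_mul_le hΓ (isCompact_singleton (x := x))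
  exact le_ciSup (f := fun g => dist (f g) (f (g * x)))
    ⟨C, by rintro _ ⟨g, rfl⟩; exact hC x rfl g⟩ g

theorem exists_displacement_le {Q : Set G} (hQ : IsCompact Q) :
    ∃ C : ℝ, ∀ x ∈ Q, displacement f x ≤ C := by
  obtain ⟨C, hC⟩ := hf.exists_forall_dist_mul_le hΓ hQ
  exact ⟨C, fun x hx => ciSup_le (hC x hx)⟩

theorem tendsto_displacement : Tendsto (displacement f) (𝓝 1) (𝓝 0) := by
  obtain ⟨F, hF, hFΓ⟩ := hΓ.exists_isCompact_forall_mul_mem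
  have hc := hf.continuous
  refine Metric.tendsto_nhds.2 fun ε hε => ?_
  have key : ∀ᶠ x in 𝓝 (1 : G), ∀ g ∈ F, dist (f g) (f (g * x)) < ε / 2 := by
    refine hF.eventually_forall_of_forall_eventually fun g _ => ?_
    have hcont : Continuous fun z : G × G => dist (f z.2) (f (z.2 * z.1)) := by fun_prop
    exact (isOpen_lt hcont continuous_const).mem_nhds (by simpa using hε)
  filter_upwards [key] with x hx
  rw [dist_zero_right, Real.norm_of_nonneg (displacement_nonneg f x)]
  refine (ciSup_le fun g => ?_).trans_lt (half_lt_self hε)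
  obtain ⟨γ, hγ⟩ := hFΓ g
  rw [← hf.dist_mul hf γ g, ← mul_assoc]
  exact (hx _ hγ).le

end IsEquivariantMap

end Cocompact

end Equivariant

section Mollify

open Filter Topology MeasureTheory

-- `χ` is a multiple of a bump function that equals one on `P⁻¹ * tsupport β`.
theorem exists_forall_le_comp_mul {G : Type*} [Group G] [TopologicalSpace G] [IsTopologicalGroup G]
    [LocallyCompactSpace G] {β : G → ℝ} (βc : Continuous β) (βs : HasCompactSupport β) {P : Set G}
    (hP : IsCompact P) : ∃ χ : G → ℝ, Continuous χ ∧ HasCompactSupport χ ∧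
      (∀ q, 0 ≤ χ q) ∧ ∀ a ∈ P, ∀ q, β q ≤ χ (a⁻¹ * q) := by
  obtain ⟨u, us, u0, u1⟩ := exists_continuousMap_one_on (hP.inv.mul βs.isCompact)
  obtain ⟨B, hB⟩ := βs.exists_bound_of_continuous βc
  have hB0 : 0 ≤ B := (norm_nonneg _).trans (hB 1)
  refine ⟨fun q => B * u q, by fun_prop, us.mul_left, fun q => mul_nonneg hB0 (u0 q),
    fun a ha q => ?_⟩
  change β q ≤ B * u (a⁻¹ * q)
  by_cases hq : q ∈ tsupport β
  · rw [u1 (Set.mul_mem_mul (Set.inv_mem_inv.2 ha) hq), Pi.one_apply, mul_one]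
    exact (le_abs_self _).trans (hB q)
  · rw [image_eq_zero_of_notMem_tsupport hq]
    exact mul_nonneg hB0 (u0 _)

theorem continuous_integral_mul {E H : Type*} [TopologicalSpace E] [TopologicalSpace H]
    [MeasurableSpace H] [OpensMeasurableSpace H] {mH : Measure H} [IsFiniteMeasureOnCompacts mH]
    {ν : H → ℝ} (νc : Continuous ν) (νs : HasCompactSupport ν) {Φ : E → H → ℝ}
    (hΦ : Continuous (Function.uncurry Φ)) : Continuous fun x => ∫ q, ν q * Φ x q ∂mH := by
  rw [← continuousOn_univ]
  refine continuousOn_integral_of_compact_support (k := tsupport ν) νs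
    ((νc.comp continuous_snd).mul hΦ).continuousOn fun x q _ hq => ?_
  rw [image_eq_zero_of_notMem_tsupport hq, zero_mul]

variable {H : Type*} [TopologicalSpace H] [MeasurableSpace H]

/-- A continuous compactly supported probability density, used as a mollifier. -/
structure IsKernel (mH : Measure H) (ν : H → ℝ) : Prop where
  continuous : Continuous ν
  hasCompactSupport : HasCompactSupport ν
  nonneg : ∀ q, 0 ≤ ν q
  integral_eq_one : ∫ q, ν q ∂mH = 1

theorem exists_isKernel [R1Space H] [LocallyCompactSpace H] [Nonempty H] [OpensMeasurableSpace H]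
    (mH : Measure H) [IsFiniteMeasureOnCompacts mH] [mH.IsOpenPosMeasure] :
    ∃ ν : H → ℝ, IsKernel mH ν := by
  obtain ⟨q₀⟩ := ‹Nonempty H›
  obtain ⟨u, us, u0, u1⟩ := exists_continuousMap_one_on (isCompact_singleton (x := q₀))
  have hpos : 0 < ∫ q, u q ∂mH :=
    u.continuous.integral_pos_of_hasCompactSupport_nonneg_nonzero us u0 (x := q₀) (by simp [u1 rfl])
  refine ⟨fun q => u q / ∫ q, u q ∂mH, u.continuous.div_const _, ?_,
    fun q => div_nonneg (u0 q) hpos.le, ?_⟩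
  · simp only [div_eq_mul_inv]
    exact us.mul_right
  · rw [integral_div, div_self hpos.ne']

namespace IsKernel

variable {mH : Measure H} {ν : H → ℝ} (hν : IsKernel mH ν)

include hν

variable [OpensMeasurableSpace H] [IsFiniteMeasureOnCompacts mH]

theorem integrable_mul {φ : H → ℝ} (hφ : Continuous φ) : Integrable (fun q => ν q * φ q) mH :=
  (hν.continuous.mul hφ).integrable_of_hasCompactSupport hν.hasCompactSupport.mul_right

theorem integral_mul_le {φ : H → ℝ} (hφ : Continuous φ) {c : ℝ} (hc : ∀ q, φ q ≤ c) :
    ∫ q, ν q * φ q ∂mH ≤ c := by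
  calc _ ≤ ∫ q, ν q * c ∂mH := integral_mono (hν.integrable_mul hφ)
        (hν.integrable_mul continuous_const)
        fun q => mul_le_mul_of_nonneg_left (hc q) (hν.nonneg q)
    _ = c := by rw [integral_mul_const, hν.integral_eq_one, one_mul]

theorem hasSecondMoment {X : Type*} [MetricSpace X] {f : H → X} (hf : Continuous f) :
    HasSecondMoment mH ν f :=
  ⟨hν.nonneg, hν.integral_eq_one, fun _ => hν.integrable_mul (by fun_prop)⟩

end IsKernel

variable {X : Type*} [MetricSpace X] [Nonempty X] {G : Type*} [Group G] [Group H]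

/-- The average of `f` over right translations by the image of `H`, taken as a barycenter. -/
noncomputable def mollify (mH : Measure H) (ν : H → ℝ) (ι : H →* G) (f : G → X) (g : G) : X :=
  bary mH ν fun q => f (g * ι q)

namespace IsCAT0

variable [ProperSpace X] [TopologicalSpace G] [IsTopologicalGroup G] [OpensMeasurableSpace H]
  {mH : Measure H} [IsFiniteMeasureOnCompacts mH] {ν : H → ℝ} {ι : H →* G} {f f' : G → X}
  (hX : IsCAT0 X) (hν : IsKernel mH ν) (hι : Continuous ι) (hf : Continuous f)

include hX hν hι hf

theorem continuous_mollify : Continuous (mollify mH ν ι f) := by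
  refine hX.continuous_argmin (F := fun g x => ∫ q, ν q * dist x (f (g * ι q)) ^ 2 ∂mH)
    (fun g => (hν.hasSecondMoment (f := fun q => f (g * ι q)) (by fun_prop)).quadratic hX) ?_
  refine continuous_integral_mul (Φ := fun (z : G × X) q => dist z.2 (f (z.1 * ι q)) ^ 2)
    hν.continuous hν.hasCompactSupport ?_
  unfold Function.uncurry
  fun_prop

theorem smul_mollify {M : Type*} [Group M] [MulAction M X] [IsIsometricSMul M X] (a : M)
    (g : G) : a • mollify mH ν ι f g = mollify mH ν ι (fun g => a • f g) g :=
  hX.smul_bary (hν.hasSecondMoment (f := fun q => f (g * ι q)) (by fun_prop)) a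

theorem sq_dist_mollify_mollify_le (hf' : Continuous f') (g g' : G) :
    dist (mollify mH ν ι f g) (mollify mH ν ι f' g') ^ 2 ≤
      ∫ q, ν q * dist (f (g * ι q)) (f' (g' * ι q)) ^ 2 ∂mH :=
  hX.sq_dist_bary_bary_le (hν.hasSecondMoment (by fun_prop)) (hν.hasSecondMoment (by fun_prop))
    (hν.integrable_mul (by fun_prop))

theorem dist_mollify_mollify_le (hf' : Continuous f') {g g' : G} {c : ℝ} (hc0 : 0 ≤ c)
    (hc : ∀ q, dist (f (g * ι q)) (f' (g' * ι q)) ≤ c) :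
    dist (mollify mH ν ι f g) (mollify mH ν ι f' g') ≤ c := by
  refine le_of_sq_le_sq ((hX.sq_dist_mollify_mollify_le hν hι hf hf' g g').trans ?_) hc0
  exact hν.integral_mul_le (by fun_prop) fun q => pow_le_pow_left₀ dist_nonneg (hc q) 2

end IsCAT0

end Mollify

section Admissible

open Filter Topology MeasureTheory

variable {X : Type*} {G H : Type*} [Group G] [Group H] {p : G →* H} {ι : H →* G} {f₀ f f' : G → X}

/-- The right translate of a map by an element of `H`. -/
def translate (ι : H →* G) (h : H) (f : G → X) : G → X := fun g => f (g * ι h)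

theorem translate_mul (h h' : H) : translate ι (h * h') f = translate ι h (translate ι h' f) := by
  ext g
  simp only [translate, map_mul, mul_assoc]

theorem translate_one : translate ι 1 f = f := by
  ext g
  simp only [translate, map_one, mul_one]

variable [MetricSpace X]

/-- The mean square distance of two maps; for equivariant maps the mean is over `Γ \ G`. -/
noncomputable def meanSq [MeasurableSpace G] (m : Measure G) (w : G → ℝ) (f f' : G → X) : ℝ :=
  ∫ g, w g * dist (f g) (f' g) ^ 2 ∂m

variable [TopologicalSpace G] {Γ : Subgroup G}

theorem IsWeight.meanSq_nonneg [MeasurableSpace G] {m : Measure G} {w : G → ℝ}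
    (hw : IsWeight Γ w) (f f' : G → X) : 0 ≤ meanSq m w f f' :=
  integral_nonneg fun g => mul_nonneg (hw.nonneg g) (sq_nonneg _)

variable [MulAction Γ X]

/-- `G` is the product of the image of `ι : H →* G` and of the kernel of `p : G →* H`, and the
projection of `Γ` to `H` is dense. -/
structure IsSplitting [TopologicalSpace H] (Γ : Subgroup G) (p : G →* H) (ι : H →* G) : Prop where
  continuous_proj : Continuous p
  continuous_incl : Continuous ι
  proj_incl : ∀ h, p (ι h) = h
  comm : ∀ h k, p k = 1 → ι h * k = k * ι h
  dense : Dense (p '' (Γ : Set G))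

theorem IsSplitting.proj_inv_incl_mul [TopologicalSpace H] (hs : IsSplitting Γ p ι) (x : G) :
    p ((ι (p x))⁻¹ * x) = 1 := by
  rw [map_mul, map_inv, hs.proj_incl, inv_mul_cancel]

/-- Equivariant maps that are displaced by elements of the kernel of `p` at most as much as
`f₀`. This uniform control makes up for the lack of an action of `G` on `X`. -/
structure IsAdmissible (Γ : Subgroup G) [MulAction Γ X] (p : G →* H) (f₀ f : G → X) : Prop where
  equivariant : IsEquivariantMap Γ f
  dist_le : ∀ k, p k = 1 → ∀ g, dist (f g) (f (g * k)) ≤ displacement f₀ k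

theorem IsEquivariantMap.translate [IsTopologicalGroup G] (hf : IsEquivariantMap Γ f) (h : H) :
    IsEquivariantMap Γ (translate ι h f) := by
  refine ⟨hf.continuous.comp (continuous_mul_const _), fun γ g => ?_⟩
  simp only [CAT0.translate, mul_assoc, hf.map_mul]

namespace IsAdmissible

theorem translate [IsTopologicalGroup G] [TopologicalSpace H] (hf : IsAdmissible Γ p f₀ f)
    (hs : IsSplitting Γ p ι) (h : H) : IsAdmissible Γ p f₀ (translate ι h f) := by
  refine ⟨hf.equivariant.translate h, fun k hk g => ?_⟩
  simp only [CAT0.translate]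
  rw [mul_assoc g k, ← hs.comm h k hk, ← mul_assoc]
  exact hf.dist_le k hk _

theorem sq_dist_le (hf : IsAdmissible Γ p f₀ f) (hf' : IsAdmissible Γ p f₀ f') {k : G}
    (hk : p k = 1) (g : G) :
    dist (f g) (f' g) ^ 2 ≤
      2 * dist (f (g * k)) (f' (g * k)) ^ 2 + 8 * displacement f₀ k ^ 2 := by
  have h := hf.dist_le k hk g
  have h' := hf'.dist_le k hk g
  rw [dist_comm] at h'
  have htri := dist_triangle4 (f g) (f (g * k)) (f' (g * k)) (f' g)
  calc dist (f g) (f' g) ^ 2 ≤ (dist (f (g * k)) (f' (g * k)) + 2 * displacement f₀ k) ^ 2 :=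
        pow_le_pow_left₀ dist_nonneg (by linarith) 2
    _ ≤ 2 * (dist (f (g * k)) (f' (g * k)) ^ 2 + (2 * displacement f₀ k) ^ 2) := add_sq_le
    _ = _ := by ring

variable [IsIsometricSMul Γ X]

theorem mid {hX : IsCAT0 X} (hf : IsAdmissible Γ p f₀ f) (hf' : IsAdmissible Γ p f₀ f') :
    IsAdmissible Γ p f₀ fun g => hX.mid (f g) (f' g) := by
  refine ⟨⟨hX.continuous_mid.comp (hf.equivariant.continuous.prodMk hf'.equivariant.continuous),
    fun γ g => ?_⟩, fun k hk g => ?_⟩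
  · rw [hf.equivariant.map_mul, hf'.equivariant.map_mul, hX.smul_mid]
  · have hmid := hX.dist_mid_mid_le (f g) (f' g) (f (g * k)) (f' (g * k))
    linarith [hf.dist_le k hk g, hf'.dist_le k hk g]

theorem of_approx (h : ∀ ε > 0, ∃ f', IsAdmissible Γ p f₀ f' ∧ ∀ g, dist (f g) (f' g) ≤ ε) :
    IsAdmissible Γ p f₀ f := by
  refine ⟨⟨?_, fun γ g => ?_⟩, fun k hk g => le_of_forall_pos_le_add fun ε hε => ?_⟩
  · refine continuous_of_uniform_approx_of_continuous fun u hu => ?_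
    obtain ⟨ε, hε, hεu⟩ := Metric.mem_uniformity_dist.1 hu
    obtain ⟨f', hf', hd⟩ := h (ε / 2) (half_pos hε)
    exact ⟨f', hf'.equivariant.continuous, fun g => hεu ((hd g).trans_lt (half_lt_self hε))⟩
  · refine dist_le_zero.1 (le_of_forall_pos_le_add fun ε hε => ?_)
    obtain ⟨f', hf', hd⟩ := h (ε / 2) (half_pos hε)
    have htri := dist_triangle (f (γ * g)) (f' (γ * g)) (γ • f g)
    have hγ : dist (f' (γ * g)) (γ • f g) = dist (f g) (f' g) := by
      rw [hf'.equivariant.map_mul, dist_smul, dist_comm]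
    linarith [hd g, hd (γ * g)]
  · obtain ⟨f', hf', hd⟩ := h (ε / 2) (half_pos hε)
    have htri := dist_triangle4 (f g) (f' g) (f' (g * k)) (f (g * k))
    rw [dist_comm (f' (g * k)) (f (g * k))] at htri
    linarith [hd g, hd (g * k), hf'.dist_le k hk g]

end IsAdmissible

variable [TopologicalSpace H] [MeasurableSpace H] [OpensMeasurableSpace H] {mH : Measure H}
  {ν : H → ℝ} [IsTopologicalGroup G]

theorem IsAdmissible.mollify [IsFiniteMeasureOnCompacts mH] [ProperSpace X] [Nonempty X]
    [IsIsometricSMul Γ X] (hf : IsAdmissible Γ p f₀ f) (hX : IsCAT0 X) (hs : IsSplitting Γ p ι)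
    (hν : IsKernel mH ν) : IsAdmissible Γ p f₀ (mollify mH ν ι f) := by
  have hc := hf.equivariant.continuous
  have hι := hs.continuous_incl
  refine ⟨⟨hX.continuous_mollify hν hι hc, fun γ g => ?_⟩, fun k hk g => ?_⟩
  · rw [hX.smul_mollify hν hι hc]
    simp only [CAT0.mollify, mul_assoc, hf.equivariant.map_mul]
  · refine hX.dist_mollify_mollify_le hν hι hc hc (displacement_nonneg _ _) fun q => ?_
    rw [mul_assoc, ← hs.comm q k hk, ← mul_assoc]
    exact hf.dist_le k hk _

theorem IsAdmissible.integral_sq_dist_le [IsTopologicalGroup H] [BorelSpace H]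
    [IsFiniteMeasureOnCompacts mH] [mH.IsMulLeftInvariant] (hf : IsAdmissible Γ p f₀ f)
    (hf' : IsAdmissible Γ p f₀ f') (hs : IsSplitting Γ p ι) (hν : IsKernel mH ν) {χ : H → ℝ}
    (χc : Continuous χ) (χs : HasCompactSupport χ) (χ0 : ∀ q, 0 ≤ χ q) {x : G}
    (hνχ : ∀ q, ν q ≤ χ ((p x)⁻¹ * q)) (g : G) :
    ∫ q, ν q * dist (f (g * ι q)) (f' (g * ι q)) ^ 2 ∂mH ≤
      2 * ∫ q, χ q * dist (f (g * x * ι q)) (f' (g * x * ι q)) ^ 2 ∂mH +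
        8 * (∫ q, χ q ∂mH) * displacement f₀ ((ι (p x))⁻¹ * x) ^ 2 := by
  set D := displacement f₀ ((ι (p x))⁻¹ * x)
  set φ : G → ℝ := fun y => dist (f y) (f' y) ^ 2
  have hfc := hf.equivariant.continuous
  have hfc' := hf'.equivariant.continuous
  have hι := hs.continuous_incl
  have hχ : ∀ {ψ : H → ℝ}, Continuous ψ → Integrable (fun q => χ q * ψ q) mH := fun hψ =>
    (χc.mul hψ).integrable_of_hasCompactSupport χs.mul_right
  have hk := hs.proj_inv_incl_mul x
  have hshift : ∀ q, φ (g * ι (p x * q)) ≤ 2 * φ (g * x * ι q) + 8 * D ^ 2 := by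
    intro q
    have hmul : g * ι (p x * q) * ((ι (p x))⁻¹ * x) = g * x * ι q := by
      rw [map_mul, ← mul_assoc g, mul_assoc (g * ι (p x)), hs.comm q _ hk]
      group
    have h := hf.sq_dist_le hf' hk (g * ι (p x * q))
    rwa [hmul] at h
  calc ∫ q, ν q * φ (g * ι q) ∂mH ≤ ∫ q, χ ((p x)⁻¹ * q) * φ (g * ι q) ∂mH := by
        refine integral_mono (hν.integrable_mul (by fun_prop)) ?_ fun q =>
          mul_le_mul_of_nonneg_right (hνχ q) (sq_nonneg _)
        exact Continuous.integrable_of_hasCompactSupport (by fun_prop)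
          (χs.comp_homeomorph (Homeomorph.mulLeft (p x)⁻¹)).mul_right
    _ = ∫ q, χ q * φ (g * ι (p x * q)) ∂mH := by
        rw [← integral_mul_left_eq_self _ (p x)]
        simp only [inv_mul_cancel_left]
    _ ≤ ∫ q, χ q * (2 * φ (g * x * ι q) + 8 * D ^ 2) ∂mH :=
        integral_mono (hχ (by fun_prop)) (hχ (by fun_prop)) fun q =>
          mul_le_mul_of_nonneg_left (hshift q) (χ0 q)
    _ = _ := by
        simp only [mul_add]
        rw [integral_add (hχ (by fun_prop)) (hχ (by fun_prop)), integral_mul_const]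
        simp only [mul_left_comm (χ _), integral_const_mul]
        ring

/-- The standing data: a uniform lattice in a product, a weight normalised to have integral one,
a mollifier on the factor `H`, and an equivariant map. -/
structure IsAveragingSetup [MeasurableSpace G] (Γ : Subgroup G) [MulAction Γ X] (p : G →* H)
    (ι : H →* G) (m : Measure G) (mH : Measure H) (w : G → ℝ) (ν : H → ℝ) (f₀ : G → X) : Prop where
  lattice : IsUniformLattice Γ
  splitting : IsSplitting Γ p ι
  weight : IsWeight Γ w
  weight_one : ∫ g, w g ∂m = 1
  kernel : IsKernel mH ν
  base : IsEquivariantMap Γ f₀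

namespace IsAveragingSetup

variable [T2Space G] [LocallyCompactSpace G] [MeasurableSpace G] [BorelSpace G] {m : Measure G}
  [m.IsHaarMeasure] {w : G → ℝ} [IsTopologicalGroup H] [LocallyCompactSpace H]
  [BorelSpace H] [mH.IsHaarMeasure] [IsIsometricSMul Γ X]
  (S : IsAveragingSetup Γ p ι m mH w ν f₀)

include S

theorem exists_integral_sq_dist_le {η : ℝ} (hη : 0 < η) :
    ∃ C : ℝ, 0 ≤ C ∧ ∀ f f' : G → X, IsAdmissible Γ p f₀ f → IsAdmissible Γ p f₀ f' → ∀ g,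
      ∫ q, ν q * dist (f (g * ι q)) (f' (g * ι q)) ^ 2 ∂mH ≤ C * meanSq m w f f' + η := by
  have hι := S.splitting.continuous_incl
  have hp := S.splitting.continuous_proj
  have := S.lattice.discrete
  obtain ⟨P, hP, hP1⟩ := exists_compact_mem_nhds (1 : H)
  obtain ⟨χ, χc, χs, χ0, hνχ⟩ :=
    exists_forall_le_comp_mul S.kernel.continuous S.kernel.hasCompactSupport hP
  set c := ∫ q, χ q ∂mH
  have hW : ∀ᶠ x in 𝓝 (1 : G),
      p x ∈ P ∧ 8 * c * displacement f₀ ((ι (p x))⁻¹ * x) ^ 2 < η := by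
    refine ((hp.tendsto' 1 1 (map_one p)).eventually hP1).and ?_
    have hk : Tendsto (fun x => (ι (p x))⁻¹ * x) (𝓝 1) (𝓝 1) :=
      Continuous.tendsto' (by fun_prop) 1 1 (by simp)
    have hlim := (((S.base.tendsto_displacement S.lattice).comp hk).pow 2).const_mul (8 * c)
    exact hlim.eventually_lt_const (by simpa using hη)
  obtain ⟨C, hC0, hC⟩ := S.weight.exists_forall_le_mul_integral (m := m) S.lattice hW
  refine ⟨2 * C * c, mul_nonneg (by positivity) (integral_nonneg χ0), fun f f' hf hf' g => ?_⟩
  have hfc := hf.equivariant.continuous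
  have hfc' := hf'.equivariant.continuous
  have hΓ : ∀ (γ : Γ) g, dist (f (γ * g)) (f' (γ * g)) ^ 2 = dist (f g) (f' g) ^ 2 := fun γ g => by
    rw [hf.equivariant.dist_mul hf'.equivariant]
  set u : G → ℝ := fun y => ∫ q, χ q * dist (f (y * ι q)) (f' (y * ι q)) ^ 2 ∂mH
  have hu : ∫ g, w g * u g ∂m = c * meanSq m w f f' :=
    S.weight.integral_mul_average (φ := fun g => dist (f g) (f' g) ^ 2) (by fun_prop) hΓ hι χc χs
  set v := ∫ q, ν q * dist (f (g * ι q)) (f' (g * ι q)) ^ 2 ∂mH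
  have hv : (v - η) / 2 ≤ C * ∫ g, w g * u g ∂m := by
    refine hC u ?_ (fun γ g => ?_) (fun g => ?_) g _ fun x hx => ?_
    · exact continuous_integral_mul (Φ := fun y q => dist (f (y * ι q)) (f' (y * ι q)) ^ 2) χc χs
        (by unfold Function.uncurry; fun_prop)
    · simp only [u, mul_assoc, hΓ]
    · exact integral_nonneg fun q => mul_nonneg (χ0 _) (sq_nonneg _)
    · linarith [hf.integral_sq_dist_le hf' S.splitting S.kernel χc χs χ0 (hνχ _ hx.1) g, hx.2]
  rw [hu] at hv
  linarith

theorem exists_forall_dist_mollify_le [ProperSpace X] [Nonempty X] (hX : IsCAT0 X) {ε : ℝ}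
    (hε : 0 < ε) : ∃ δ > 0, ∀ f f' : G → X, IsAdmissible Γ p f₀ f → IsAdmissible Γ p f₀ f' →
      meanSq m w f f' ≤ δ → ∀ g, dist (mollify mH ν ι f g) (mollify mH ν ι f' g) ≤ ε := by
  obtain ⟨C, hC0, hC⟩ := S.exists_integral_sq_dist_le (η := ε ^ 2 / 2) (by positivity)
  refine ⟨ε ^ 2 / (2 * (C + 1)), by positivity, fun f f' hf hf' hδ g => ?_⟩
  have hsmall : C * meanSq m w f f' ≤ ε ^ 2 / 2 := by
    have h := (le_div_iff₀ (by positivity)).1 hδ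
    linarith [S.weight.meanSq_nonneg (m := m) f f']
  refine le_of_sq_le_sq ((hX.sq_dist_mollify_mollify_le S.kernel S.splitting.continuous_incl
    hf.equivariant.continuous hf'.equivariant.continuous g g).trans ?_) hε.le
  exact (hC f f' hf hf' g).trans (by linarith)

end IsAveragingSetup

end Admissible

section MeanSq

open Filter Topology MeasureTheory

variable {X : Type*} [MetricSpace X] {G : Type*} [Group G] [TopologicalSpace G]
  [MeasurableSpace G] [BorelSpace G] {m : Measure G} {Γ : Subgroup G} {w : G → ℝ}

namespace IsWeight

variable (hw : IsWeight Γ w)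

include hw

section FiniteOnCompacts

variable [IsFiniteMeasureOnCompacts m]

theorem integral_mul_mono {φ ψ : G → ℝ} (hφ : Continuous φ) (hψ : Continuous ψ)
    (h : ∀ g, φ g ≤ ψ g) : ∫ g, w g * φ g ∂m ≤ ∫ g, w g * ψ g ∂m :=
  integral_mono (hw.integrable_mul hφ) (hw.integrable_mul hψ) fun g =>
    mul_le_mul_of_nonneg_left (h g) (hw.nonneg g)

theorem integral_mul_add {φ ψ : G → ℝ} (hφ : Continuous φ) (hψ : Continuous ψ) (a b : ℝ) :
    ∫ g, w g * (a * φ g + b * ψ g) ∂m =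
      a * ∫ g, w g * φ g ∂m + b * ∫ g, w g * ψ g ∂m := by
  simp only [mul_add, mul_left_comm (w _)]
  rw [integral_add ((hw.integrable_mul hφ).const_mul a) ((hw.integrable_mul hψ).const_mul b),
    integral_const_mul, integral_const_mul]

theorem hasSecondMoment (h1 : ∫ g, w g ∂m = 1) {f : G → X} (hf : Continuous f) :
    HasSecondMoment m w f :=
  ⟨hw.nonneg, h1, fun _ => hw.integrable_mul (by fun_prop)⟩

theorem meanSq_le_two_mul {f f' f'' : G → X} (hf : Continuous f) (hf' : Continuous f')
    (hf'' : Continuous f'') :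
    meanSq m w f f'' ≤ 2 * meanSq m w f f' + 2 * meanSq m w f' f'' := by
  simp only [meanSq]
  rw [← hw.integral_mul_add (by fun_prop) (by fun_prop)]
  refine hw.integral_mul_mono (by fun_prop) (by fun_prop) fun g => ?_
  rw [← mul_add]
  exact sq_dist_le_two_mul _ _ _

theorem meanSq_le_sq (h1 : ∫ g, w g ∂m = 1) {f f' : G → X} (hf : Continuous f)
    (hf' : Continuous f') {C : ℝ} (hC : ∀ g, dist (f g) (f' g) ≤ C) :
    meanSq m w f f' ≤ C ^ 2 := by
  calc meanSq m w f f' ≤ ∫ g, w g * C ^ 2 ∂m :=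
        hw.integral_mul_mono (by fun_prop) continuous_const fun g =>
          pow_le_pow_left₀ dist_nonneg (hC g) 2
    _ = C ^ 2 := by rw [integral_mul_const, h1, one_mul]

theorem meanSq_mid_le (hX : IsCAT0 X) {f f₁ f₂ : G → X} (hf : Continuous f)
    (h₁ : Continuous f₁) (h₂ : Continuous f₂) :
    meanSq m w f (fun g => hX.mid (f₁ g) (f₂ g)) ≤
      (meanSq m w f f₁ + meanSq m w f f₂) / 2 - meanSq m w f₁ f₂ / 4 := by
  have hm : Continuous fun g => hX.mid (f₁ g) (f₂ g) := hX.continuous_mid.comp (h₁.prodMk h₂)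
  calc meanSq m w f (fun g => hX.mid (f₁ g) (f₂ g))
      ≤ ∫ g, w g * (1 * (1 / 2 * dist (f g) (f₁ g) ^ 2 + 1 / 2 * dist (f g) (f₂ g) ^ 2)
          + (- 1 / 4) * dist (f₁ g) (f₂ g) ^ 2) ∂m := by
        refine hw.integral_mul_mono (by fun_prop) (by fun_prop) fun g => ?_
        have hmid := hX.sq_dist_mid_le (f₁ g) (f₂ g) (f g)
        rw [dist_comm _ (f g), dist_comm (f₁ g) (f g), dist_comm (f₂ g) (f g)] at hmid
        linarith
    _ = _ := by
        rw [hw.integral_mul_add (by fun_prop) (by fun_prop),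
          hw.integral_mul_add (by fun_prop) (by fun_prop)]
        simp only [meanSq]
        ring

theorem meanSq_add_meanSq_le (hX : IsCAT0 X) {a b f f' : G → X} (ha : Continuous a)
    (hb : Continuous b) (hf : Continuous f) (hf' : Continuous f') :
    meanSq m w a f' + meanSq m w b f ≤
      meanSq m w a f + meanSq m w b f' + (2 * meanSq m w a b + 1 / 2 * meanSq m w f f') := by
  calc meanSq m w a f' + meanSq m w b f
      = ∫ g, w g * (1 * dist (a g) (f' g) ^ 2 + 1 * dist (b g) (f g) ^ 2) ∂m := by
        rw [hw.integral_mul_add (by fun_prop) (by fun_prop), one_mul, one_mul]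
        rfl
    _ ≤ ∫ g, w g * (1 * (1 * dist (a g) (f g) ^ 2 + 1 * dist (b g) (f' g) ^ 2) +
          1 * (2 * dist (a g) (b g) ^ 2 + 1 / 2 * dist (f g) (f' g) ^ 2)) ∂m := by
        refine hw.integral_mul_mono (by fun_prop) (by fun_prop) fun g => ?_
        have hquad := hX.sq_dist_add_sq_dist_le (a g) (b g) (f g) (f' g)
        linarith [sq_nonneg (2 * dist (a g) (b g) - dist (f g) (f' g))]
    _ = _ := by
        rw [hw.integral_mul_add (by fun_prop) (by fun_prop),
          hw.integral_mul_add (by fun_prop) (by fun_prop),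
          hw.integral_mul_add (by fun_prop) (by fun_prop)]
        simp only [meanSq, one_mul]

theorem meanSq_bary_le [CompleteSpace X] [Nonempty X] (hX : IsCAT0 X) (h1 : ∫ g, w g ∂m = 1)
    {f : G → X} (hf : Continuous f) :
    meanSq m w (fun _ => bary m w f) f ≤
      ∫ g, w g * (∫ g', w g' * dist (f g) (f g') ^ 2 ∂m) ∂m := by
  refine hw.integral_mul_mono (by fun_prop) (continuous_integral_mul hw.continuous
    hw.hasCompactSupport (Φ := fun g g' => dist (f g) (f g') ^ 2)
    (by unfold Function.uncurry; fun_prop)) fun g => ?_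
  exact hX.sq_dist_bary_le (hw.hasSecondMoment h1 hf) (f g)

end FiniteOnCompacts

variable [IsTopologicalGroup G]

theorem sq_dist_smul_bary_le [CompleteSpace X] [Nonempty X] [MulAction Γ X]
    [IsIsometricSMul Γ X] [IsFiniteMeasureOnCompacts m] [m.IsMulLeftInvariant] (hX : IsCAT0 X)
    (h1 : ∫ g, w g ∂m = 1) {f : G → X} (hf : IsEquivariantMap Γ f) (γ : Γ) :
    dist (γ • bary m w f) (bary m w f) ^ 2 ≤
      ∫ g, w g * (∫ g', w ((γ : G)⁻¹ * g') * dist (f g) (f g') ^ 2 ∂m) ∂m := by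
  have hc := hf.continuous
  have hmom := hw.hasSecondMoment h1 hc
  have hdist : ∀ g, dist (γ • bary m w f) (f g) ^ 2 ≤
      ∫ g', w ((γ : G)⁻¹ * g') * dist (f g) (f g') ^ 2 ∂m := by
    intro g
    calc dist (γ • bary m w f) (f g) ^ 2 ≤ ∫ g', w g' * dist (f g) (γ • f g') ^ 2 ∂m := by
          rw [hX.smul_bary hmom]
          exact hX.sq_dist_bary_le (hw.hasSecondMoment h1 (hc.const_smul γ)) (f g)
      _ = _ := by
          rw [← integral_mul_left_eq_self (fun g' => w ((γ : G)⁻¹ * g') * _) (γ : G)]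
          simp only [inv_mul_cancel_left, hf.map_mul]
  rw [dist_comm]
  refine (hX.sq_dist_bary_le hmom _).trans (hw.integral_mul_mono (by fun_prop) ?_ hdist)
  exact continuous_integral_mul (hw.continuous.comp (continuous_const_mul _))
    (hw.hasCompactSupport.comp_homeomorph (Homeomorph.mulLeft (γ : G)⁻¹))
    (by unfold Function.uncurry; fun_prop)

variable [T2Space G] [DiscreteTopology Γ]

theorem meanSq_translate [m.IsHaarMeasure] [MulAction Γ X] [IsIsometricSMul Γ X] {H : Type*}
    [Group H] {ι : H →* G} {f f' : G → X} (hf : IsEquivariantMap Γ f)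
    (hf' : IsEquivariantMap Γ f') (h : H) :
    meanSq m w (translate ι h f) (translate ι h f') = meanSq m w f f' := by
  have hc := hf.continuous
  have hc' := hf'.continuous
  exact hw.integral_mul_comp_mul_right (φ := fun g => dist (f g) (f' g) ^ 2) (by fun_prop)
    (fun γ g => by rw [hf.dist_mul hf']) (ι h)

end IsWeight

end MeanSq

section FixedPoint

open Filter Topology MeasureTheory

variable {G : Type*} [Group G] [TopologicalSpace G] [IsTopologicalGroup G] [LocallyCompactSpace G]
  [MeasurableSpace G] [BorelSpace G] {m : Measure G} {Γ : Subgroup G} {w : G → ℝ}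

namespace IsWeight

variable (hw : IsWeight Γ w)

include hw

theorem exists_forall_integral_mul_integral_le [m.IsMulLeftInvariant]
    [IsFiniteMeasureOnCompacts m] {β : G → ℝ} (βc : Continuous β) (βs : HasCompactSupport β) :
    ∃ Q : Set G, IsCompact Q ∧ ∃ B : ℝ, ∀ Φ : G → G → ℝ, Continuous (Function.uncurry Φ) →
      (∀ g g', 0 ≤ Φ g g') → ∀ C, (∀ x ∈ Q, ∫ g, w g * Φ g (g * x) ∂m ≤ C) →
        ∫ g, w g * (∫ g', β g' * Φ g g' ∂m) ∂m ≤ B * C := by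
  obtain ⟨χ, χc, χs, χ0, hχ⟩ :=
    exists_forall_le_comp_mul βc βs hw.hasCompactSupport.isCompact
  refine ⟨tsupport χ, χs.isCompact, ∫ x, χ x ∂m, fun Φ hΦ Φ0 C hC => ?_⟩
  have hΦ' : Continuous (Function.uncurry fun g x => Φ g (g * x)) :=
    hΦ.comp (continuous_fst.prodMk continuous_mul)
  have le_convolution : ∀ g ∈ tsupport w,
      ∫ g', β g' * Φ g g' ∂m ≤ ∫ x, χ x * Φ g (g * x) ∂m := by
    intro g hg
    have hΦg : Continuous (Φ g) := hΦ.comp (Continuous.prodMk_right g)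
    calc _ ≤ ∫ g', χ (g⁻¹ * g') * Φ g g' ∂m := by
          refine integral_mono
            ((βc.mul hΦg).integrable_of_hasCompactSupport βs.mul_right) ?_
            fun g' => mul_le_mul_of_nonneg_right (hχ g hg g') (Φ0 _ _)
          exact Continuous.integrable_of_hasCompactSupport (by fun_prop)
            (χs.comp_homeomorph (Homeomorph.mulLeft g⁻¹)).mul_right
      _ = _ := by
          rw [← integral_mul_left_eq_self _ g]
          simp only [inv_mul_cancel_left]
  calc _ ≤ ∫ g, w g * (∫ x, χ x * Φ g (g * x) ∂m) ∂m := by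
        refine integral_mono (hw.integrable_mul (continuous_integral_mul βc βs hΦ))
          (hw.integrable_mul (continuous_integral_mul χc χs hΦ')) fun g => ?_
        by_cases hg : g ∈ tsupport w
        · exact mul_le_mul_of_nonneg_left (le_convolution g hg) (hw.nonneg g)
        · simp [image_eq_zero_of_notMem_tsupport hg]
    _ = ∫ x, χ x * (∫ g, w g * Φ g (g * x) ∂m) ∂m :=
        integral_mul_integral_mul_comm hw.continuous hw.hasCompactSupport χc χs hΦ'
    _ ≤ ∫ x, χ x * C ∂m := by
        refine integral_mono ?_ ((χc.integrable_of_hasCompactSupport χs).mul_const C) fun x => ?_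
        · refine Continuous.integrable_of_hasCompactSupport (χc.mul ?_) χs.mul_right
          exact continuous_integral_mul hw.continuous hw.hasCompactSupport
            (hΦ'.comp continuous_swap)
        · by_cases hx : x ∈ tsupport χ
          · exact mul_le_mul_of_nonneg_left (hC x hx) (χ0 x)
          · simp [image_eq_zero_of_notMem_tsupport hx]
    _ = _ := integral_mul_const _ _

end IsWeight

variable {X : Type*} [MetricSpace X] [MulAction Γ X] [IsIsometricSMul Γ X] {H : Type*} [Group H]
  [TopologicalSpace H] [MeasurableSpace H] {p : G →* H} {ι : H →* G} {mH : Measure H} {ν : H → ℝ}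
  {f₀ : G → X}

/-- Right translations by `H` displace `f` not much more than `f₀`. The constants are those that
the parallelogram inequality gives for maps that nearly minimize the distance to `f₀`. -/
def HasControlledDisplacement (ι : H →* G) (m : Measure G) (w : G → ℝ) (f₀ f : G → X) : Prop :=
  ∀ h, meanSq m w f (translate ι h f) ≤ 4 * meanSq m w f₀ (translate ι h f₀) + 8

namespace IsAveragingSetup

variable (S : IsAveragingSetup Γ p ι m mH w ν f₀)

include S

theorem exists_meanSq_mul_le [IsFiniteMeasureOnCompacts m] {Q : Set G} (hQ : IsCompact Q) :
    ∃ C, ∀ f, IsAdmissible Γ p f₀ f → HasControlledDisplacement ι m w f₀ f →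
      ∀ x ∈ Q, meanSq m w f (fun g => f (g * x)) ≤ C := by
  have hι := S.splitting.continuous_incl
  have hp := S.splitting.continuous_proj
  have hw := S.weight
  obtain ⟨C₁, hC₁⟩ := S.base.exists_displacement_le S.lattice
    (hQ.image (f := fun x => ι (p x)) (by fun_prop))
  obtain ⟨C₂, hC₂⟩ := S.base.exists_displacement_le S.lattice
    (hQ.image (f := fun x => (ι (p x))⁻¹ * x) (by fun_prop))
  refine ⟨2 * (4 * C₁ ^ 2 + 8) + 2 * C₂ ^ 2, fun f hf hdisp x hx => ?_⟩
  have hc := hf.equivariant.continuous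
  have hct := (hf.equivariant.translate (ι := ι) (p x)).continuous
  have base_le : meanSq m w f₀ (translate ι (p x) f₀) ≤ C₁ ^ 2 :=
    hw.meanSq_le_sq S.weight_one S.base.continuous (S.base.translate (p x)).continuous fun g =>
      (S.base.dist_mul_le_displacement S.lattice g _).trans (hC₁ _ ⟨x, hx, rfl⟩)
  have kernel_le : meanSq m w (translate ι (p x) f) (fun g => f (g * x)) ≤ C₂ ^ 2 := by
    refine hw.meanSq_le_sq S.weight_one hct (by fun_prop) fun g => ?_
    have h := hf.dist_le _ (S.splitting.proj_inv_incl_mul x) (g * ι (p x))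
    rw [mul_assoc, mul_inv_cancel_left] at h
    exact h.trans (hC₂ _ ⟨x, hx, rfl⟩)
  have htri := hw.meanSq_le_two_mul (m := m) hc hct (f'' := fun g => f (g * x)) (by fun_prop)
  linarith [hdisp (p x)]

variable [IsFiniteMeasureOnCompacts m] [m.IsMulLeftInvariant]

theorem exists_integral_mul_integral_sq_dist_le {β : G → ℝ} (βc : Continuous β)
    (βs : HasCompactSupport β) :
    ∃ C, ∀ f, IsAdmissible Γ p f₀ f → HasControlledDisplacement ι m w f₀ f →
      ∫ g, w g * (∫ g', β g' * dist (f g) (f g') ^ 2 ∂m) ∂m ≤ C := by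
  obtain ⟨Q, hQ, B, hB⟩ := S.weight.exists_forall_integral_mul_integral_le (m := m) βc βs
  obtain ⟨C, hC⟩ := S.exists_meanSq_mul_le hQ
  refine ⟨B * C, fun f hf hdisp => hB (fun g g' => dist (f g) (f g') ^ 2) ?_
    (fun _ _ => sq_nonneg _) C (hC f hf hdisp)⟩
  have hc := hf.equivariant.continuous
  unfold Function.uncurry
  fun_prop

variable [ProperSpace X] [Nonempty X] (hX : IsCAT0 X)

include hX

theorem exists_meanSq_le_sq_dist_bary (x₀ : X) :
    ∃ C, ∀ f, IsAdmissible Γ p f₀ f → HasControlledDisplacement ι m w f₀ f →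
      meanSq m w f₀ f ≤ 4 * dist x₀ (bary m w f) ^ 2 + C := by
  have hw := S.weight
  obtain ⟨C, hC⟩ := S.exists_integral_mul_integral_sq_dist_le hw.continuous hw.hasCompactSupport
  refine ⟨4 * meanSq m w f₀ (fun _ => x₀) + 2 * C, fun f hf hdisp => ?_⟩
  have hc := hf.equivariant.continuous
  have f_bary := hw.meanSq_le_two_mul (m := m) S.base.continuous
    (continuous_const (y := bary m w f)) hc
  have bary_x₀ := hw.meanSq_le_two_mul (m := m) S.base.continuous (continuous_const (y := x₀))
    (continuous_const (y := bary m w f))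
  have const_le := hw.meanSq_le_sq S.weight_one (continuous_const (y := x₀))
    (continuous_const (y := bary m w f)) fun _ => le_rfl
  linarith [hC f hf hdisp, hw.meanSq_bary_le hX S.weight_one hc]

-- The barycenters of the maps `f n` go to infinity while `Γ` displaces them boundedly.
theorem exists_fixed_boundary {f : ℕ → G → X} (hf : ∀ n, IsAdmissible Γ p f₀ (f n))
    (hdisp : ∀ n, HasControlledDisplacement ι m w f₀ (f n))
    (hinf : Tendsto (fun n => meanSq m w f₀ (f n)) atTop atTop) :
    ∃ ξ : Boundary X, ∀ γ : Γ, γ • ξ = ξ := by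
  obtain ⟨x₀⟩ := ‹Nonempty X›
  refine hX.exists_fixed_of_bounded_displacement (x₀ := x₀) (x := fun n => bary m w (f n))
    ?_ fun γ => ?_
  · obtain ⟨C, hC⟩ := S.exists_meanSq_le_sq_dist_bary hX x₀
    refine tendsto_atTop.2 fun b => ?_
    filter_upwards [tendsto_atTop.1 hinf (4 * b ^ 2 + C)] with n hn
    exact le_of_sq_le_sq (by linarith [hC (f n) (hf n) (hdisp n)]) dist_nonneg
  · obtain ⟨C, hC⟩ := S.exists_integral_mul_integral_sq_dist_le
      (S.weight.continuous.comp (continuous_const_mul (γ : G)⁻¹))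
      (S.weight.hasCompactSupport.comp_homeomorph (Homeomorph.mulLeft (γ : G)⁻¹))
    exact ⟨√C, fun n => Real.le_sqrt_of_sq_le
      ((S.weight.sq_dist_smul_bary_le hX S.weight_one (hf n).equivariant γ).trans
        (hC (f n) (hf n) (hdisp n)))⟩

end IsAveragingSetup

end FixedPoint

/-! ### Minimal stable sets -/

section Stable

open Filter Topology MeasureTheory

variable {X : Type*} [MetricSpace X] [Nonempty X] {G : Type*} [Group G]
  [TopologicalSpace G] {H : Type*} [Group H] [MeasurableSpace H] {Γ : Subgroup G} [MulAction Γ X]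
  {p : G →* H} {ι : H →* G} {mH : Measure H} {ν : H → ℝ} {f₀ : G → X} {hX : IsCAT0 X}

/-- Non-empty sets of admissible maps that are closed for uniform convergence, convex, and
invariant under `H` and under mollification. -/
structure IsStable (hX : IsCAT0 X) (Γ : Subgroup G) [MulAction Γ X] (p : G →* H) (ι : H →* G)
    (mH : Measure H) (ν : H → ℝ) (f₀ : G → X) (M : Set (G → X)) : Prop where
  nonempty : M.Nonempty
  admissible : ∀ f ∈ M, IsAdmissible Γ p f₀ f
  closed : ∀ f, (∀ ε > 0, ∃ f' ∈ M, ∀ g, dist (f g) (f' g) ≤ ε) → f ∈ M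
  mid : ∀ f ∈ M, ∀ f' ∈ M, (fun g => hX.mid (f g) (f' g)) ∈ M
  translate : ∀ f ∈ M, ∀ h, translate ι h f ∈ M
  mollify : ∀ f ∈ M, mollify mH ν ι f ∈ M

theorem IsStable.sInter {c : Set (Set (G → X))} (hc : ∀ M ∈ c, IsStable hX Γ p ι mH ν f₀ M)
    (hne : c.Nonempty) (hinter : (⋂₀ c).Nonempty) : IsStable hX Γ p ι mH ν f₀ (⋂₀ c) where
  nonempty := hinter
  admissible f hf := (hc _ hne.some_mem).admissible f (hf _ hne.some_mem)
  closed f hf M hM := (hc M hM).closed f fun ε hε =>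
    (hf ε hε).imp fun _ hf' => ⟨hf'.1 M hM, hf'.2⟩
  mid f hf f' hf' M hM := (hc M hM).mid f (hf M hM) f' (hf' M hM)
  translate f hf h M hM := (hc M hM).translate f (hf M hM) h
  mollify f hf M hM := (hc M hM).mollify f (hf M hM)

theorem IsStable.forall_of_minimal {M : Set (G → X)} (hM : Minimal (IsStable hX Γ p ι mH ν f₀) M)
    {P : (G → X) → Prop} (nonempty : ∃ f ∈ M, P f)
    (closed : ∀ f ∈ M, (∀ ε > 0, ∃ f' ∈ M, P f' ∧ ∀ g, dist (f g) (f' g) ≤ ε) → P f)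
    (mid : ∀ f ∈ M, ∀ f' ∈ M, P f → P f' → P fun g => hX.mid (f g) (f' g))
    (translate : ∀ f ∈ M, P f → ∀ h, P (CAT0.translate ι h f))
    (mollify : ∀ f ∈ M, P f → P (CAT0.mollify mH ν ι f)) {f : G → X} (hf : f ∈ M) : P f := by
  have hMs := hM.prop
  refine (hM.le_of_le (y := {f ∈ M | P f}) ⟨nonempty, fun f hf => hMs.admissible f hf.1, ?_, ?_,
    ?_, ?_⟩ (fun f hf => hf.1) hf).2
  · intro f hf
    have hfM : f ∈ M := hMs.closed f fun ε hε => (hf ε hε).imp fun _ hf' => ⟨hf'.1.1, hf'.2⟩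
    exact ⟨hfM, closed f hfM fun ε hε => (hf ε hε).imp fun _ hf' => and_assoc.1 hf'⟩
  · exact fun f hf f' hf' => ⟨hMs.mid f hf.1 f' hf'.1, mid f hf.1 f' hf'.1 hf.2 hf'.2⟩
  · exact fun f hf h => ⟨hMs.translate f hf.1 h, translate f hf.1 hf.2 h⟩
  · exact fun f hf => ⟨hMs.mollify f hf.1, mollify f hf.1 hf.2⟩

theorem IsAveragingSetup.isStable_setOf_isAdmissible [ProperSpace X] [MeasurableSpace G]
    {m : Measure G} {w : G → ℝ} [TopologicalSpace H] [OpensMeasurableSpace H]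
    [IsFiniteMeasureOnCompacts mH] [IsTopologicalGroup G] [LocallyCompactSpace G]
    [IsIsometricSMul Γ X] (S : IsAveragingSetup Γ p ι m mH w ν f₀)
    (hX : IsCAT0 X) : IsStable hX Γ p ι mH ν f₀ {f | IsAdmissible Γ p f₀ f} where
  nonempty := ⟨f₀, S.base, fun k _ g => S.base.dist_mul_le_displacement S.lattice g k⟩
  admissible _ hf := hf
  closed _ hf := .of_approx hf
  mid _ hf _ hf' := hf.mid hf'
  translate _ hf h := hf.translate S.splitting h
  mollify _ hf := hf.mollify hX S.splitting S.kernel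

end Stable

section Chain

open Filter Topology MeasureTheory

variable {X : Type*} [MetricSpace X] {G : Type*} [MeasurableSpace G] {m : Measure G} {w : G → ℝ}
  {f₀ : G → X}

/-- The squared distance of `f₀` to a set of maps. -/
noncomputable def infMeanSq (m : Measure G) (w : G → ℝ) (f₀ : G → X) (M : Set (G → X)) : ℝ :=
  sInf (meanSq m w f₀ '' M)

theorem exists_meanSq_lt {M : Set (G → X)} (hM : M.Nonempty) {b : ℝ}
    (hb : infMeanSq m w f₀ M < b) : ∃ f ∈ M, meanSq m w f₀ f < b := by
  obtain ⟨_, ⟨f, hf, rfl⟩, h⟩ := exists_lt_of_csInf_lt (hM.image (meanSq m w f₀)) hb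
  exact ⟨f, hf, h⟩

/-- For a chain `c` of sets of maps whose distances to `f₀` have the supremum `√R`: the elements
of members of `c` such that they and the member containing them are almost at distance `√R`. -/
def nearMinimizers (m : Measure G) (w : G → ℝ) (f₀ : G → X) (c : Set (Set (G → X))) (ε : ℝ) :
    Set (G → X) :=
  {f | meanSq m w f₀ f ≤ sSup (infMeanSq m w f₀ '' c) + ε ∧
    ∃ M ∈ c, f ∈ M ∧ sSup (infMeanSq m w f₀ '' c) ≤ infMeanSq m w f₀ M + ε}

theorem nearMinimizers_mono {c : Set (Set (G → X))} : Monotone (nearMinimizers m w f₀ c) := by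
  rintro ε δ hεδ f ⟨hf, M, hM, hfM, hR⟩
  exact ⟨by linarith, M, hM, hfM, by linarith⟩

variable [Group G] [TopologicalSpace G] {Γ : Subgroup G}

theorem IsWeight.infMeanSq_le (hw : IsWeight Γ w) {M : Set (G → X)} {f : G → X} (hf : f ∈ M) :
    infMeanSq m w f₀ M ≤ meanSq m w f₀ f :=
  csInf_le ⟨0, by rintro _ ⟨f, -, rfl⟩; exact hw.meanSq_nonneg _ _⟩ ⟨f, hf, rfl⟩

theorem IsWeight.infMeanSq_anti (hw : IsWeight Γ w) {M M' : Set (G → X)} (h : M ⊆ M')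
    (hM : M.Nonempty) : infMeanSq m w f₀ M' ≤ infMeanSq m w f₀ M :=
  le_csInf (hM.image _) (by rintro _ ⟨f, hf, rfl⟩; exact hw.infMeanSq_le (h hf))

theorem IsWeight.exists_mem_nearMinimizers (hw : IsWeight Γ w) {c : Set (Set (G → X))}
    (hchain : IsChain (· ⊆ ·) c) (hne : ∀ M ∈ c, M.Nonempty)
    (hb : BddAbove (infMeanSq m w f₀ '' c)) {M : Set (G → X)} (hM : M ∈ c) {ε : ℝ} (hε : 0 < ε) :
    ∃ f ∈ M, f ∈ nearMinimizers m w f₀ c ε := by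
  obtain ⟨M', hM', hM'M, hR⟩ : ∃ M' ∈ c, M' ⊆ M ∧
      sSup (infMeanSq m w f₀ '' c) ≤ infMeanSq m w f₀ M' + ε := by
    obtain ⟨_, ⟨M₁, hM₁, rfl⟩, hlt⟩ := exists_lt_of_lt_csSup (Set.image_nonempty.2 ⟨M, hM⟩)
      (sub_lt_self (sSup (infMeanSq m w f₀ '' c)) hε)
    rcases hchain.total hM₁ hM with hsub | hsub
    · exact ⟨M₁, hM₁, hsub, by linarith⟩
    · exact ⟨M, hM, subset_rfl, by linarith [hw.infMeanSq_anti (m := m) (f₀ := f₀) hsub (hne M hM)]⟩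
  obtain ⟨f, hf, hlt⟩ := exists_meanSq_lt (hne M' hM')
    (lt_add_of_le_of_pos (le_csSup hb ⟨M', hM', rfl⟩) hε)
  exact ⟨f, hM'M hf, hlt.le, M', hM', hf, hR⟩

theorem IsWeight.meanSq_le_of_mem_nearMinimizers (hw : IsWeight Γ w) [BorelSpace G]
    [IsFiniteMeasureOnCompacts m] [MulAction Γ X] [Nonempty X] {H : Type*} [Group H]
    [MeasurableSpace H] {mH : Measure H} {p : G →* H} {ι : H →* G} {ν : H → ℝ} {hX : IsCAT0 X}
    (hf₀ : Continuous f₀) {c : Set (Set (G → X))} (hc : ∀ M ∈ c, IsStable hX Γ p ι mH ν f₀ M)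
    (hchain : IsChain (· ⊆ ·) c) {ε : ℝ} {f f' : G → X} (hf : f ∈ nearMinimizers m w f₀ c ε)
    (hf' : f' ∈ nearMinimizers m w f₀ c ε) : meanSq m w f f' ≤ 8 * ε := by
  obtain ⟨hfε, M, hM, hfM, hMε⟩ := hf
  obtain ⟨hfε', M', hM', hfM', hMε'⟩ := hf'
  obtain ⟨N, hN, hfN, hfN', hNε⟩ : ∃ N ∈ c, f ∈ N ∧ f' ∈ N ∧
      sSup (infMeanSq m w f₀ '' c) ≤ infMeanSq m w f₀ N + ε := by
    rcases hchain.total hM hM' with hsub | hsub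
    · exact ⟨M', hM', hsub hfM, hfM', hMε'⟩
    · exact ⟨M, hM, hfM, hsub hfM', hMε⟩
  have hNs := hc N hN
  have mid_le := hw.meanSq_mid_le (m := m) hX hf₀
    (hNs.admissible f hfN).equivariant.continuous (hNs.admissible f' hfN').equivariant.continuous
  linarith [hw.infMeanSq_le (m := m) (f₀ := f₀) (hNs.mid f hfN f' hfN')]

end Chain

section Minimal

open Filter Topology MeasureTheory

variable {X : Type*} [MetricSpace X] [Nonempty X]
  {G : Type*} [Group G] [TopologicalSpace G] [IsTopologicalGroup G] [T2Space G]
  [MeasurableSpace G] [BorelSpace G] {m : Measure G} [m.IsHaarMeasure] {Γ : Subgroup G}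
  [MulAction Γ X] [IsIsometricSMul Γ X] {H : Type*} [Group H] [TopologicalSpace H]
  [MeasurableSpace H] {mH : Measure H} {p : G →* H} {ι : H →* G} {w : G → ℝ} {ν : H → ℝ}
  {f₀ : G → X} {hX : IsCAT0 X}

namespace IsAveragingSetup

variable (S : IsAveragingSetup Γ p ι m mH w ν f₀)

include S

theorem hasControlledDisplacement {M : Set (G → X)} (hM : IsStable hX Γ p ι mH ν f₀ M)
    {f : G → X} (hf : f ∈ M) (hfM : meanSq m w f₀ f ≤ infMeanSq m w f₀ M + 1) :
    HasControlledDisplacement ι m w f₀ f := by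
  intro h
  have hw := S.weight
  have := S.lattice.discrete
  have equiv : ∀ f ∈ M, IsEquivariantMap Γ f := fun f hf => (hM.admissible f hf).equivariant
  have hq := hM.translate f hf h
  have hmid := hM.mid f hf _ hq
  have hmid' := hM.translate _ hmid h⁻¹
  have ac := S.base.continuous
  have bc := (S.base.translate (ι := ι) h).continuous
  have fc := (equiv f hf).continuous
  have qc := (equiv _ hq).continuous
  have mid_f₀ := (hw.infMeanSq_le hmid).trans (hw.meanSq_mid_le (m := m) hX ac fc qc)
  have mid_translate := (hw.infMeanSq_le (m := m) (f₀ := f₀) hmid').trans_eq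
    (hw.meanSq_translate (ι := ι) S.base (equiv _ hmid') h).symm
  rw [← translate_mul, mul_inv_cancel, translate_one] at mid_translate
  have mid_translate' := mid_translate.trans (hw.meanSq_mid_le hX bc fc qc)
  have translate_eq := hw.meanSq_translate (m := m) (ι := ι) S.base (equiv f hf) h
  linarith [hw.meanSq_add_meanSq_le (m := m) hX ac bc fc qc]

variable [ProperSpace X] [LocallyCompactSpace G]
  (hno : ¬ ∃ ξ : Boundary X, ∀ γ : Γ, γ • ξ = ξ)

include hno

theorem bddAbove_infMeanSq {c : Set (Set (G → X))} (hc : ∀ M ∈ c, IsStable hX Γ p ι mH ν f₀ M) :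
    BddAbove (infMeanSq m w f₀ '' c) := by
  by_contra hb
  simp only [not_bddAbove_iff, Set.exists_mem_image] at hb
  choose M hMc hMn using fun n : ℕ => hb n
  choose f hf hfr using fun n => exists_meanSq_lt (m := m) (w := w) (f₀ := f₀)
    (hc _ (hMc n)).nonempty (lt_add_one _)
  refine hno (S.exists_fixed_boundary hX (fun n => (hc _ (hMc n)).admissible _ (hf n))
    (fun n => S.hasControlledDisplacement (hc _ (hMc n)) (hf n) (hfr n).le) ?_)
  exact tendsto_atTop_mono (fun n => (hMn n).le.trans (S.weight.infMeanSq_le (hf n)))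
    tendsto_natCast_atTop_atTop

variable [IsTopologicalGroup H] [LocallyCompactSpace H] [BorelSpace H] [mH.IsHaarMeasure]

-- Near-minimizers are Cauchy in mean square, so that their mollifications are uniformly Cauchy.
theorem sInter_nonempty {c : Set (Set (G → X))} (hc : ∀ M ∈ c, IsStable hX Γ p ι mH ν f₀ M)
    (hchain : IsChain (· ⊆ ·) c) (hne : c.Nonempty) : (⋂₀ c).Nonempty := by
  have hb := S.bddAbove_infMeanSq hno hc
  have near : ∀ M ∈ c, ∀ ε > 0, ∃ f ∈ M, f ∈ nearMinimizers m w f₀ c ε := fun M hM ε hε =>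
    S.weight.exists_mem_nearMinimizers hchain (fun M hM => (hc M hM).nonempty) hb hM hε
  have close : ∀ ε > 0, ∃ δ > 0, ∀ M ∈ c, ∀ M' ∈ c, ∀ f ∈ M, ∀ f' ∈ M',
      f ∈ nearMinimizers m w f₀ c δ → f' ∈ nearMinimizers m w f₀ c δ →
        ∀ g, dist (mollify mH ν ι f g) (mollify mH ν ι f' g) ≤ ε := by
    intro ε hε
    obtain ⟨δ, hδ, h⟩ := S.exists_forall_dist_mollify_le hX hε
    refine ⟨δ / 8, by positivity, fun M hM M' hM' f hf f' hf' hn hn' =>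
      h f f' ((hc M hM).admissible f hf) ((hc M' hM').admissible f' hf') ?_⟩
    linarith [S.weight.meanSq_le_of_mem_nearMinimizers S.base.continuous hc hchain hn hn']
  obtain ⟨M₀, hM₀⟩ := hne
  choose f hf hfn using fun n : ℕ => near M₀ hM₀ (1 / (n + 1)) Nat.one_div_pos_of_nat
  have hfn' : ∀ δ > 0, ∀ᶠ n in atTop, f n ∈ nearMinimizers m w f₀ c δ := fun δ hδ =>
    (tendsto_one_div_add_atTop_nhds_zero_nat.eventually_lt_const hδ).mono fun n hn =>
      nearMinimizers_mono hn.le (hfn n)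
  have cauchy : ∀ g, CauchySeq fun n => mollify mH ν ι (f n) g := by
    refine fun g => Metric.cauchySeq_iff'.2 fun ε hε => ?_
    obtain ⟨δ, hδ, h⟩ := close (ε / 2) (half_pos hε)
    obtain ⟨N, hN⟩ := eventually_atTop.1 (hfn' δ hδ)
    exact ⟨N, fun n hn => (h M₀ hM₀ M₀ hM₀ _ (hf n) _ (hf N) (hN n hn) (hN N le_rfl) g).trans_lt
      (half_lt_self hε)⟩
  choose F hF using fun g => cauchySeq_tendsto_of_complete (cauchy g)
  refine ⟨F, fun M hM => (hc M hM).closed F fun ε hε => ?_⟩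
  obtain ⟨δ, hδ, h⟩ := close ε hε
  obtain ⟨f', hf', hfn''⟩ := near M hM δ hδ
  refine ⟨_, (hc M hM).mollify f' hf', fun g =>
    le_of_tendsto ((hF g).dist tendsto_const_nhds) ?_⟩
  filter_upwards [hfn' δ hδ] with n hn
  exact h M₀ hM₀ M hM _ (hf n) f' hf' hn hfn'' g

theorem exists_minimal_isStable (hX : IsCAT0 X) :
    ∃ M : Set (G → X), Minimal (IsStable hX Γ p ι mH ν f₀) M := by
  obtain ⟨M, -, hM⟩ := zorn_superset_nonempty {M | IsStable hX Γ p ι mH ν f₀ M}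
    (fun c hc hchain hne => ⟨⋂₀ c, .sInter hc hne (S.sInter_nonempty hno hc hchain hne),
      fun M hM => Set.sInter_subset_of_mem hM⟩) _ (S.isStable_setOf_isAdmissible hX)
  exact ⟨M, hM⟩

end IsAveragingSetup

end Minimal

section KernelDisplacement

open Filter Topology MeasureTheory

variable {X : Type*} [MetricSpace X] {G : Type*} [Group G] [TopologicalSpace G]
  [IsTopologicalGroup G] [MeasurableSpace G] [BorelSpace G] {m : Measure G} {Γ : Subgroup G}
  {w : G → ℝ} {f f' : G → X} {k : G}

theorem IsWeight.meanSq_mul_mid_add_le [IsFiniteMeasureOnCompacts m] (hw : IsWeight Γ w)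
    (hX : IsCAT0 X) (hf : Continuous f) (hf' : Continuous f') :
    meanSq m w (fun g => hX.mid (f g) (f' g)) (fun g => hX.mid (f (g * k)) (f' (g * k))) +
        1 / 4 * ∫ g, w g * (dist (f g) (f' g) - dist (f (g * k)) (f' (g * k))) ^ 2 ∂m ≤
      1 / 2 * meanSq m w f (fun g => f (g * k)) +
        1 / 2 * meanSq m w f' (fun g => f' (g * k)) := by
  have hmid : Continuous fun g => hX.mid (f g) (f' g) := hX.continuous_mid.comp (hf.prodMk hf')
  have hmid' : Continuous fun g => hX.mid (f (g * k)) (f' (g * k)) :=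
    hmid.comp (continuous_mul_const k)
  simp only [meanSq]
  rw [← hw.integral_mul_add (by fun_prop) (by fun_prop), ← one_mul (∫ g, _ ∂m),
    ← hw.integral_mul_add (by fun_prop) (by fun_prop)]
  refine hw.integral_mul_mono (by fun_prop) (by fun_prop) fun g => ?_
  linarith [hX.sq_dist_mid_mid_le (f g) (f' g) (f (g * k)) (f' (g * k))]

variable [MulAction Γ X] {H : Type*} [Group H] [TopologicalSpace H] [MeasurableSpace H]
  {p : G →* H} {ι : H →* G} {mH : Measure H} {ν : H → ℝ} {f₀ : G → X}

namespace IsAveragingSetup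

variable (S : IsAveragingSetup Γ p ι m mH w ν f₀)

include S

theorem meanSq_mul_le_of_approx [IsFiniteMeasureOnCompacts m] (hk : p k = 1)
    (hf : Continuous f) {C : ℝ} (happrox : ∀ ε > 0, ∃ f', IsAdmissible Γ p f₀ f' ∧
      meanSq m w f' (fun g => f' (g * k)) ≤ C ∧ ∀ g, dist (f g) (f' g) ≤ ε) :
    meanSq m w f (fun g => f (g * k)) ≤ C := by
  refine le_of_forall_pos_le_add fun ε hε => ?_
  set D := displacement f₀ k
  have hD : 0 ≤ D := displacement_nonneg _ _
  set η := min 1 (ε / (4 * D + 4))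
  have hη0 : 0 < η := lt_min one_pos (by positivity)
  have hη : η * (4 * D + 4) ≤ ε := (le_div_iff₀ (by positivity)).1 (min_le_right _ _)
  obtain ⟨f', hf', hC, hd⟩ := happrox η hη0
  have hc' := hf'.equivariant.continuous
  have sq_le : ∀ g, dist (f g) (f (g * k)) ^ 2 ≤ dist (f' g) (f' (g * k)) ^ 2 + ε := by
    intro g
    have htri := dist_triangle4 (f g) (f' g) (f' (g * k)) (f (g * k))
    rw [dist_comm (f' (g * k)) (f (g * k))] at htri
    calc dist (f g) (f (g * k)) ^ 2 ≤ (dist (f' g) (f' (g * k)) + 2 * η) ^ 2 :=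
          pow_le_pow_left₀ dist_nonneg (by linarith [hd g, hd (g * k)]) 2
      _ = dist (f' g) (f' (g * k)) ^ 2 + η * (4 * dist (f' g) (f' (g * k)) + 4 * η) := by ring
      _ ≤ dist (f' g) (f' (g * k)) ^ 2 + η * (4 * D + 4 * 1) := by
          gcongr
          · exact hf'.dist_le k hk g
          · exact min_le_left _ _
      _ ≤ _ := by linarith
  calc meanSq m w f (fun g => f (g * k))
      ≤ ∫ g, w g * (1 * dist (f' g) (f' (g * k)) ^ 2 + ε * 1) ∂m :=
        S.weight.integral_mul_mono (by fun_prop) (by fun_prop) fun g => by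
          linarith [sq_le g]
    _ = meanSq m w f' (fun g => f' (g * k)) + ε := by
        rw [S.weight.integral_mul_add (by fun_prop) (by fun_prop)]
        simp only [mul_one, S.weight_one, one_mul, meanSq]
    _ ≤ C + ε := by gcongr

variable [IsIsometricSMul Γ X] [T2Space G] [m.IsHaarMeasure]

theorem meanSq_translate_mul (hk : p k = 1) (hf : IsEquivariantMap Γ f) (h : H) :
    meanSq m w (translate ι h f) (fun g => translate ι h f (g * k)) =
      meanSq m w f (fun g => f (g * k)) := by
  have := S.lattice.discrete
  have hfk : IsEquivariantMap Γ fun g => f (g * k) := hf.translate (ι := MonoidHom.id G) k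
  rw [← S.weight.meanSq_translate (ι := ι) hf hfk h]
  congr 1
  ext g
  simp only [translate, mul_assoc, S.splitting.comm h k hk]

variable [BorelSpace H] [mH.IsHaarMeasure] [ProperSpace X] [Nonempty X]

theorem meanSq_mollify_mul_le (hX : IsCAT0 X) (hk : p k = 1) (hf : IsEquivariantMap Γ f) :
    meanSq m w (mollify mH ν ι f) (fun g => mollify mH ν ι f (g * k)) ≤
      meanSq m w f (fun g => f (g * k)) := by
  have := S.lattice.discrete
  have hc := hf.continuous
  have hι := S.splitting.continuous_incl
  have hmol := hX.continuous_mollify S.kernel hι hc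
  calc meanSq m w (mollify mH ν ι f) (fun g => mollify mH ν ι f (g * k))
      ≤ ∫ g, w g * (∫ q, ν q * dist (f (g * ι q)) (f (g * ι q * k)) ^ 2 ∂mH) ∂m := by
        refine S.weight.integral_mul_mono (by fun_prop) (continuous_integral_mul
          S.kernel.continuous S.kernel.hasCompactSupport
          (Φ := fun g q => dist (f (g * ι q)) (f (g * ι q * k)) ^ 2)
          (by unfold Function.uncurry; fun_prop)) fun g => ?_
        simp only [mul_assoc, S.splitting.comm _ k hk]
        simp only [← mul_assoc]
        exact hX.sq_dist_mollify_mollify_le S.kernel hι hc hc g (g * k)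
    _ = meanSq m w f (fun g => f (g * k)) := by
        rw [S.weight.integral_mul_average (φ := fun g => dist (f g) (f (g * k)) ^ 2)
          (by fun_prop) (fun γ g => by rw [mul_assoc, hf.dist_mul hf]) hι S.kernel.continuous
          S.kernel.hasCompactSupport, S.kernel.integral_eq_one, one_mul]
        rfl

end IsAveragingSetup

end KernelDisplacement

section Rigidity

open Filter Topology MeasureTheory

variable {X : Type*} [MetricSpace X] [ProperSpace X] [Nonempty X]
  {G : Type*} [Group G] [TopologicalSpace G] [IsTopologicalGroup G] [T2Space G]
  [MeasurableSpace G] [BorelSpace G] {m : Measure G} [m.IsHaarMeasure]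
  {Γ : Subgroup G} [MulAction Γ X] [IsIsometricSMul Γ X]
  {H : Type*} [Group H] [TopologicalSpace H] [MeasurableSpace H] [BorelSpace H]
  {mH : Measure H} [mH.IsHaarMeasure]
  {p : G →* H} {ι : H →* G} {w : G → ℝ} {ν : H → ℝ} {f₀ : G → X} {hX : IsCAT0 X}
  {M : Set (G → X)} {f f' : G → X}

namespace IsAveragingSetup

variable (S : IsAveragingSetup Γ p ι m mH w ν f₀) (hM : Minimal (IsStable hX Γ p ι mH ν f₀) M)

include S hM

theorem meanSq_mul_le {k : G} (hk : p k = 1) (hf : f ∈ M) (hf' : f' ∈ M) :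
    meanSq m w f (fun g => f (g * k)) ≤ meanSq m w f' (fun g => f' (g * k)) := by
  have adm := hM.prop.admissible
  have cont : ∀ f ∈ M, Continuous f := fun f hf => (adm f hf).equivariant.continuous
  refine IsStable.forall_of_minimal (P := fun f => meanSq m w f (fun g => f (g * k)) ≤
    meanSq m w f' (fun g => f' (g * k))) hM ⟨f', hf', le_rfl⟩ ?_ ?_ ?_ ?_ hf
  · intro f hf happrox
    refine S.meanSq_mul_le_of_approx hk (cont f hf) fun ε hε => ?_
    obtain ⟨f'', hf'', h⟩ := happrox ε hε
    exact ⟨f'', adm f'' hf'', h⟩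
  · intro f₁ h₁ f₂ h₂ hle₁ hle₂
    have hmid := S.weight.meanSq_mul_mid_add_le (m := m) (k := k) hX (cont f₁ h₁) (cont f₂ h₂)
    have hnn : 0 ≤ ∫ g, w g * (dist (f₁ g) (f₂ g) - dist (f₁ (g * k)) (f₂ (g * k))) ^ 2 ∂m :=
      integral_nonneg fun g => mul_nonneg (S.weight.nonneg g) (sq_nonneg _)
    linarith
  · exact fun f hf hle h => (S.meanSq_translate_mul hk (adm f hf).equivariant h).trans_le hle
  · exact fun f hf hle => (S.meanSq_mollify_mul_le hX hk (adm f hf).equivariant).trans hle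

theorem dist_mul_eq {k : G} (hk : p k = 1) (hf : f ∈ M) (hf' : f' ∈ M) (g : G) :
    dist (f (g * k)) (f' (g * k)) = dist (f g) (f' g) := by
  have he := (hM.prop.admissible f hf).equivariant
  have he' := (hM.prop.admissible f' hf').equivariant
  have hc := he.continuous
  have hc' := he'.continuous
  have hmid := hM.prop.mid f hf f' hf'
  have hle := S.weight.meanSq_mul_mid_add_le (m := m) (k := k) hX hc hc'
  have nonneg : 0 ≤ fun g => (dist (f g) (f' g) - dist (f (g * k)) (f' (g * k))) ^ 2 :=
    fun g => sq_nonneg _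
  have integral_eq_zero :
      ∫ g, w g * (dist (f g) (f' g) - dist (f (g * k)) (f' (g * k))) ^ 2 ∂m = 0 := by
    refine le_antisymm ?_ (integral_nonneg fun g => mul_nonneg (S.weight.nonneg g) (nonneg g))
    linarith [S.meanSq_mul_le hM hk hf hmid, S.meanSq_mul_le hM hk hf' hmid]
  have hzero := S.weight.eq_zero_of_integral_mul_eq_zero (by fun_prop)
    (fun γ g => by simp only [mul_assoc, he.dist_mul he']) nonneg integral_eq_zero g
  exact (sub_eq_zero.1 (pow_eq_zero_iff two_ne_zero |>.1 hzero)).symm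

-- `dist (f g) (f' g)` is invariant under `Γ` and depends only on `p g`; but `p '' Γ` is dense.
theorem dist_eq_dist_one (hf : f ∈ M) (hf' : f' ∈ M) (g : G) :
    dist (f g) (f' g) = dist (f 1) (f' 1) := by
  have he := (hM.prop.admissible f hf).equivariant
  have he' := (hM.prop.admissible f' hf').equivariant
  have hc := he.continuous
  have hc' := he'.continuous
  have hι := S.splitting.continuous_incl
  have dist_incl_proj : ∀ g, dist (f (ι (p g))) (f' (ι (p g))) = dist (f g) (f' g) := by
    intro g
    have h := S.dist_mul_eq hM (S.splitting.proj_inv_incl_mul g) hf hf' (ι (p g))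
    rw [mul_inv_cancel_left] at h
    exact h.symm
  have hclosed : IsClosed {h : H | dist (f (ι h)) (f' (ι h)) = dist (f 1) (f' 1)} :=
    isClosed_eq (by fun_prop) continuous_const
  have dist_incl : ∀ h : H, dist (f (ι h)) (f' (ι h)) = dist (f 1) (f' 1) := by
    refine fun h => hclosed.closure_subset_iff.2 ?_ (S.splitting.dense h)
    rintro _ ⟨γ, hγ, rfl⟩
    have h := he.dist_mul he' ⟨γ, hγ⟩ 1 1
    simp only [mul_one] at h
    exact (dist_incl_proj γ).trans h
  rw [← dist_incl_proj, dist_incl]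

theorem dist_one_le_of_dist_one_le {f₀' : G → X} (hf₀' : f₀' ∈ M) {r : ℝ}
    (hr : ∀ f ∈ M, dist (f₀' 1) (f 1) ≤ r) (hf : f ∈ M) (hf' : f' ∈ M) :
    dist (f 1) (f' 1) ≤ r := by
  have hMs := hM.prop
  have hι := S.splitting.continuous_incl
  have dist_incl_le : ∀ f ∈ M, (∀ f' ∈ M, dist (f 1) (f' 1) ≤ r) → ∀ h, ∀ f' ∈ M,
      dist (f (ι h)) (f' 1) ≤ r := by
    intro f hf hfr h f' hf'
    have hf'' := hMs.translate f' hf' h⁻¹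
    have hdist := S.dist_eq_dist_one hM hf hf'' (ι h)
    simp only [translate, map_inv, mul_inv_cancel] at hdist
    rw [hdist]
    simpa only [translate, map_inv] using hfr _ hf''
  refine IsStable.forall_of_minimal (P := fun f => ∀ f' ∈ M, dist (f 1) (f' 1) ≤ r) hM
    ⟨f₀', hf₀', hr⟩ ?_ ?_ ?_ ?_ hf f' hf'
  · refine fun f _ happrox f' hf' => le_of_forall_pos_le_add fun ε hε => ?_
    obtain ⟨f'', _, hfr, hd⟩ := happrox ε hε
    linarith [dist_triangle (f 1) (f'' 1) (f' 1), hd 1, hfr f' hf']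
  · intro f₁ _ f₂ _ hr₁ hr₂ f' hf'
    have h := hX.dist_mid_mid_le (f₁ 1) (f₂ 1) (f' 1) (f' 1)
    rw [hX.mid_self] at h
    linarith [hr₁ f' hf', hr₂ f' hf']
  · intro f hf hfr h f' hf'
    simpa only [translate, one_mul] using dist_incl_le f hf hfr h f' hf'
  · intro f hf hfr f' hf'
    have hc := (hMs.admissible f hf).equivariant.continuous
    refine le_of_sq_le_sq ?_ (dist_nonneg.trans (hr f' hf'))
    refine (hX.sq_dist_bary_le (S.kernel.hasSecondMoment
      (f := fun q => f (1 * ι q)) (by fun_prop)) (f' 1)).trans ?_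
    refine S.kernel.integral_mul_le (by fun_prop) fun q => ?_
    rw [one_mul, dist_comm]
    exact pow_le_pow_left₀ dist_nonneg (dist_incl_le f hf hfr q f' hf') 2

-- If `f ≠ f'`, then the midpoint of `f` and `f'` is too close to all elements of `M`.
theorem eq_of_isBounded (hb : Bornology.IsBounded ((fun f : G → X => f 1) '' M)) (hf : f ∈ M)
    (hf' : f' ∈ M) : f = f' := by
  set D := Metric.diam ((fun f : G → X => f 1) '' M)
  set d := dist (f 1) (f' 1) with hd
  have hD : ∀ f ∈ M, ∀ f' ∈ M, dist (f 1) (f' 1) ≤ D := fun f hf f' hf' =>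
    Metric.dist_le_diam_of_mem hb ⟨f, hf, rfl⟩ ⟨f', hf', rfl⟩
  have hD0 : 0 ≤ D := Metric.diam_nonneg
  have mid_sq_le : ∀ f'' ∈ M, dist (hX.mid (f 1) (f' 1)) (f'' 1) ^ 2 ≤ D ^ 2 - d ^ 2 / 4 := by
    intro f'' hf''
    have h := pow_le_pow_left₀ dist_nonneg (hD f hf f'' hf'') 2
    have h' := pow_le_pow_left₀ dist_nonneg (hD f' hf' f'' hf'') 2
    linarith [hX.sq_dist_mid_le (f 1) (f' 1) (f'' 1)]
  have nonneg := (sq_nonneg _).trans (mid_sq_le f hf)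
  have D_le : D ≤ √(D ^ 2 - d ^ 2 / 4) := by
    refine Metric.diam_le_of_forall_dist_le (Real.sqrt_nonneg _) ?_
    rintro _ ⟨f₁, h₁, rfl⟩ _ ⟨f₂, h₂, rfl⟩
    exact S.dist_one_le_of_dist_one_le hM (hM.prop.mid f hf f' hf')
      (fun f hf => Real.le_sqrt_of_sq_le (mid_sq_le f hf)) h₁ h₂
  have sq_le := pow_le_pow_left₀ hD0 D_le 2
  rw [Real.sq_sqrt nonneg] at sq_le
  have d_eq_zero : d = 0 := pow_eq_zero_iff two_ne_zero |>.1 (by linarith [sq_nonneg d])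
  ext g
  rw [← dist_eq_zero, S.dist_eq_dist_one hM hf hf' g, ← hd, d_eq_zero]

theorem isClosed_image_eval_one : IsClosed ((fun f : G → X => f 1) '' M) := by
  refine isClosed_of_closure_subset fun a ha => ?_
  obtain ⟨x, hx, hxa⟩ := mem_closure_iff_seq_limit.1 ha
  choose f hf hfx using hx
  have dist_apply : ∀ n k g, dist (f n g) (f k g) = dist (x n) (x k) := fun n k g => by
    rw [S.dist_eq_dist_one hM (hf n) (hf k) g, ← hfx n, ← hfx k]
  have hlim : ∀ g, ∃ y, Tendsto (fun n => f n g) atTop (𝓝 y) := by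
    refine fun g => cauchySeq_tendsto_of_complete (Metric.cauchySeq_iff.2 ?_)
    simpa only [dist_apply] using Metric.cauchySeq_iff.1 hxa.cauchySeq
  choose F hF using hlim
  have dist_limit : ∀ n g, dist (F g) (f n g) = dist a (x n) := fun n g => by
    refine tendsto_nhds_unique ((hF g).dist tendsto_const_nhds) ?_
    simpa only [dist_apply] using hxa.dist tendsto_const_nhds
  refine ⟨F, hM.prop.closed F fun ε hε => ?_, tendsto_nhds_unique (hF 1) ?_⟩
  · obtain ⟨n, hn⟩ := (Metric.tendsto_nhds.1 hxa ε hε).exists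
    refine ⟨f n, hf n, fun g => ?_⟩
    rw [dist_limit, dist_comm]
    exact hn.le
  · simpa only [hfx] using hxa

end IsAveragingSetup

end Rigidity

/-! ### Products -/

section Dichotomy

open Filter Topology MeasureTheory

theorem IsCAT0.exists_extendsOn_of_injective {Γ H X Y : Type*} [Group Γ] [Group H]
    [TopologicalSpace H] [MetricSpace X] [ProperSpace X] [MulAction Γ X] [IsIsometricSMul Γ X]
    [MulAction H Y] {φ : Γ →* H} (hX : IsCAT0 X) {e : Y → X} (he : Function.Injective e)
    (hdist : ∀ (h : H) (y y' : Y), dist (e (h • y)) (e (h • y')) = dist (e y) (e y'))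
    (hb : ¬ Bornology.IsBounded (Set.range e)) (hcl : IsClosed (Set.range e))
    (hmid : hX.MidClosed (Set.range e)) (hcont : ∀ y : Y, Continuous fun h : H => e (h • y))
    (hφ : ∀ γ : Γ, ∃ K, ∀ y, dist (γ • e y) (e (φ γ • y)) ≤ K) :
    ∃ C : Set (Boundary X), ExtendsOn φ C := by
  let : MetricSpace Y := MetricSpace.induced e he inferInstance
  have hiso : Isometry e := fun _ _ => rfl
  have : IsIsometricSMul H Y := ⟨fun h => Isometry.of_dist_eq (hdist h)⟩
  have : NoncompactSpace Y := not_compactSpace_iff.1 fun _ =>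
    hb (isCompact_range hiso.continuous).isBounded
  exact ⟨_, hX.extendsOn_range_boundaryMap hiso hcl hmid
    (fun y => hiso.isEmbedding.continuous_iff.2 (hcont y)) hφ⟩

variable {X : Type*} [MetricSpace X] [ProperSpace X] [Nonempty X] {G : Type*} [Group G]
  [TopologicalSpace G] [IsTopologicalGroup G] [T2Space G] {Γ : Subgroup G} [MulAction Γ X]
  {H : Type*} [Group H] {p : G →* H} {ι : H →* G} {f₀ : G → X} {hX : IsCAT0 X}

/-- The action of `H` on a stable set by translation. -/
@[reducible] def IsStable.mulAction [MeasurableSpace H] {mH : Measure H} {ν : H → ℝ}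
    {M : Set (G → X)} (hM : IsStable hX Γ p ι mH ν f₀ M) : MulAction H M where
  smul h f := ⟨CAT0.translate ι h f, hM.translate f f.2 h⟩
  one_smul _ := Subtype.ext translate_one
  mul_smul h h' _ := Subtype.ext (translate_mul h h')

variable [IsIsometricSMul Γ X] [TopologicalSpace H]

section Measure

variable [MeasurableSpace G] [BorelSpace G] {m : Measure G} [m.IsHaarMeasure]
  [MeasurableSpace H] [BorelSpace H] {mH : Measure H} [mH.IsHaarMeasure] {w : G → ℝ} {ν : H → ℝ}

namespace IsAveragingSetup

variable (S : IsAveragingSetup Γ p ι m mH w ν f₀)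

include S

-- Evaluation at `1` embeds a minimal stable set isometrically as a closed convex subset of `X`.
theorem extendsOn_of_not_isBounded {M : Set (G → X)}
    (hM : Minimal (IsStable hX Γ p ι mH ν f₀) M)
    (hb : ¬ Bornology.IsBounded ((fun f : G → X => f 1) '' M)) :
    ∃ C : Set (Boundary X), ExtendsOn (p.comp Γ.subtype) C := by
  have hMs := hM.prop
  let : MulAction H M := hMs.mulAction
  have range_eval : Set.range (fun f : M => (f : G → X) 1) = (fun f : G → X => f 1) '' M :=
    (Set.image_eq_range (fun f : G → X => f 1) M).symm
  have eval_smul : ∀ (h : H) (f : M), ((h • f : M) : G → X) 1 = (f : G → X) (ι h) := fun h f =>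
    congrArg (f : G → X) (one_mul _)
  refine hX.exists_extendsOn_of_injective (e := fun f : M => (f : G → X) 1) (fun f f' h => ?_)
    (fun h f f' => ?_) (by rwa [range_eval]) ?_ ?_ (fun f => ?_) fun γ => ?_
  · refine Subtype.ext <| funext fun g => ?_
    rw [← dist_eq_zero, S.dist_eq_dist_one hM f.2 f'.2, dist_eq_zero]
    exact h
  · simp only [eval_smul]
    exact S.dist_eq_dist_one hM f.2 f'.2 _
  · rw [range_eval]
    exact S.isClosed_image_eval_one hM
  · rintro _ ⟨f, rfl⟩ _ ⟨f', rfl⟩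
    exact ⟨⟨_, hMs.mid f f.2 f' f'.2⟩, rfl⟩
  · have hc := (hMs.admissible f f.2).equivariant.continuous
    have hι := S.splitting.continuous_incl
    simp only [eval_smul]
    fun_prop
  · refine ⟨displacement f₀ ((ι (p γ))⁻¹ * γ), fun f => ?_⟩
    have hf := hMs.admissible f f.2
    have hdist := hf.dist_le _ (S.splitting.proj_inv_incl_mul γ) (ι (p γ))
    rw [mul_inv_cancel_left, ← mul_one (γ : G), hf.equivariant.map_mul, mul_one, dist_comm] at hdist
    exact (congrArg _ (eval_smul _ _)).trans_le hdist

theorem exists_invariant_or_extendsOn [LocallyCompactSpace G] [IsTopologicalGroup H]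
    [LocallyCompactSpace H] (hX : IsCAT0 X) (hno : ¬ ∃ ξ : Boundary X, ∀ γ : Γ, γ • ξ = ξ) :
    (∃ f, IsAdmissible Γ p f₀ f ∧ ∀ h g, f (g * ι h) = f g) ∨
      ∃ C : Set (Boundary X), ExtendsOn (p.comp Γ.subtype) C := by
  obtain ⟨M, hM⟩ := S.exists_minimal_isStable hno hX
  by_cases hb : Bornology.IsBounded ((fun f : G → X => f 1) '' M)
  · obtain ⟨f, hf⟩ := hM.prop.nonempty
    exact .inl ⟨f, hM.prop.admissible f hf, fun h g =>
      congrFun (S.eq_of_isBounded hM hb (hM.prop.translate f hf h) hf) g⟩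
  · exact .inr (S.extendsOn_of_not_isBounded hM hb)

end IsAveragingSetup

end Measure

variable [LocallyCompactSpace G] [IsTopologicalGroup H] [LocallyCompactSpace H]

theorem IsCAT0.exists_invariant_or_extendsOn (hX : IsCAT0 X) (hΓ : IsUniformLattice Γ)
    (hs : IsSplitting Γ p ι) (hf₀ : IsEquivariantMap Γ f₀)
    (hno : ¬ ∃ ξ : Boundary X, ∀ γ : Γ, γ • ξ = ξ) :
    (∃ f, IsAdmissible Γ p f₀ f ∧ ∀ h g, f (g * ι h) = f g) ∨
      ∃ C : Set (Boundary X), ExtendsOn (p.comp Γ.subtype) C := by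
  borelize G H
  obtain ⟨w, hw⟩ := hΓ.exists_isWeight
  obtain ⟨ν, hν⟩ := exists_isKernel (Measure.haar : Measure H)
  have hpos : 0 < ∫ g, w g ∂(Measure.haar : Measure G) := hw.integral_pos
  set c := ∫ g, w g ∂(Measure.haar : Measure G)
  have : (ENNReal.ofReal c⁻¹ • (Measure.haar : Measure G)).IsHaarMeasure :=
    Measure.IsHaarMeasure.smul _ (by simpa using hpos) ENNReal.ofReal_ne_top
  have weight_one : ∫ g, w g ∂(ENNReal.ofReal c⁻¹ • (Measure.haar : Measure G)) = 1 := by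
    rw [integral_smul_measure, ENNReal.toReal_ofReal (inv_nonneg.2 hpos.le), smul_eq_mul]
    exact inv_mul_cancel₀ hpos.ne'
  have S : IsAveragingSetup Γ p ι (ENNReal.ofReal c⁻¹ • (Measure.haar : Measure G))
    Measure.haar w ν f₀ := ⟨hΓ, hs, hw, weight_one, hν, hf₀⟩
  exact S.exists_invariant_or_extendsOn hX hno

end Dichotomy

section Product

variable {I : Type*} {G : I → Type*} [∀ i, Group (G i)]

theorem isSplitting_evalMonoidHom_mulSingle [DecidableEq I] [∀ i, TopologicalSpace (G i)]
    {Γ : Subgroup (∀ i, G i)} {j : I}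
    (hdense : Dense ((fun g : ∀ i, G i => g j) '' (Γ : Set (∀ i, G i)))) :
    IsSplitting Γ (Pi.evalMonoidHom G j) (MonoidHom.mulSingle G j) where
  continuous_proj := continuous_apply j
  continuous_incl := continuous_mulSingle j
  proj_incl h := by simp
  comm h k hk := by
    replace hk : k j = 1 := hk
    ext i
    rcases eq_or_ne i j with rfl | hij
    · simp [hk]
    · simp [Pi.mulSingle_eq_of_ne hij]
  dense := hdense

variable {X : Type*} [MetricSpace X]

theorem displacement_eq_zero_of_dependsOn {f : (∀ i, G i) → X} {s : Set I} (hf : DependsOn f s)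
    {k : ∀ i, G i} (hk : ∀ i ∈ s, k i = 1) : displacement f k = 0 := by
  refine (Real.iSup_nonpos fun g => ?_).antisymm (displacement_nonneg f k)
  rw [hf fun i hi => show g i = (g * k) i by rw [Pi.mul_apply, hk i hi, mul_one], dist_self]

variable [∀ i, TopologicalSpace (G i)] {Γ : Subgroup (∀ i, G i)} [MulAction Γ X]

theorem IsAdmissible.dependsOn_sdiff_singleton [DecidableEq I] {j : I} {f₀ f : (∀ i, G i) → X}
    {s : Set I} (hf : IsAdmissible Γ (Pi.evalMonoidHom G j) f₀ f)
    (hinv : ∀ h g, f (g * MonoidHom.mulSingle G j h) = f g) (hf₀ : DependsOn f₀ s) :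
    DependsOn f (s \ {j}) := by
  intro x y hxy
  set x' := x * MonoidHom.mulSingle G j (x j)⁻¹
  set y' := y * MonoidHom.mulSingle G j (y j)⁻¹
  have hx' : x' j = 1 := by simp [x']
  have hy' : y' j = 1 := by simp [y']
  have hs : ∀ i ∈ s, (x'⁻¹ * y') i = 1 := by
    intro i hi
    rcases eq_or_ne i j with rfl | hij
    · simp [hx', hy']
    · simp [x', y', Pi.mulSingle_eq_of_ne hij, hxy i ⟨hi, hij⟩]
  have hdist := hf.dist_le (x'⁻¹ * y') (by simp [hx', hy']) x'
  rw [mul_inv_cancel_left, displacement_eq_zero_of_dependsOn hf₀ hs, dist_le_zero] at hdist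
  rwa [← hinv (x j)⁻¹ x, ← hinv (y j)⁻¹ y]

theorem IsEquivariantMap.nonempty_of_dependsOn {f : (∀ i, G i) → X} {s : Set I}
    (hf : IsEquivariantMap Γ f) (hs : DependsOn f s) (hfix : ¬ ∃ x : X, ∀ γ : Γ, γ • x = x) :
    s.Nonempty := by
  by_contra! rfl
  exact hfix ⟨f 1, fun γ => (hf.map_mul γ 1).symm.trans (hs.empty _ _)⟩

variable [∀ i, IsTopologicalGroup (G i)] [∀ i, T2Space (G i)] [∀ i, LocallyCompactSpace (G i)]
  [Finite I] [ProperSpace X] [Nonempty X] [IsIsometricSMul Γ X]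

-- In a set of coordinates on which some equivariant map depends, and which is minimal with this
-- property, no coordinate can be dropped by an invariant map.
theorem IsCAT0.exists_extendsOn_evalMonoidHom (hX : IsCAT0 X) (hΓ : IsUniformLattice Γ)
    (hirr : ∀ i, Dense ((fun g : ∀ j, G j => g i) '' (Γ : Set (∀ j, G j))))
    (hfix : ¬ ∃ x : X, ∀ γ : Γ, γ • x = x) :
    ∃ i, ∃ C : Set (Boundary X), ExtendsOn ((Pi.evalMonoidHom G i).comp Γ.subtype) C := by
  classical
  obtain ⟨f₁, hf₁⟩ := hX.exists_isEquivariantMap hΓ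
  obtain ⟨s, ⟨f₀, hf₀, hs⟩, hmin⟩ := exists_minimal_of_wellFoundedLT
    (fun s : Set I => ∃ f : (∀ i, G i) → X, IsEquivariantMap Γ f ∧ DependsOn f s)
    ⟨_, f₁, hf₁, dependsOn_univ f₁⟩
  obtain ⟨j, hj⟩ := hf₀.nonempty_of_dependsOn hs hfix
  refine ⟨j, ?_⟩
  by_cases hξ : ∃ ξ : Boundary X, ∀ γ : Γ, γ • ξ = ξ
  · obtain ⟨ξ, hξ⟩ := hξ
    have := hX.t2Space_boundary
    exact ⟨_, .singleton hξ⟩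
  · refine (hX.exists_invariant_or_extendsOn hΓ (isSplitting_evalMonoidHom_mulSingle (hirr j)) hf₀
      hξ).resolve_left fun ⟨f, hf, hinv⟩ => ?_
    exact (hmin ⟨f, hf.equivariant, hf.dependsOn_sdiff_singleton hinv hs⟩ Set.sdiff_subset hj).2 rfl

end Product

end CAT0

theorem theorem2_general {I : Type*} [Finite I] {G : I → Type*} [∀ i, Group (G i)]
    [∀ i, TopologicalSpace (G i)] [∀ i, IsTopologicalGroup (G i)] [∀ i, T2Space (G i)]
    [∀ i, LocallyCompactSpace (G i)] (Γ : Subgroup (∀ i, G i)) (hΓ : CAT0.IsUniformLattice Γ)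
    (hirr : ∀ i, Dense ((fun g : ∀ j, G j => g i) '' (Γ : Set (∀ j, G j))))
    {X : Type*} [MetricSpace X] [ProperSpace X] [Nonempty X] (hX : CAT0.IsCAT0 X)
    [MulAction Γ X] [IsIsometricSMul Γ X] (hfix : ¬ ∃ x : X, ∀ γ : Γ, γ • x = x) :
    ∃ C : Set (CAT0.Boundary X), C.Nonempty ∧ IsClosed C ∧
      (∀ γ : Γ, ∀ ξ ∈ C, γ • ξ ∈ C) ∧
      ∃ ρ : (∀ i, G i) →* Equiv.Perm C,
        Continuous (fun p : (∀ i, G i) × C => ρ p.1 p.2) ∧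
        (∀ (γ : Γ) (ξ : C), (ρ (γ : ∀ i, G i) ξ : CAT0.Boundary X) = γ • (ξ : CAT0.Boundary X)) ∧
        ∃ (i : I) (ρi : G i →* Equiv.Perm C),
          Continuous (fun p : G i × C => ρi p.1 p.2) ∧
          ρ = ρi.comp (Pi.evalMonoidHom G i) := by
  obtain ⟨i, C, hne, hcl, hinv, ρ, hρ, hργ⟩ := hX.exists_extendsOn_evalMonoidHom hΓ hirr hfix
  have hcont := hρ.comp (((continuous_apply i).comp continuous_fst).prodMk continuous_snd)
  exact ⟨C, hne, hcl, hinv, ρ.comp (Pi.evalMonoidHom G i), hcont, hργ, i, ρ, hρ, rfl⟩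

theorem theorem2 {n : ℕ} {G : Fin n → Type*} [∀ i, Group (G i)] [∀ i, TopologicalSpace (G i)]
    [∀ i, IsTopologicalGroup (G i)] [∀ i, T2Space (G i)] [∀ i, LocallyCompactSpace (G i)]
    [∀ i, SigmaCompactSpace (G i)]
    (Γ : Subgroup (∀ i, G i)) (hΓ : CAT0.IsUniformLattice Γ) (hirr : CAT0.IsIrreducible Γ)
    {X : Type*} [MetricSpace X] [ProperSpace X] [Nonempty X] (hX : CAT0.IsCAT0 X)
    [MulAction Γ X] [IsIsometricSMul Γ X]
    (hfix : ¬ ∃ x : X, ∀ γ : Γ, γ • x = x) :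
    ∃ C : Set (CAT0.Boundary X), C.Nonempty ∧ IsClosed C ∧
      (∀ γ : Γ, ∀ ξ ∈ C, γ • ξ ∈ C) ∧
      ∃ ρ : (∀ i, G i) →* Equiv.Perm C,
        Continuous (fun p : (∀ i, G i) × C => ρ p.1 p.2) ∧
        (∀ (γ : Γ) (ξ : C), (ρ (γ : ∀ i, G i) ξ : CAT0.Boundary X) = γ • (ξ : CAT0.Boundary X)) ∧
        ∃ (i : Fin n) (ρi : G i →* Equiv.Perm C),
          Continuous (fun p : G i × C => ρi p.1 p.2) ∧
          ρ = ρi.comp (Pi.evalMonoidHom G i) :=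
  theorem2_general Γ hΓ hirr hX hfix
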